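/- Let $M$ be a compact smooth Riemannian manifold, with or without boundary, $\dim M=k$, let $m\ge 1$ and $d=k+m\ge 3$. Let $\Gamma\subset\mathbb R^m$ be the lattice generated by a basis $b_1,\dots,b_m$ of $\mathbb R^m$ with $|b_1|=1$, let $\mathbb T=\mathbb R^m/\Gamma$, and let $\Omega$ be the elementary cell $\{\sum_j y_jb_j:\ y_j\in[0,1)\}$. For a real-valued $V$ on $M\times\mathbb T$ and $\zeta\in\mathbb C^m$ let $H(\zeta)$ be the operator in $L_2(M\times\mathbb T)$ of the form $$h(\zeta)[v,v]=\int_{M\times\Omega}\Big(|\nabla_xv|^2+\langle(\nabla_y+i\zeta)v,(\nabla_y+i\overline{\zeta})v\rangle+V|v|^2\Big)\,dx\,dy$$ with form domain $H^1(M\times\mathbb T)$ (Neumann condition; no condition if $\partial M=\emptyset$) or $H^1_0(M\times\mathbb T)$ (Dirichlet condition). Fix one of these boundary conditions. For real $\xi\perp b_1$ and real $\tau$ put $H(\tau)=H((\pi+i\tau)b_1+\xi)$, let $H_0$ be the operator $H(0)$ with $V=0$, and for an integer $l\ge1$ let $E_l$ be the spectral projector of the self-adjoint operator $H_0$ for the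 interval $[(l-1)^2,l^2)$. Condition $\mathrm A(q)$: for every $\xi\in\mathbb R^m$ with $\langle\xi,b_1\rangle=0$ there exist $\varepsilon>0$ and $C>0$ such that $$\|E_lf\|_{L_q(M\times\mathbb T)}\le C\,l^{1/2-\varepsilon}\,\|f\|_{L_2(M\times\mathbb T)}\qquad\text{for all } l\ge 1,\ f\in L_2(M\times\mathbb T).$$ Theorem. Suppose that $\mathrm A(q)$ holds for some $q\in(2,2d/(d-2))$ and that $V\in L_p(M\times\mathbb T)$ with $p=q/(q-2)$. Then for every $\lambda\in\mathbb C$ and every $\xi\in\mathbb R^m$ with $\xi\perp b_1$ there exist $\tau_0>0$ and $C$ such that for all real $\tau$ with $|\tau|>\tau_0$ the operator $H(\tau)-\lambda I$ is invertible, with a bounded inverse on $L_2(M\times\mathbb T)$, and $$\big\|(H(\tau)-\lambda I)^{-1}\big\|\le C|\tau|^{-1}.$$ -/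

import Mathlib

open MeasureTheory Set Filter Topology
open scoped Manifold ContDiff ENNReal ComplexConjugate

noncomputable section

namespace Cylinder

/-- `I` is the model of a `k`-dimensional manifold without boundary (its range is `ℝᵏ`) or with
boundary (its range is a closed coordinate half-space). In particular `𝓡 k` and `𝓡∂ k`
qualify. -/
def IsBoundaryModel {k : ℕ} {H : Type*} [TopologicalSpace H]
    (I : ModelWithCorners ℝ (EuclideanSpace ℝ (Fin k)) H) : Prop :=
  range I = univ ∨ ∃ i : Fin k, range I = {z | 0 ≤ z i}

/-- The boundary condition on `∂M × 𝕋`. If `∂M = ∅`, both choices give the same operator. -/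
inductive BoundaryCondition
  | dirichlet
  | neumann

section Riemannian

variable {k : ℕ} {H : Type*} [TopologicalSpace H]
  {I : ModelWithCorners ℝ (EuclideanSpace ℝ (Fin k)) H}
  {M : Type*} [TopologicalSpace M] [ChartedSpace H M] [IsManifold I ∞ M]

/-- A smooth Riemannian metric on `M`. -/
abbrev Metric (I : ModelWithCorners ℝ (EuclideanSpace ℝ (Fin k)) H) (M : Type*)
    [TopologicalSpace M] [ChartedSpace H M] [IsManifold I ∞ M] :=
  Bundle.ContMDiffRiemannianMetric I ∞ (EuclideanSpace ℝ (Fin k)) (TangentSpace I : M → Type _)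

/-- The Gram matrix `g_x(e i, e j)` of a family of tangent vectors. -/
def gram (g : Metric I M) (x : M) (e : Fin k → TangentSpace I x) : Matrix (Fin k) (Fin k) ℝ :=
  Matrix.of fun i j => g.inner x (e i) (e j)

/-- A basis of the tangent space `T_x M`: the coordinate vectors of the preferred chart at `x`. -/
def stdVec (x : M) (i : Fin k) : TangentSpace I x :=
  (EuclideanSpace.single i (1 : ℝ) : EuclideanSpace ℝ (Fin k))

/-- The vector field `∂ / ∂zᵢ` of the chart `chartAt H x₀`, at the point with coordinates `z`. -/
def coordVec (x₀ : M) (z : EuclideanSpace ℝ (Fin k)) (i : Fin k) :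
    TangentSpace I ((extChartAt I x₀).symm z) :=
  mfderivWithin 𝓘(ℝ, EuclideanSpace ℝ (Fin k)) I (extChartAt I x₀).symm (range I) z
    (EuclideanSpace.single i (1 : ℝ) : EuclideanSpace ℝ (Fin k))

/-- The Riemannian measure of one chart domain: `√(det g_{ij}) dz` transported to `M`. -/
def chartVolume [MeasurableSpace M] (g : Metric I M) (x₀ : M) : Measure M :=
  Measure.map (extChartAt I x₀).symm
    ((volume.restrict (extChartAt I x₀).target).withDensity fun z =>
      ENNReal.ofReal (Real.sqrt (gram g ((extChartAt I x₀).symm z) (coordVec x₀ z)).det))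

/-- The Riemannian volume of `(M, g)`. The measures of the chart domains agree on overlaps, so that
their supremum is the measure on `M` that restricts to each of them. -/
def riemannianVolume [MeasurableSpace M] (g : Metric I M) : Measure M :=
  ⨆ x₀ : M, chartVolume g x₀

/-- The Hermitian product `∑ᵢⱼ gⁱʲ αᵢ (conj βⱼ)` of complex covectors at `x`. For `α = du`
and `β = dv` this is `⟨∇u, ∇v⟩`. -/
def covectorInner (g : Metric I M) (x : M) (α β : TangentSpace I x →L[ℝ] ℂ) : ℂ :=
  ∑ i, ∑ j, (((gram g x (stdVec x))⁻¹ i j : ℝ) : ℂ) * α (stdVec x i) * conj (β (stdVec x j))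

end Riemannian

section Operators

variable {k m : ℕ} {H : Type*} [TopologicalSpace H]
  {I : ModelWithCorners ℝ (EuclideanSpace ℝ (Fin k)) H}
  {M : Type*} [TopologicalSpace M] [ChartedSpace H M] [IsManifold I ∞ M]
  (g : Metric I M) (b : Module.Basis (Fin m) ℝ (EuclideanSpace ℝ (Fin m)))

/-- Functions on `M × 𝕋`, `𝕋 = ℝᵐ / Γ`, are functions on `M × ℝᵐ` which are periodic with respect
to the lattice `Γ` generated by the basis `b`. -/
def IsPeriodic {α : Type*} (u : M × EuclideanSpace ℝ (Fin m) → α) : Prop :=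
  ∀ (x : M) (y : EuclideanSpace ℝ (Fin m)) (j : Fin m), u (x, y + b j) = u (x, y)

/-- The measure `dx dy` on `M × Ω`, where `Ω = {∑ yⱼ bⱼ : yⱼ ∈ [0, 1)}` is the elementary cell. -/
def cellMeasure [MeasurableSpace M] : Measure (M × EuclideanSpace ℝ (Fin m)) :=
  (riemannianVolume g).prod (volume.restrict (ZSpan.fundamentalDomain b))

/-- The complex Hilbert space `L₂(M × 𝕋)`. -/
abbrev L2 [MeasurableSpace M] := Lp ℂ 2 (cellMeasure g b)

/-- Smooth functions on `M × 𝕋` (up to the boundary) for the Neumann condition; for the Dirichlet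
condition, those which in addition have compact support in `(interior M) × 𝕋`. -/
def IsCoreFunction (I : ModelWithCorners ℝ (EuclideanSpace ℝ (Fin k)) H)
    [IsManifold I ∞ M] (bc : BoundaryCondition) (u : M × EuclideanSpace ℝ (Fin m) → ℂ) : Prop :=
  ContMDiff (I.prod 𝓘(ℝ, EuclideanSpace ℝ (Fin m))) 𝓘(ℝ, ℂ) ∞ u ∧ IsPeriodic b u ∧
    match bc with
    | .neumann => True
    | .dirichlet => ∃ K : Set M, IsCompact K ∧ K ⊆ I.interior M ∧
        ∀ x, x ∉ K → ∀ y, u (x, y) = 0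

/-- The differential of `u` in the variable `x ∈ M`. -/
def diffX (I : ModelWithCorners ℝ (EuclideanSpace ℝ (Fin k)) H) [IsManifold I ∞ M]
    (u : M × EuclideanSpace ℝ (Fin m) → ℂ) (p : M × EuclideanSpace ℝ (Fin m)) :
    TangentSpace I p.1 →L[ℝ] ℂ :=
  mfderiv I 𝓘(ℝ, ℂ) (fun x => u (x, p.2)) p.1

/-- The partial derivative of `u` in `y_j`. -/
def diffY (u : M × EuclideanSpace ℝ (Fin m) → ℂ) (j : Fin m)
    (p : M × EuclideanSpace ℝ (Fin m)) : ℂ :=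
  fderiv ℝ (fun y => u (p.1, y)) p.2 (EuclideanSpace.single j 1)

/-- The free form on smooth functions:
`∫_{M × Ω} ⟨∇_x u, ∇_x v⟩ + ⟨(∇_y + iξ) u, (∇_y + i ξ̄) v⟩ dx dy`, for `ξ ∈ ℂᵐ`. -/
def freeForm [MeasurableSpace M] (ξ : EuclideanSpace ℂ (Fin m))
    (u v : M × EuclideanSpace ℝ (Fin m) → ℂ) : ℂ :=
  ∫ p, (covectorInner g p.1 (diffX I u p) (diffX I v p) +
    ∑ j, (diffY u j p + Complex.I * ξ j * u p) *
      conj (diffY v j p + Complex.I * conj (ξ j) * v p)) ∂(cellMeasure g b)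

/-- `w` is a sequence of core functions which converges to `u` in `L₂(M × 𝕋)` and is a Cauchy
sequence for the Dirichlet integral `∫ |∇_x w|² + |∇_y w|²`: it converges to `u` in `H¹`. -/
def TendstoH1 [MeasurableSpace M] (bc : BoundaryCondition)
    (w : ℕ → M × EuclideanSpace ℝ (Fin m) → ℂ) (u : L2 g b) : Prop :=
  (∀ n, IsCoreFunction b I bc (w n)) ∧
  Tendsto (fun n => eLpNorm (w n - ⇑u) 2 (cellMeasure g b)) atTop (𝓝 0) ∧
  ∀ ε : ℝ, 0 < ε → ∃ N : ℕ, ∀ n ≥ N, ∀ l ≥ N,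
    (freeForm g b 0 (w n - w l) (w n - w l)).re < ε

/-- The operator `H(ξ)` as a graph: `u ∈ Dom H(ξ)` and `H(ξ) u = f`. This is the operator of the
form `h(ξ)`, whose domain is the closure of the core functions in `H¹(M × 𝕋)` (that is, `H¹` for
Neumann and `H¹₀` for Dirichlet) and whose free part is extended to this domain by continuity.
The condition says that `u` is in the form domain and that `h(ξ)[u, v] = (f, v)` for every `v` in
the form domain. -/
def IsSchrodinger [MeasurableSpace M] (bc : BoundaryCondition)
    (V : M × EuclideanSpace ℝ (Fin m) → ℝ) (ξ : EuclideanSpace ℂ (Fin m)) (u f : L2 g b) : Prop :=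
  ∃ w, TendstoH1 g b bc w u ∧ ∀ (v : L2 g b) (z), TendstoH1 g b bc z v →
    Integrable (fun p => (V p : ℂ) * u p * conj (v p)) (cellMeasure g b) ∧
    Tendsto (fun n => freeForm g b ξ (w n) (z n) +
        ∫ p, (V p : ℂ) * u p * conj (v p) ∂(cellMeasure g b))
      atTop (𝓝 (∫ p, f p * conj (v p) ∂(cellMeasure g b)))

/-- The quasimomentum `(π + iτ) b₁ + ξ ∈ ℂᵐ`. -/
def quasimomentum [NeZero m] (ξ : EuclideanSpace ℝ (Fin m)) (τ : ℝ) : EuclideanSpace ℂ (Fin m) :=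
  WithLp.toLp 2 fun j => ((Real.pi : ℂ) + Complex.I * τ) * (b 0 j : ℂ) + (ξ j : ℂ)

/-- The range of the spectral projector `E_l` of `H₀ = H((π b₁ + ξ))` with `V = 0` for the interval
`[(l - 1)², l²)`. Since `M × 𝕋` is compact, the spectrum of `H₀` is discrete, and this is the closed
span of the eigenvectors with eigenvalues in the interval. -/
def spectralCluster [MeasurableSpace M] [NeZero m] (bc : BoundaryCondition)
    (ξ : EuclideanSpace ℝ (Fin m)) (l : ℕ) : Submodule ℂ (L2 g b) :=
  (Submodule.span ℂ {u | ∃ s : ℝ, ((l : ℝ) - 1) ^ 2 ≤ s ∧ s < (l : ℝ) ^ 2 ∧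
    IsSchrodinger g b bc 0 (quasimomentum b ξ 0) u ((s : ℂ) • u)}).topologicalClosure

/-- The spectral projector `E_l`: the orthogonal projection of `L₂(M × 𝕋)` onto
`spectralCluster`. -/
def clusterProjector [MeasurableSpace M] [NeZero m] (bc : BoundaryCondition)
    (ξ : EuclideanSpace ℝ (Fin m)) (l : ℕ) : L2 g b →L[ℂ] L2 g b :=
  haveI : CompleteSpace (spectralCluster g b bc ξ l) :=
    (Submodule.isClosed_topologicalClosure _).completeSpace_coe
  (spectralCluster g b bc ξ l).starProjection

/-- Condition `A(q)`: for every real `ξ ⟂ b₁` there are `ε > 0` and `C > 0` with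
`‖E_l f‖_{L_q} ≤ C l^{1/2 - ε} ‖f‖_{L_2}` for all `l ≥ 1` and all `f ∈ L₂(M × 𝕋)`. -/
def ConditionA [MeasurableSpace M] [NeZero m] (bc : BoundaryCondition) (q : ℝ) : Prop :=
  ∀ ξ : EuclideanSpace ℝ (Fin m), inner ℝ ξ (b 0) = 0 →
    ∃ ε : ℝ, 0 < ε ∧ ∃ C : ℝ, 0 < C ∧ ∀ l : ℕ, 1 ≤ l → ∀ f : L2 g b,
      eLpNorm (clusterProjector g b bc ξ l f) (ENNReal.ofReal q) (cellMeasure g b) ≤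
        ENNReal.ofReal (C * (l : ℝ) ^ (1 / 2 - ε)) * eLpNorm f 2 (cellMeasure g b)

/-- `R` is the bounded inverse of `H(ξ) - lam`; here `H(ξ)` is really an operator (its graph is
single-valued), `R` maps `L₂(M × 𝕋)` into its domain, and `R` is a two-sided inverse. -/
def IsResolvent [MeasurableSpace M] (bc : BoundaryCondition)
    (V : M × EuclideanSpace ℝ (Fin m) → ℝ) (ξ : EuclideanSpace ℂ (Fin m)) (lam : ℂ)
    (R : L2 g b →L[ℂ] L2 g b) : Prop :=
  (∀ u f₁ f₂, IsSchrodinger g b bc V ξ u f₁ → IsSchrodinger g b bc V ξ u f₂ → f₁ = f₂) ∧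
  (∀ f, IsSchrodinger g b bc V ξ (R f) (f + lam • R f)) ∧
  ∀ u f, IsSchrodinger g b bc V ξ u f → R (f - lam • u) = u

end Operators

end Cylinder

end

/-!
The starting point is that translations along `b₁` commute with the free operator. Hence `L₂` has an
orthonormal basis `eᵢ` of eigenfunctions of `H₀` which are also eigenfunctions of the derivative
along `b₁` (`IsFormSpace.exists_eigenbasis`). Since the period is `1`, the derivative `∂ + iπ` has
on `eᵢ` the eigenvalue `i dᵢ`, where `dᵢ` is an odd multiple of `π`. As `|b₁| = 1` and `ξ ⊥ b₁`, the
form of `H(τ)` with `V = 0` is diagonal in this basis: if `aᵢ ≥ 0` is the eigenvalue of `H₀`, then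
that of `H(τ)` is `μᵢ = aᵢ - τ² + 2iτdᵢ` (`twistedEigenvalue`).

The quasimomentum `π b₁` keeps `dᵢ` away from zero, so `|μᵢ| ≥ 6|τ|`. Together with the real part
this gives `6 |μᵢ| ≥ (1 + |l - |τ||) (l + |τ|)` when `(l - 1)² ≤ aᵢ < l²`
(`cluster_le_norm_twistedEigenvalue`).

Write `V - λ = p₂ p̄₁` with `|p₁| = |p₂|` in `L_{2p}` (`exists_factorization`). By Hölder's
inequality and condition `A(q)`, multiplication by `p₁` or `p₂` maps the `l`-th spectral cluster to
`L₂` with norm `O(l^{1/2 - ε})`. Let `G` be the diagonal operator `|μᵢ|^{-1/2}`. By Cauchy–Schwarz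
over the clusters (`exists_multiplier`), the operators `p₁ G` and `p₂ G` have squared norm at most a
constant times `∑ l^{1 - 2ε} / ((1 + |l - |τ||) (l + |τ|))`, which is `O(|τ|^{-ε})`
(`exists_sum_cluster_le`). So for large `|τ|` they are small, and
`H(τ) - λ = G⁻¹ (U + (p₁ G)† p₂ G) G⁻¹`, where `U` is the unitary diagonal operator `μᵢ / |μᵢ|`. The
middle factor has an inverse of norm at most `2`, while `‖G‖² ≤ 1 / (6|τ|)`; this gives the
resolvent and its bound (`exists_resolvent`).

The eigenbasis is obtained on the completion `W` of the core functions in the norm of the form,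
which is `H¹` or `H¹₀` (`IsFormSpace`). Its embedding `J` in `L₂` is compact by a Rellich inequality
(`rellich`): on small convex pieces of coordinate patches Poincaré's inequality holds with a small
constant, up to the mean value on the piece. The core functions are dense in `L₂`, because the
boundary of `M` is a null set. The spectral theorem for the compact operator `J J†` then gives the
eigenfunctions of `H₀`, and on each of its finite-dimensional eigenspaces the derivative along `b₁`
acts as a skew-symmetric operator, which can be diagonalized (`exists_hilbertBasis`).
-/

namespace Cylinder

/-! ### Gram matrices -/

section GramAlgebra

variable {k : ℕ} {W : Type*} [AddCommGroup W] [Module ℝ W]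

theorem posDef_gram (B : W →ₗ[ℝ] W →ₗ[ℝ] ℝ) (hs : ∀ v w, B v w = B w v)
    (hp : ∀ v, v ≠ 0 → 0 < B v v) {e : Fin k → W} (he : LinearIndependent ℝ e) :
    (Matrix.of fun i j => B (e i) (e j)).PosDef := by
  refine Matrix.PosDef.of_dotProduct_mulVec_pos ?_ fun a ha => ?_
  · ext i j; simp [hs (e j) (e i)]
  · have h : star a ⬝ᵥ (Matrix.of fun i j => B (e i) (e j)).mulVec a
        = B (∑ i, a i • e i) (∑ i, a i • e i) := by
      simp only [dotProduct, Matrix.mulVec, Matrix.of_apply, map_sum, map_smul,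
        LinearMap.sum_apply, LinearMap.smul_apply, smul_eq_mul, Pi.star_apply, star_trivial,
        Finset.mul_sum]
      rw [Finset.sum_comm]
      exact Finset.sum_congr rfl fun i _ => Finset.sum_congr rfl fun j _ => by ring
    rw [h]
    refine hp _ fun h0 => ha ?_
    ext i
    exact Fintype.linearIndependent_iff.1 he a h0 i

/-- The Hermitian form of the inverse Gram matrix does not depend on the basis. -/
theorem sum_inv_gram (B : W →ₗ[ℝ] W →ₗ[ℝ] ℝ) (hs : ∀ v w, B v w = B w v)
    (hp : ∀ v, v ≠ 0 → 0 < B v v) {e : Fin k → W} (he : LinearIndependent ℝ e)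
    (hspan : ⊤ ≤ Submodule.span ℝ (range e)) (X Y : W) :
    ∑ i, ∑ j, (Matrix.of fun i j => B (e i) (e j))⁻¹ i j * B X (e i) * B Y (e j) = B X Y := by
  set G := Matrix.of fun i j => B (e i) (e j) with hG
  have hdet : IsUnit G.det := (posDef_gram B hs hp he).det_pos.ne'.isUnit
  let b := Module.Basis.mk he hspan
  have hb : ∀ i, b i = e i := fun i => by simp [b]
  have hX : ∀ X : W, (fun i => B X (e i)) = G.mulVec (b.repr X) := fun X => by
    ext i
    conv_lhs => rw [← b.sum_repr X]
    simp [Matrix.mulVec, dotProduct, hb, hG, hs (e i), mul_comm]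
  have h1 : ∑ i, ∑ j, G⁻¹ i j * B X (e i) * B Y (e j)
      = (fun i => B X (e i)) ⬝ᵥ (G⁻¹.mulVec fun j => B Y (e j)) := by
    simp only [dotProduct, Matrix.mulVec, Finset.mul_sum]
    exact Finset.sum_congr rfl fun i _ => Finset.sum_congr rfl fun j _ => by ring
  rw [h1, hX Y, Matrix.mulVec_mulVec, Matrix.nonsing_inv_mul _ hdet, Matrix.one_mulVec]
  conv_rhs => rw [hs, ← b.sum_repr Y]
  simp only [dotProduct, map_sum, map_smul, LinearMap.sum_apply, LinearMap.smul_apply, smul_eq_mul]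
  exact Finset.sum_congr rfl fun i _ => by rw [hb, hs (e i), mul_comm]

/-- The Gram determinant of the image of the standard basis under `J`. -/
theorem det_gram_comp (B : EuclideanSpace ℝ (Fin k) →ₗ[ℝ] EuclideanSpace ℝ (Fin k) →ₗ[ℝ] ℝ)
    (J : EuclideanSpace ℝ (Fin k) →ₗ[ℝ] EuclideanSpace ℝ (Fin k)) :
    (Matrix.of fun i j => B (J (EuclideanSpace.single i 1)) (J (EuclideanSpace.single j 1))).det
      = LinearMap.det J ^ 2 *
        (Matrix.of fun i j => B (EuclideanSpace.single i 1) (EuclideanSpace.single j 1)).det := by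
  set G := Matrix.of fun i j : Fin k => B (EuclideanSpace.single i 1) (EuclideanSpace.single j 1)
  let b := (EuclideanSpace.basisFun (Fin k) ℝ).toBasis
  set A := LinearMap.toMatrix b b J with hA
  have hb : ∀ i, b i = EuclideanSpace.single i 1 := fun i => by simp [b]
  have h : (Matrix.of fun i j => B (J (EuclideanSpace.single i 1)) (J (EuclideanSpace.single j 1)))
      = A.transpose * G * A := by
    have hJ : ∀ i, J (EuclideanSpace.single i 1) =
        ∑ l, A l i • EuclideanSpace.single l (1 : ℝ) := by
      intro i
      rw [← b.sum_repr (J (EuclideanSpace.single i 1))]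
      simp [hA, LinearMap.toMatrix_apply, hb]
    ext i j
    simp only [Matrix.of_apply, hJ, map_sum, map_smul, LinearMap.sum_apply, LinearMap.smul_apply,
      smul_eq_mul, Matrix.mul_apply, Matrix.transpose_apply, Finset.sum_mul, Finset.mul_sum, G]
    refine Finset.sum_congr rfl fun l _ => Finset.sum_congr rfl fun n _ => by ring
  rw [h, Matrix.det_mul, Matrix.det_mul, Matrix.det_transpose, hA, LinearMap.det_toMatrix]
  ring

end GramAlgebra

section Riemannian

variable {k : ℕ} {H : Type*} [TopologicalSpace H]
  {I : ModelWithCorners ℝ (EuclideanSpace ℝ (Fin k)) H}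
  {M : Type*} [TopologicalSpace M] [ChartedSpace H M] [IsManifold I ∞ M]

/-- The metric at a point as a bilinear form in the algebraic sense. -/
noncomputable def metricForm (g : Metric I M) (x : M) :
    TangentSpace I x →ₗ[ℝ] TangentSpace I x →ₗ[ℝ] ℝ :=
  LinearMap.mk₂ ℝ (fun v w => g.inner x v w) (by simp) (by simp) (by simp) (by simp)

@[simp] theorem metricForm_apply (g : Metric I M) (x : M) (v w : TangentSpace I x) :
    metricForm g x v w = g.inner x v w := rfl

theorem metricForm_symm (g : Metric I M) (x : M) (v w : TangentSpace I x) :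
    metricForm g x v w = metricForm g x w v := g.symm x v w

theorem metricForm_pos (g : Metric I M) (x : M) (v : TangentSpace I x) (hv : v ≠ 0) :
    0 < metricForm g x v v := g.pos x v hv

theorem metricForm_self_nonneg (g : Metric I M) (x : M) (v : TangentSpace I x) :
    0 ≤ metricForm g x v v := by
  rcases eq_or_ne v 0 with rfl | h
  · simp
  · exact (metricForm_pos g x v h).le

/-- A complex covector is represented by two tangent vectors. -/
theorem exists_riesz (g : Metric I M) (x : M) (α : TangentSpace I x →L[ℝ] ℂ) :
    ∃ X Y : TangentSpace I x, ∀ v,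
      α v = (metricForm g x X v : ℂ) + Complex.I * (metricForm g x Y v : ℂ) := by
  have : FiniteDimensional ℝ (TangentSpace I x) :=
    inferInstanceAs (FiniteDimensional ℝ (EuclideanSpace ℝ (Fin k)))
  have hinj : Function.Injective (metricForm g x) := by
    rw [injective_iff_map_eq_zero]
    intro v hv
    by_contra h
    exact (metricForm_pos g x v h).ne' (by rw [hv]; rfl)
  have hsurj : Function.Surjective (metricForm g x) :=
    (LinearMap.injective_iff_surjective_of_finrank_eq_finrank
      (Subspace.dual_finrank_eq (K := ℝ) (V := TangentSpace I x)).symm).1 hinj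
  obtain ⟨X, hX⟩ := hsurj (Complex.reLm ∘ₗ (α : TangentSpace I x →ₗ[ℝ] ℂ))
  obtain ⟨Y, hY⟩ := hsurj (Complex.imLm ∘ₗ (α : TangentSpace I x →ₗ[ℝ] ℂ))
  refine ⟨X, Y, fun v => ?_⟩
  rw [hX, hY]
  apply Complex.ext <;> simp

/-- In any basis `e`, the inverse Gram matrix of `e` gives the product of two complex covectors in
terms of the vectors representing them. -/
theorem sum_inv_gram_covector (g : Metric I M) (x : M) {e : Fin k → TangentSpace I x}
    (he : LinearIndependent ℝ e) (hspan : ⊤ ≤ Submodule.span ℝ (range e))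
    {α β : TangentSpace I x → ℂ} {X Y X' Y' : TangentSpace I x}
    (hα : ∀ v, α v = (metricForm g x X v : ℂ) + Complex.I * (metricForm g x Y v : ℂ))
    (hβ : ∀ v, β v = (metricForm g x X' v : ℂ) + Complex.I * (metricForm g x Y' v : ℂ)) :
    ∑ i, ∑ j, (((gram g x e)⁻¹ i j : ℝ) : ℂ) * α (e i) * conj (β (e j)) =
      ((metricForm g x X X' + metricForm g x Y Y' : ℝ) : ℂ) +
        Complex.I * ((metricForm g x Y X' - metricForm g x X Y' : ℝ) : ℂ) := by
  have key := sum_inv_gram (metricForm g x) (metricForm_symm g x) (metricForm_pos g x) he hspan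
  rw [← key X X', ← key Y Y', ← key Y X', ← key X Y']
  push_cast
  simp only [Finset.mul_sum, ← Finset.sum_add_distrib, ← Finset.sum_sub_distrib]
  refine Finset.sum_congr rfl fun i _ => Finset.sum_congr rfl fun j _ => ?_
  rw [hα, hβ]
  simp only [map_add, map_mul, Complex.conj_I, Complex.conj_ofReal]
  simp only [gram, metricForm_apply]
  ring_nf
  simp only [Complex.I_sq]
  ring

theorem linearIndependent_stdVec (x : M) :
    LinearIndependent ℝ (stdVec (I := I) x) ∧
      ⊤ ≤ Submodule.span ℝ (range (stdVec (I := I) x)) := by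
  have h1 := (EuclideanSpace.basisFun (Fin k) ℝ).toBasis.linearIndependent
  have h2 := (EuclideanSpace.basisFun (Fin k) ℝ).toBasis.span_eq
  have h : ((EuclideanSpace.basisFun (Fin k) ℝ).toBasis : Fin k → EuclideanSpace ℝ (Fin k))
      = fun i => EuclideanSpace.single i (1 : ℝ) := by ext i; simp
  rw [h] at h1 h2
  exact ⟨h1, h2.ge⟩

/-- The product of two covectors may be computed in any basis of the tangent space. -/
theorem covectorInner_eq_sum (g : Metric I M) (x : M) {e : Fin k → TangentSpace I x}
    (he : LinearIndependent ℝ e) (hspan : ⊤ ≤ Submodule.span ℝ (range e))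
    (α β : TangentSpace I x →L[ℝ] ℂ) :
    covectorInner g x α β =
      ∑ i, ∑ j, (((gram g x e)⁻¹ i j : ℝ) : ℂ) * α (e i) * conj (β (e j)) := by
  obtain ⟨X, Y, hα⟩ := exists_riesz g x α
  obtain ⟨X', Y', hβ⟩ := exists_riesz g x β
  rw [sum_inv_gram_covector g x he hspan hα hβ]
  exact sum_inv_gram_covector g x (linearIndependent_stdVec x).1 (linearIndependent_stdVec x).2
    hα hβ

theorem covectorInner_conj (g : Metric I M) (x : M) (α β : TangentSpace I x →L[ℝ] ℂ) :
    conj (covectorInner g x α β) = covectorInner g x β α := by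
  obtain ⟨X, Y, hα⟩ := exists_riesz g x α
  obtain ⟨X', Y', hβ⟩ := exists_riesz g x β
  have hs := linearIndependent_stdVec (I := I) x
  have h1 := sum_inv_gram_covector g x hs.1 hs.2 hα hβ
  have h2 := sum_inv_gram_covector g x hs.1 hs.2 hβ hα
  unfold covectorInner
  rw [h1, h2, metricForm_symm g x X' X, metricForm_symm g x Y' Y, metricForm_symm g x Y' X,
    metricForm_symm g x X' Y]
  simp
  ring

theorem covectorInner_self (g : Metric I M) (x : M) {α : TangentSpace I x →L[ℝ] ℂ}
    {X Y : TangentSpace I x}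
    (hα : ∀ v, α v = (metricForm g x X v : ℂ) + Complex.I * (metricForm g x Y v : ℂ)) :
    covectorInner g x α α = ((metricForm g x X X + metricForm g x Y Y : ℝ) : ℂ) := by
  have hs := linearIndependent_stdVec (I := I) x
  have h1 := sum_inv_gram_covector g x hs.1 hs.2 hα hα
  unfold covectorInner
  rw [h1, metricForm_symm g x X Y]
  simp

theorem covectorInner_self_nonneg (g : Metric I M) (x : M) (α : TangentSpace I x →L[ℝ] ℂ) :
    0 ≤ (covectorInner g x α α).re := by
  obtain ⟨X, Y, hα⟩ := exists_riesz g x α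
  rw [covectorInner_self g x hα, Complex.ofReal_re]
  exact add_nonneg (metricForm_self_nonneg g x X) (metricForm_self_nonneg g x Y)

/-- Cauchy–Schwarz for the value of a covector on a tangent vector. -/
theorem norm_sq_apply_le (g : Metric I M) (x : M) (α : TangentSpace I x →L[ℝ] ℂ)
    (v : TangentSpace I x) :
    ‖α v‖ ^ 2 ≤ g.inner x v v * (covectorInner g x α α).re := by
  obtain ⟨X, Y, hα⟩ := exists_riesz g x α
  have cs : ∀ X, metricForm g x X v ^ 2 ≤ metricForm g x v v * metricForm g x X X := by
    intro X
    -- the discriminant of `t ↦ g(X + t v, X + t v) ≥ 0` is nonpositive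
    have h : ∀ t : ℝ, 0 ≤ metricForm g x v v * (t * t) + (2 * metricForm g x X v) * t
        + metricForm g x X X := by
      intro t
      have := metricForm_self_nonneg g x (X + t • v)
      simp only [map_add, map_smul, LinearMap.add_apply, LinearMap.smul_apply, smul_eq_mul] at this
      rw [metricForm_symm g x v X] at this
      nlinarith
    have := discrim_le_zero h
    rw [discrim] at this
    nlinarith
  rw [covectorInner_self g x hα, Complex.ofReal_re, hα, Complex.sq_norm, Complex.normSq_apply]
  simp only [Complex.add_re, Complex.ofReal_re, Complex.mul_re, Complex.I_re, Complex.I_im,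
    Complex.ofReal_im, Complex.add_im, Complex.mul_im]
  have h1 := cs X
  have h2 := cs Y
  rw [metricForm_apply g x v v] at h1 h2
  nlinarith

end Riemannian

/-! ### Coordinate expressions -/

section Coordinates

variable {k m : ℕ} {H : Type*} [TopologicalSpace H]
  {I : ModelWithCorners ℝ (EuclideanSpace ℝ (Fin k)) H}
  {M : Type*} [TopologicalSpace M] [ChartedSpace H M] [IsManifold I ∞ M]

theorem linearIndependent_coordVec (x₀ : M) {z : EuclideanSpace ℝ (Fin k)}
    (hz : z ∈ (extChartAt I x₀).target) :
    LinearIndependent ℝ (coordVec (I := I) x₀ z) ∧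
      ⊤ ≤ Submodule.span ℝ (range (coordVec (I := I) x₀ z)) := by
  obtain ⟨L, hL⟩ := isInvertible_mfderivWithin_extChartAt_symm (I := I) hz
  let L' : EuclideanSpace ℝ (Fin k) ≃ₗ[ℝ] TangentSpace I ((extChartAt I x₀).symm z) :=
    L.toLinearEquiv
  have e : (((EuclideanSpace.basisFun (Fin k) ℝ).toBasis.map L' :
      Module.Basis (Fin k) ℝ (TangentSpace I ((extChartAt I x₀).symm z))) : Fin k → _)
      = coordVec (I := I) x₀ z := by
    ext1 i
    rw [Module.Basis.map_apply]
    simp only [OrthonormalBasis.coe_toBasis, EuclideanSpace.basisFun_apply, coordVec, ← hL]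
    rfl
  rw [← e]
  exact ⟨Module.Basis.linearIndependent _, (Module.Basis.span_eq _).ge⟩

theorem continuousOn_coordVec (x₀ : M) (i : Fin k) :
    ContinuousOn (fun z => (⟨(extChartAt I x₀).symm z, coordVec x₀ z i⟩ : TangentBundle I M))
      (extChartAt I x₀).target := by
  intro z hz
  have h1 : ContMDiffOn 𝓘(ℝ, EuclideanSpace ℝ (Fin k)) I ∞ (extChartAt I x₀).symm
    (extChartAt I x₀).target := contMDiffOn_extChartAt_symm x₀
  have h2 := h1.continuousOn_tangentMapWithin (by simp)
    (uniqueDiffOn_extChartAt_target (I := I) x₀).uniqueMDiffOn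
  have h3 : Continuous (fun z : EuclideanSpace ℝ (Fin k) =>
      (⟨z, (EuclideanSpace.single i (1 : ℝ) : EuclideanSpace ℝ (Fin k))⟩ :
        TangentBundle 𝓘(ℝ, EuclideanSpace ℝ (Fin k)) (EuclideanSpace ℝ (Fin k)))) :=
    (contMDiff_vectorSpace_iff_contDiff (n := 0)
      (V := fun _ => (EuclideanSpace.single i (1 : ℝ) : EuclideanSpace ℝ (Fin k)))).2
      contDiff_const |>.continuous
  have h4 := h2.comp h3.continuousOn (fun z hz => hz) (s := (extChartAt I x₀).target)
  refine (h4.congr ?_) z hz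
  intro z hz
  simp only [Function.comp, tangentMapWithin, coordVec]
  congr 1
  rw [mfderivWithin_subset (extChartAt_target_subset_range x₀)
    ((uniqueDiffOn_extChartAt_target (I := I) x₀).uniqueMDiffOn z hz)
    (mdifferentiableWithinAt_extChartAt_symm hz)]

theorem continuousOn_gram_coordVec (g : Metric I M) (x₀ : M) :
    ContinuousOn (fun z => gram g ((extChartAt I x₀).symm z) (coordVec x₀ z))
      (extChartAt I x₀).target := by
  refine continuousOn_pi.2 fun i => continuousOn_pi.2 fun j => fun z hz => ?_
  have hf := continuousOn_extChartAt_symm (I := I) x₀ z hz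
  have h : ContinuousWithinAt (fun z => (⟨(extChartAt I x₀).symm z,
      g.inner ((extChartAt I x₀).symm z) (coordVec x₀ z i) (coordVec x₀ z j)⟩ :
        Bundle.TotalSpace ℝ (Bundle.Trivial M ℝ))) (extChartAt I x₀).target z :=
    (g.contMDiff.continuous.continuousAt.comp_continuousWithinAt hf).clm_bundle_apply₂
      (F₁ := EuclideanSpace ℝ (Fin k)) (F₂ := EuclideanSpace ℝ (Fin k))
      (continuousOn_coordVec x₀ i z hz) (continuousOn_coordVec x₀ j z hz)
  simp only [FiberBundle.continuousWithinAt_totalSpace] at h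
  exact h.2

theorem det_gram_coordVec_pos (g : Metric I M) (x₀ : M) {z : EuclideanSpace ℝ (Fin k)}
    (hz : z ∈ (extChartAt I x₀).target) :
    0 < (gram g ((extChartAt I x₀).symm z) (coordVec x₀ z)).det :=
  (posDef_gram (metricForm g _) (metricForm_symm g _) (metricForm_pos g _)
    (linearIndependent_coordVec x₀ hz).1).det_pos

/-- The function `u` on `M × ℝᵐ` in the chart at `x₀`. -/
noncomputable def localRep (I : ModelWithCorners ℝ (EuclideanSpace ℝ (Fin k)) H) (x₀ : M)
    (u : M × EuclideanSpace ℝ (Fin m) → ℂ)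
    (p : EuclideanSpace ℝ (Fin k) × EuclideanSpace ℝ (Fin m)) :
    ℂ :=
  u ((extChartAt I x₀).symm p.1, p.2)

theorem contDiffOn_localRep (x₀ : M) {u : M × EuclideanSpace ℝ (Fin m) → ℂ}
    (hu : ContMDiff (I.prod 𝓘(ℝ, EuclideanSpace ℝ (Fin m))) 𝓘(ℝ, ℂ) ∞ u) :
    ContDiffOn ℝ ∞ (localRep I x₀ u) ((extChartAt I x₀).target ×ˢ univ) := by
  have h1 : ContMDiffOn (𝓘(ℝ, EuclideanSpace ℝ (Fin k)).prod 𝓘(ℝ, EuclideanSpace ℝ (Fin m)))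
      (I.prod 𝓘(ℝ, EuclideanSpace ℝ (Fin m))) ∞
      (Prod.map (extChartAt I x₀).symm
        (id : EuclideanSpace ℝ (Fin m) → EuclideanSpace ℝ (Fin m)))
      ((extChartAt I x₀).target ×ˢ univ) := by
    have hid : ContMDiffOn 𝓘(ℝ, EuclideanSpace ℝ (Fin m)) 𝓘(ℝ, EuclideanSpace ℝ (Fin m)) ∞
      (id : EuclideanSpace ℝ (Fin m) → EuclideanSpace ℝ (Fin m)) univ := contMDiffOn_id
    exact (contMDiffOn_extChartAt_symm x₀).prodMap hid
  have h2 := hu.comp_contMDiffOn h1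
  rw [← contMDiffOn_iff_contDiffOn, modelWithCornersSelf_prod, ← chartedSpaceSelf_prod]
  exact h2

theorem uniqueDiffOn_target_prod (x₀ : M) :
    UniqueDiffOn ℝ ((extChartAt I x₀).target ×ˢ (univ : Set (EuclideanSpace ℝ (Fin m)))) :=
  (uniqueDiffOn_extChartAt_target x₀).prod uniqueDiffOn_univ

/-- The differential of `u` in the chart at `x₀`. -/
noncomputable def localDiff (I : ModelWithCorners ℝ (EuclideanSpace ℝ (Fin k)) H) (x₀ : M)
    (u : M × EuclideanSpace ℝ (Fin m) → ℂ)
    (p : EuclideanSpace ℝ (Fin k) × EuclideanSpace ℝ (Fin m)) :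
    EuclideanSpace ℝ (Fin k) × EuclideanSpace ℝ (Fin m) →L[ℝ] ℂ :=
  fderivWithin ℝ (localRep I x₀ u) ((extChartAt I x₀).target ×ˢ univ) p

theorem hasFDerivWithinAt_localRep (x₀ : M) {u : M × EuclideanSpace ℝ (Fin m) → ℂ}
    (hu : ContMDiff (I.prod 𝓘(ℝ, EuclideanSpace ℝ (Fin m))) 𝓘(ℝ, ℂ) ∞ u)
    {p : EuclideanSpace ℝ (Fin k) × EuclideanSpace ℝ (Fin m)}
    (hp : p.1 ∈ (extChartAt I x₀).target) :
    HasFDerivWithinAt (localRep I x₀ u) (localDiff I x₀ u p)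
      ((extChartAt I x₀).target ×ˢ univ) p :=
  ((contDiffOn_localRep x₀ hu).differentiableOn (by simp) p ⟨hp, mem_univ _⟩).hasFDerivWithinAt

theorem continuousOn_localDiff (x₀ : M) {u : M × EuclideanSpace ℝ (Fin m) → ℂ}
    (hu : ContMDiff (I.prod 𝓘(ℝ, EuclideanSpace ℝ (Fin m))) 𝓘(ℝ, ℂ) ∞ u) :
    ContinuousOn (localDiff I x₀ u) ((extChartAt I x₀).target ×ˢ univ) :=
  (contDiffOn_localRep x₀ hu).continuousOn_fderivWithin (uniqueDiffOn_target_prod x₀) (by simp)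

theorem diffX_coordVec (x₀ : M) {u : M × EuclideanSpace ℝ (Fin m) → ℂ}
    (hu : ContMDiff (I.prod 𝓘(ℝ, EuclideanSpace ℝ (Fin m))) 𝓘(ℝ, ℂ) ∞ u)
    {z : EuclideanSpace ℝ (Fin k)} (hz : z ∈ (extChartAt I x₀).target)
    (y : EuclideanSpace ℝ (Fin m)) (i : Fin k) :
    diffX I u ((extChartAt I x₀).symm z, y) (coordVec x₀ z i) =
      localDiff I x₀ u (z, y) (EuclideanSpace.single i 1, 0) := by
  have hd : MDifferentiableAt I 𝓘(ℝ, ℂ) (fun x => u (x, y)) ((extChartAt I x₀).symm z) := by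
    have : ContMDiff I 𝓘(ℝ, ℂ) ∞ (fun x => u (x, y)) :=
      hu.comp (contMDiff_id.prodMk contMDiff_const)
    exact this.mdifferentiable (by simp) _
  have hU := (uniqueDiffOn_extChartAt_target (I := I) x₀) z hz
  have h1 : HasFDerivWithinAt (fun z => localRep I x₀ u (z, y))
      ((localDiff I x₀ u (z, y)).comp (ContinuousLinearMap.inl ℝ _ _))
      (extChartAt I x₀).target z := by
    refine (hasFDerivWithinAt_localRep x₀ hu (p := (z, y)) hz).comp z
      (f := fun z => (z, y)) ?_ (fun w hw => ⟨hw, mem_univ _⟩)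
    exact (hasFDerivAt_prodMk_left z y).hasFDerivWithinAt
  have h2 : HasMFDerivWithinAt 𝓘(ℝ, EuclideanSpace ℝ (Fin k)) 𝓘(ℝ, ℂ)
      (fun z => localRep I x₀ u (z, y)) (extChartAt I x₀).target z
      ((mfderiv I 𝓘(ℝ, ℂ) (fun x => u (x, y)) ((extChartAt I x₀).symm z)).comp
        (mfderivWithin 𝓘(ℝ, EuclideanSpace ℝ (Fin k)) I (extChartAt I x₀).symm (range I) z)) :=
    hd.hasMFDerivAt.comp_hasMFDerivWithinAt z
      ((mdifferentiableWithinAt_extChartAt_symm hz).hasMFDerivWithinAt.mono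
        (extChartAt_target_subset_range x₀))
  have h3 := hU.eq h1 h2.hasFDerivWithinAt
  have h4 := congrArg (fun L => L (EuclideanSpace.single i (1 : ℝ))) h3
  simp only [ContinuousLinearMap.comp_apply, ContinuousLinearMap.inl_apply] at h4
  rw [h4]
  rfl

theorem hasFDerivAt_snd {u : M × EuclideanSpace ℝ (Fin m) → ℂ}
    (hu : ContMDiff (I.prod 𝓘(ℝ, EuclideanSpace ℝ (Fin m))) 𝓘(ℝ, ℂ) ∞ u)
    (x₀ x : M) (hx : x ∈ (extChartAt I x₀).source) (y : EuclideanSpace ℝ (Fin m)) :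
    HasFDerivAt (fun y => u (x, y))
      ((localDiff I x₀ u (extChartAt I x₀ x, y)).comp (ContinuousLinearMap.inr ℝ _ _)) y := by
  have hz := (extChartAt I x₀).map_source hx
  rw [← hasFDerivWithinAt_univ]
  have := (hasFDerivWithinAt_localRep x₀ hu (p := (extChartAt I x₀ x, y)) hz).comp y (s := univ)
      (f := fun y => (extChartAt I x₀ x, y))
      (hasFDerivAt_prodMk_right (extChartAt I x₀ x) y).hasFDerivWithinAt
      (fun w _ => ⟨hz, mem_univ _⟩)
  refine this.congr (fun y' _ => ?_) ?_ <;>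
  simp only [localRep, Function.comp, (extChartAt I x₀).left_inv hx]

theorem diffY_localDiff (x₀ : M) {u : M × EuclideanSpace ℝ (Fin m) → ℂ}
    (hu : ContMDiff (I.prod 𝓘(ℝ, EuclideanSpace ℝ (Fin m))) 𝓘(ℝ, ℂ) ∞ u)
    {z : EuclideanSpace ℝ (Fin k)} (hz : z ∈ (extChartAt I x₀).target)
    (y : EuclideanSpace ℝ (Fin m)) (j : Fin m) :
    diffY u j ((extChartAt I x₀).symm z, y) =
      localDiff I x₀ u (z, y) (0, EuclideanSpace.single j 1) := by
  have h := hasFDerivAt_snd hu x₀ _ ((extChartAt I x₀).map_target hz) y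
  rw [diffY, h.fderiv, (extChartAt I x₀).right_inv hz]
  simp

theorem covectorInner_diffX_eq (g : Metric I M) (x₀ : M) {u v : M × EuclideanSpace ℝ (Fin m) → ℂ}
    (hu : ContMDiff (I.prod 𝓘(ℝ, EuclideanSpace ℝ (Fin m))) 𝓘(ℝ, ℂ) ∞ u)
    (hv : ContMDiff (I.prod 𝓘(ℝ, EuclideanSpace ℝ (Fin m))) 𝓘(ℝ, ℂ) ∞ v)
    {z : EuclideanSpace ℝ (Fin k)} (hz : z ∈ (extChartAt I x₀).target)
    (y : EuclideanSpace ℝ (Fin m)) :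
    covectorInner g ((extChartAt I x₀).symm z) (diffX I u ((extChartAt I x₀).symm z, y))
        (diffX I v ((extChartAt I x₀).symm z, y)) =
      ∑ i, ∑ j, (((gram g ((extChartAt I x₀).symm z) (coordVec x₀ z))⁻¹ i j : ℝ) : ℂ) *
        localDiff I x₀ u (z, y) (EuclideanSpace.single i 1, 0) *
        conj (localDiff I x₀ v (z, y) (EuclideanSpace.single j 1, 0)) := by
  rw [covectorInner_eq_sum g _ (linearIndependent_coordVec x₀ hz).1
    (linearIndependent_coordVec x₀ hz).2]
  simp only [diffX_coordVec x₀ hu hz, diffX_coordVec x₀ hv hz]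

/-- A function on `M × ℝᵐ` is continuous if all its coordinate expressions are. -/
theorem continuous_of_localRep {Y : Type*} [TopologicalSpace Y]
    {F : M × EuclideanSpace ℝ (Fin m) → Y}
    (h : ∀ x₀ : M, ContinuousOn (fun p : EuclideanSpace ℝ (Fin k) × EuclideanSpace ℝ (Fin m) =>
      F ((extChartAt I x₀).symm p.1, p.2)) ((extChartAt I x₀).target ×ˢ univ)) :
    Continuous F := by
  refine continuous_iff_continuousAt.2 fun q => ?_
  have hs : (extChartAt I q.1).source ×ˢ (univ : Set (EuclideanSpace ℝ (Fin m))) ∈ 𝓝 q :=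
    ((isOpen_extChartAt_source q.1).prod isOpen_univ).mem_nhds
      ⟨mem_extChartAt_source q.1, mem_univ _⟩
  have h1 : ContinuousOn (Prod.map (extChartAt I q.1) (id : EuclideanSpace ℝ (Fin m) → _))
      ((extChartAt I q.1).source ×ˢ univ) :=
    (continuousOn_extChartAt q.1).prodMap continuousOn_id
  have h2 := (h q.1).comp h1 (fun p hp => ⟨(extChartAt I q.1).map_source hp.1, mem_univ _⟩)
  refine (h2.congr ?_).continuousAt hs
  intro p hp
  simp only [Function.comp, Prod.map, id, (extChartAt I q.1).left_inv hp.1]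

theorem continuousOn_inv_gram_coordVec (g : Metric I M) (x₀ : M) (i j : Fin k) :
    ContinuousOn (fun z => (gram g ((extChartAt I x₀).symm z) (coordVec x₀ z))⁻¹ i j)
      (extChartAt I x₀).target := by
  have h1 := continuousOn_gram_coordVec g x₀
  have hdet := (Continuous.matrix_det (R := ℝ) (n := Fin k) continuous_id).comp_continuousOn h1
  have hadj := (Continuous.matrix_adjugate (R := ℝ) (n := Fin k) continuous_id).comp_continuousOn h1
  have h := (hdet.inv₀ fun z hz => (det_gram_coordVec_pos g x₀ hz).ne').mul
    ((continuous_apply_apply i j).comp_continuousOn hadj)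
  refine h.congr fun z _ => ?_
  rw [Matrix.inv_def, Ring.inverse_eq_inv']
  rfl

theorem continuous_covectorInner_diffX (g : Metric I M) {u v : M × EuclideanSpace ℝ (Fin m) → ℂ}
    (hu : ContMDiff (I.prod 𝓘(ℝ, EuclideanSpace ℝ (Fin m))) 𝓘(ℝ, ℂ) ∞ u)
    (hv : ContMDiff (I.prod 𝓘(ℝ, EuclideanSpace ℝ (Fin m))) 𝓘(ℝ, ℂ) ∞ v) :
    Continuous fun p => covectorInner g p.1 (diffX I u p) (diffX I v p) := by
  refine continuous_of_localRep (I := I) fun x₀ => ?_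
  refine ContinuousOn.congr (f := fun p => ∑ i, ∑ j,
      (((gram g ((extChartAt I x₀).symm p.1) (coordVec x₀ p.1))⁻¹ i j : ℝ) : ℂ) *
        localDiff I x₀ u p (EuclideanSpace.single i 1, 0) *
        conj (localDiff I x₀ v p (EuclideanSpace.single j 1, 0))) ?_
    fun p hp => covectorInner_diffX_eq g x₀ hu hv hp.1 p.2
  refine continuousOn_finsetSum _ fun i _ => continuousOn_finsetSum _ fun j _ => ?_
  have hG : ContinuousOn (fun p : EuclideanSpace ℝ (Fin k) × EuclideanSpace ℝ (Fin m) =>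
      (gram g ((extChartAt I x₀).symm p.1) (coordVec x₀ p.1))⁻¹ i j)
      ((extChartAt I x₀).target ×ˢ univ) :=
    (continuousOn_inv_gram_coordVec g x₀ i j).comp continuousOn_fst fun p hp => hp.1
  exact ((Complex.continuous_ofReal.comp_continuousOn hG).mul
    ((continuousOn_localDiff x₀ hu).clm_apply continuousOn_const)).mul
    (Complex.continuous_conj.comp_continuousOn
      ((continuousOn_localDiff x₀ hv).clm_apply continuousOn_const))

theorem continuous_diffY {u : M × EuclideanSpace ℝ (Fin m) → ℂ}
    (hu : ContMDiff (I.prod 𝓘(ℝ, EuclideanSpace ℝ (Fin m))) 𝓘(ℝ, ℂ) ∞ u) (j : Fin m) :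
    Continuous (diffY u j) := by
  refine continuous_of_localRep (I := I) fun x₀ => ?_
  refine ContinuousOn.congr ?_ fun p hp => diffY_localDiff x₀ hu hp.1 p.2 j
  exact (continuousOn_localDiff x₀ hu).clm_apply continuousOn_const

end Coordinates

/-! ### The Riemannian volume in charts -/

section Volume

variable {k : ℕ} {H : Type*} [TopologicalSpace H]
  {I : ModelWithCorners ℝ (EuclideanSpace ℝ (Fin k)) H}
  {M : Type*} [TopologicalSpace M] [ChartedSpace H M] [IsManifold I ∞ M]

/-- The density `√(det g_{ij})` of the Riemannian volume in the chart at `x₀`. -/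
noncomputable def volumeDensity (g : Metric I M) (x₀ : M) (z : EuclideanSpace ℝ (Fin k)) : ℝ :=
  Real.sqrt (gram g ((extChartAt I x₀).symm z) (coordVec x₀ z)).det

theorem continuousOn_volumeDensity (g : Metric I M) (x₀ : M) :
    ContinuousOn (volumeDensity g x₀) (extChartAt I x₀).target :=
  Real.continuous_sqrt.comp_continuousOn
    ((Continuous.matrix_det (R := ℝ) (n := Fin k) continuous_id).comp_continuousOn
      (continuousOn_gram_coordVec g x₀))

theorem volumeDensity_pos (g : Metric I M) (x₀ : M) {z : EuclideanSpace ℝ (Fin k)}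
    (hz : z ∈ (extChartAt I x₀).target) : 0 < volumeDensity g x₀ z :=
  Real.sqrt_pos.2 (det_gram_coordVec_pos g x₀ hz)

theorem measurableSet_extChartAt_target (x₀ : M) :
    MeasurableSet (extChartAt I x₀).target := by
  rw [extChartAt_target]
  exact ((chartAt H x₀).open_target.preimage I.continuous_symm).measurableSet.inter
    I.isClosed_range.measurableSet

/-- The points of the chart at `x₀` that also lie in the chart at `x₁`. -/
def overlap (I : ModelWithCorners ℝ (EuclideanSpace ℝ (Fin k)) H) (x₀ x₁ : M) :
    Set (EuclideanSpace ℝ (Fin k)) :=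
  (extChartAt I x₀).target ∩ (extChartAt I x₀).symm ⁻¹' (extChartAt I x₁).source

theorem metric_inner_congr (g : Metric I M) {x x' : M} (h : x = x')
    (v w : EuclideanSpace ℝ (Fin k)) :
    g.inner x (v : TangentSpace I x) (w : TangentSpace I x)
      = g.inner x' (v : TangentSpace I x') (w : TangentSpace I x') := by
  subst h; rfl

/-- The coordinate change between two charts has a derivative, whose determinant relates the two
densities of the Riemannian volume. -/
theorem exists_hasFDerivWithinAt_coordChange (g : Metric I M) (x₀ x₁ : M)
    {z : EuclideanSpace ℝ (Fin k)} (hz : z ∈ overlap I x₀ x₁) :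
    ∃ J : EuclideanSpace ℝ (Fin k) →L[ℝ] EuclideanSpace ℝ (Fin k),
      HasFDerivWithinAt (fun z => extChartAt I x₁ ((extChartAt I x₀).symm z)) J
        (overlap I x₀ x₁) z ∧
      volumeDensity g x₀ z =
        |J.det| * volumeDensity g x₁ (extChartAt I x₁ ((extChartAt I x₀).symm z)) := by
  set ψ := fun z => extChartAt I x₁ ((extChartAt I x₀).symm z) with hψ
  have hx1 : (extChartAt I x₀).symm z ∈ (extChartAt I x₁).source := hz.2
  have hinv : (extChartAt I x₁).symm (ψ z) = (extChartAt I x₀).symm z :=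
    (extChartAt I x₁).left_inv hx1
  have hsub : overlap I x₀ x₁ ⊆ range I := fun w hw => extChartAt_target_subset_range x₀ hw.1
  have hmem : overlap I x₀ x₁ ∈ 𝓝[range I] z := by
    refine inter_mem (extChartAt_target_mem_nhdsWithin_of_mem hz.1) ?_
    have hc := continuousOn_extChartAt_symm (I := I) x₀ z hz.1
    have := hc.preimage_mem_nhdsWithin ((isOpen_extChartAt_source x₁).mem_nhds hx1)
    have hn : 𝓝[range I] z ≤ 𝓝[(extChartAt I x₀).target] z :=
      nhdsWithin_le_of_mem (extChartAt_target_mem_nhdsWithin_of_mem hz.1)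
    exact hn this
  have hs0 : HasMFDerivWithinAt 𝓘(ℝ, EuclideanSpace ℝ (Fin k)) I (extChartAt I x₀).symm (range I) z
      (mfderivWithin 𝓘(ℝ, EuclideanSpace ℝ (Fin k)) I (extChartAt I x₀).symm (range I) z) :=
    (mdifferentiableWithinAt_extChartAt_symm hz.1).hasMFDerivWithinAt
  have hψd : HasMFDerivWithinAt 𝓘(ℝ, EuclideanSpace ℝ (Fin k)) 𝓘(ℝ, EuclideanSpace ℝ (Fin k))
      ψ (range I) z ((mfderiv I 𝓘(ℝ, EuclideanSpace ℝ (Fin k)) (extChartAt I x₁)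
        ((extChartAt I x₀).symm z)).comp
        (mfderivWithin 𝓘(ℝ, EuclideanSpace ℝ (Fin k)) I (extChartAt I x₀).symm (range I) z)) :=
    (mdifferentiableAt_extChartAt
      (by rwa [← extChartAt_source I])).hasMFDerivAt.comp_hasMFDerivWithinAt z hs0
  -- the derivative of the coordinate change, by the chain rule through `M`
  set J : EuclideanSpace ℝ (Fin k) →L[ℝ] EuclideanSpace ℝ (Fin k) :=
    (mfderiv I 𝓘(ℝ, EuclideanSpace ℝ (Fin k)) (extChartAt I x₁)
        ((extChartAt I x₀).symm z)).comp
        (mfderivWithin 𝓘(ℝ, EuclideanSpace ℝ (Fin k)) I (extChartAt I x₀).symm (range I) z)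
    with hJ
  refine ⟨J, hψd.hasFDerivWithinAt.mono hsub, ?_⟩
  have hψt : ψ z ∈ (extChartAt I x₁).target := (extChartAt I x₁).map_source hx1
  set c1 : EuclideanSpace ℝ (Fin k) →L[ℝ] TangentSpace I ((extChartAt I x₁).symm (ψ z)) :=
    mfderivWithin 𝓘(ℝ, EuclideanSpace ℝ (Fin k)) I (extChartAt I x₁).symm (range I) (ψ z) with hc1
  have hs1 : HasMFDerivWithinAt 𝓘(ℝ, EuclideanSpace ℝ (Fin k)) I (extChartAt I x₁).symm
      (range I) (ψ z) c1 :=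
    (mdifferentiableWithinAt_extChartAt_symm hψt).hasMFDerivWithinAt
  -- the coordinate vectors of the first chart are the images under `c1` of the columns of `J`
  have hcomp : HasMFDerivWithinAt 𝓘(ℝ, EuclideanSpace ℝ (Fin k)) I
      ((extChartAt I x₁).symm ∘ ψ) (range I) z (c1.comp J) :=
    hs1.comp z hψd fun w _ => ⟨chartAt H x₁ ((extChartAt I x₀).symm w), rfl⟩
  have hcongr : HasMFDerivWithinAt 𝓘(ℝ, EuclideanSpace ℝ (Fin k)) I
      (extChartAt I x₀).symm (range I) z (c1.comp J) := by
    refine hcomp.congr_of_eventuallyEq ?_ hinv.symm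
    filter_upwards [hmem] with w hw
    exact ((extChartAt I x₁).left_inv hw.2).symm
  have hU : UniqueMDiffWithinAt 𝓘(ℝ, EuclideanSpace ℝ (Fin k)) (range I) z :=
    (I.uniqueDiffOn z (extChartAt_target_subset_range x₀ hz.1)).uniqueMDiffWithinAt
  have heq : ∀ v : EuclideanSpace ℝ (Fin k),
      (mfderivWithin 𝓘(ℝ, EuclideanSpace ℝ (Fin k)) I (extChartAt I x₀).symm (range I) z v :
        EuclideanSpace ℝ (Fin k)) = c1 (J v) := fun v =>
    congrArg (fun L : EuclideanSpace ℝ (Fin k) →L[ℝ] EuclideanSpace ℝ (Fin k) => L v)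
      (hU.eq hs0 hcongr)
  -- the metric in the second chart; pulling it back by `J` multiplies its determinant by
  -- `det J ^ 2`
  let B : EuclideanSpace ℝ (Fin k) →ₗ[ℝ] EuclideanSpace ℝ (Fin k) →ₗ[ℝ] ℝ :=
    (metricForm g ((extChartAt I x₁).symm (ψ z))).compl₁₂ (c1 : _ →ₗ[ℝ] _) (c1 : _ →ₗ[ℝ] _)
  have hdet : (gram g ((extChartAt I x₀).symm z) (coordVec x₀ z)).det =
      J.det ^ 2 * (gram g ((extChartAt I x₁).symm (ψ z)) (coordVec x₁ (ψ z))).det := by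
    have h := det_gram_comp B (J : EuclideanSpace ℝ (Fin k) →ₗ[ℝ] EuclideanSpace ℝ (Fin k))
    refine Eq.trans ?_ h
    congr 1
    ext i j
    have := metric_inner_congr g hinv.symm
      (coordVec (I := I) x₀ z i : EuclideanSpace ℝ (Fin k))
      (coordVec (I := I) x₀ z j : EuclideanSpace ℝ (Fin k))
    refine this.trans ?_
    rw [show (coordVec (I := I) x₀ z i : EuclideanSpace ℝ (Fin k)) = _ from heq _,
      show (coordVec (I := I) x₀ z j : EuclideanSpace ℝ (Fin k)) = _ from heq _]
    rfl
  rw [volumeDensity, hdet, Real.sqrt_mul (sq_nonneg _), Real.sqrt_sq_eq_abs]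
  rfl

variable [MeasurableSpace M] [BorelSpace M]

theorem aemeasurable_extChartAt_symm (x₀ : M) :
    AEMeasurable (extChartAt I x₀).symm (volume.restrict (extChartAt I x₀).target) :=
  (continuousOn_extChartAt_symm x₀).aemeasurable (measurableSet_extChartAt_target x₀)

theorem chartVolume_apply (g : Metric I M) (x₀ : M) {A : Set M} (hA : MeasurableSet A) :
    chartVolume g x₀ A = ∫⁻ z in (extChartAt I x₀).target ∩ (extChartAt I x₀).symm ⁻¹' A,
      ENNReal.ofReal (volumeDensity g x₀ z) := by
  rw [chartVolume, Measure.map_apply_of_aemeasurable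
    ((aemeasurable_extChartAt_symm x₀).mono_ac (withDensity_absolutelyContinuous _ _)) hA,
    withDensity_apply', Measure.restrict_restrict' (measurableSet_extChartAt_target x₀), inter_comm]
  rfl

theorem measurableSet_target_inter_preimage (x₀ : M) {A : Set M} (hA : MeasurableSet A) :
    MeasurableSet ((extChartAt I x₀).target ∩ (extChartAt I x₀).symm ⁻¹' A) := by
  have h := (continuousOn_extChartAt_symm (I := I) x₀).domRestrict.measurable hA
  have := (measurableSet_extChartAt_target (I := I) x₀).subtype_image h
  convert this using 1
  ext z
  simp [and_comm]

/-- The volumes of two charts agree on their common domain, by the change of variables formula. -/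
theorem chartVolume_eq_of_subset (g : Metric I M) (x₀ x₁ : M) {A : Set M} (hA : MeasurableSet A)
    (h0 : A ⊆ (extChartAt I x₀).source) (h1 : A ⊆ (extChartAt I x₁).source) :
    chartVolume g x₀ A = chartVolume g x₁ A := by
  rw [chartVolume_apply g x₀ hA, chartVolume_apply g x₁ hA]
  set S := (extChartAt I x₀).target ∩ (extChartAt I x₀).symm ⁻¹' A with hS
  have hSo : S ⊆ overlap I x₀ x₁ := fun z hz => ⟨hz.1, h1 hz.2⟩
  choose! J hJ hJd using fun z (hz : z ∈ overlap I x₀ x₁) =>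
    exists_hasFDerivWithinAt_coordChange g x₀ x₁ hz
  have himg : (extChartAt I x₁).target ∩ (extChartAt I x₁).symm ⁻¹' A =
      (fun z => extChartAt I x₁ ((extChartAt I x₀).symm z)) '' S := by
    ext w
    constructor
    · rintro ⟨hw, hwA⟩
      refine ⟨extChartAt I x₀ ((extChartAt I x₁).symm w),
        ⟨(extChartAt I x₀).map_source (h0 hwA), ?_⟩, ?_⟩
      · rw [mem_preimage, (extChartAt I x₀).left_inv (h0 hwA)]; exact hwA
      · simp only [(extChartAt I x₀).left_inv (h0 hwA), (extChartAt I x₁).right_inv hw]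
    · rintro ⟨z, ⟨hz, hzA⟩, rfl⟩
      refine ⟨(extChartAt I x₁).map_source (h1 hzA), ?_⟩
      rw [mem_preimage, (extChartAt I x₁).left_inv (h1 hzA)]
      exact hzA
  have hinj : InjOn (fun z => extChartAt I x₁ ((extChartAt I x₀).symm z)) S := by
    intro z hz w hw h
    exact (extChartAt I x₀).symm.injOn hz.1 hw.1 ((extChartAt I x₁).injOn (h1 hz.2) (h1 hw.2) h)
  rw [himg, lintegral_image_eq_lintegral_abs_det_fderiv_mul volume
    (measurableSet_target_inter_preimage x₀ hA) (fun z hz => (hJ z (hSo hz)).mono hSo) hinj]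
  refine setLIntegral_congr_fun (measurableSet_target_inter_preimage x₀ hA) fun z hz => ?_
  rw [hJd z (hSo hz), ENNReal.ofReal_mul (abs_nonneg _)]

theorem chartVolume_le (g : Metric I M) (x₀ x₁ : M) {A : Set M} (hA : MeasurableSet A)
    (h0 : A ⊆ (extChartAt I x₀).source) : chartVolume g x₁ A ≤ chartVolume g x₀ A := by
  have hs := (isOpen_extChartAt_source (I := I) x₁).measurableSet
  have h : chartVolume g x₁ A = chartVolume g x₁ (A ∩ (extChartAt I x₁).source) := by
    rw [chartVolume_apply g x₁ hA, chartVolume_apply g x₁ (hA.inter hs)]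
    congr 2
    ext z
    simp only [mem_inter_iff, mem_preimage]
    exact ⟨fun h => ⟨h.1, h.2, (extChartAt I x₁).map_target h.1⟩, fun h => ⟨h.1, h.2.1⟩⟩
  rw [h, chartVolume_eq_of_subset g x₁ x₀ (hA.inter hs) inter_subset_right
    (inter_subset_left.trans h0)]
  exact measure_mono inter_subset_left

/-- The Riemannian volume restricts to the measure of each chart. -/
theorem riemannianVolume_apply (g : Metric I M) (x₀ : M) {A : Set M} (hA : MeasurableSet A)
    (h0 : A ⊆ (extChartAt I x₀).source) :
    riemannianVolume g A = ∫⁻ z in (extChartAt I x₀).target ∩ (extChartAt I x₀).symm ⁻¹' A,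
      ENNReal.ofReal (volumeDensity g x₀ z) := by
  rw [← chartVolume_apply g x₀ hA]
  have hs := (isOpen_extChartAt_source (I := I) x₀).measurableSet
  refine le_antisymm ?_ (Measure.le_iff'.1 (le_iSup (chartVolume g) x₀) A)
  -- off the chart domain, the volume itself serves as an upper bound
  have hle : riemannianVolume g ≤ (chartVolume g x₀).restrict (extChartAt I x₀).source +
      (riemannianVolume g).restrict (extChartAt I x₀).sourceᶜ := by
    refine iSup_le fun x₁ => Measure.le_iff.2 fun B hB => ?_
    rw [Measure.add_apply, Measure.restrict_apply hB, Measure.restrict_apply hB,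
      ← measure_inter_add_sdiff B hs]
    refine add_le_add (chartVolume_le g x₀ x₁ (hB.inter hs) inter_subset_right) ?_
    exact Measure.le_iff'.1 (le_iSup (chartVolume g) x₁) _
  refine (Measure.le_iff'.1 hle A).trans ?_
  rw [Measure.add_apply, Measure.restrict_apply hA, Measure.restrict_apply hA,
    inter_eq_left.2 h0, (disjoint_compl_right_iff_subset.2 h0).inter_eq, measure_empty, add_zero]

end Volume

/-! ### Coordinate patches -/

section Patches

variable {k m : ℕ} {H : Type*} [TopologicalSpace H]
  {I : ModelWithCorners ℝ (EuclideanSpace ℝ (Fin k)) H}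
  {M : Type*} [TopologicalSpace M] [ChartedSpace H M] [IsManifold I ∞ M]

theorem measurableSet_inter_preimage {X Y : Type*} [TopologicalSpace X] [MeasurableSpace X]
    [BorelSpace X] [TopologicalSpace Y] [MeasurableSpace Y] [BorelSpace Y] {f : X → Y} {s : Set X}
    {t : Set Y} (hf : ContinuousOn f s) (hs : MeasurableSet s) (ht : MeasurableSet t) :
    MeasurableSet (s ∩ f ⁻¹' t) := by
  convert hs.subtype_image (hf.domRestrict.measurable ht) using 1
  ext z
  simp [and_comm]

theorem IsBoundaryModel.convex_range (hI : IsBoundaryModel I) : Convex ℝ (range I) := by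
  rcases hI with h | ⟨i, h⟩
  · rw [h]; exact convex_univ
  · rw [h]
    exact convex_halfSpace_ge
      (EuclideanSpace.proj i : EuclideanSpace ℝ (Fin k) →L[ℝ] ℝ).toLinearMap.isLinear 0

/-- Around each point there is a patch of `M` which corresponds to a compact convex set in the
chart. -/
theorem exists_patch (hI : IsBoundaryModel I) (x₀ : M) :
    ∃ K : Set (EuclideanSpace ℝ (Fin k)), IsCompact K ∧ Convex ℝ K ∧
      K ⊆ (extChartAt I x₀).target ∧ (extChartAt I x₀).symm '' K ∈ 𝓝 x₀ := by
  have h := extChartAt_target_mem_nhdsWithin (I := I) x₀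
  rw [mem_nhdsWithin_iff_exists_mem_nhds_inter] at h
  obtain ⟨U, hU, hUt⟩ := h
  obtain ⟨r, hr, hrU⟩ := Metric.nhds_basis_closedBall.mem_iff.1 hU
  refine ⟨Metric.closedBall (extChartAt I x₀ x₀) r ∩ range I,
    (isCompact_closedBall _ _).inter_right I.isClosed_range,
    (convex_closedBall _ _).inter hI.convex_range,
    (inter_subset_inter_left _ hrU).trans hUt, ?_⟩
  have hc := continuousAt_extChartAt (I := I) x₀
  have hb := hc.preimage_mem_nhds (Metric.closedBall_mem_nhds (extChartAt I x₀ x₀) hr)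
  filter_upwards [hb, extChartAt_source_mem_nhds (I := I) x₀] with x hx hxs
  exact ⟨extChartAt I x₀ x, ⟨hx, ⟨chartAt H x₀ x, rfl⟩⟩, (extChartAt I x₀).left_inv hxs⟩

theorem symm_image_eq (x₀ : M) {K : Set (EuclideanSpace ℝ (Fin k))}
    (hK : K ⊆ (extChartAt I x₀).target) :
    (extChartAt I x₀).symm '' K = (extChartAt I x₀).source ∩ extChartAt I x₀ ⁻¹' K :=
  (extChartAt I x₀).symm_image_eq_source_inter_preimage hK

theorem exists_volumeDensity_bounds (g : Metric I M) (x₀ : M) {K : Set (EuclideanSpace ℝ (Fin k))}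
    (hKc : IsCompact K) (hK : K ⊆ (extChartAt I x₀).target) :
    ∃ C : ℝ, 0 < C ∧ ∀ z ∈ K, volumeDensity g x₀ z ≤ C ∧ 1 ≤ C * volumeDensity g x₀ z := by
  have hc := (continuousOn_volumeDensity g x₀).mono hK
  obtain ⟨C₁, hC₁⟩ := hKc.exists_bound_of_continuousOn hc
  obtain ⟨C₂, hC₂⟩ := hKc.exists_bound_of_continuousOn
    (hc.inv₀ fun z hz => (volumeDensity_pos g x₀ (hK hz)).ne')
  refine ⟨max 1 (max C₁ C₂), by positivity, fun z hz => ?_⟩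
  have hp := volumeDensity_pos g x₀ (hK hz)
  refine ⟨((le_abs_self _).trans (hC₁ z hz)).trans (by simp), ?_⟩
  have h2 : (volumeDensity g x₀ z)⁻¹ ≤ max 1 (max C₁ C₂) :=
    ((le_abs_self _).trans (hC₂ z hz)).trans (by simp)
  rwa [inv_le_iff_one_le_mul₀ hp] at h2

variable [MeasurableSpace M] [BorelSpace M]

theorem measurableSet_symm_image (x₀ : M) {K : Set (EuclideanSpace ℝ (Fin k))}
    (hK : K ⊆ (extChartAt I x₀).target) (hKm : MeasurableSet K) :
    MeasurableSet ((extChartAt I x₀).symm '' K) := by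
  rw [symm_image_eq x₀ hK]
  exact measurableSet_inter_preimage (continuousOn_extChartAt x₀)
    (isOpen_extChartAt_source x₀).measurableSet hKm

theorem aemeasurable_symm_restrict (x₀ : M) {K : Set (EuclideanSpace ℝ (Fin k))}
    (hK : K ⊆ (extChartAt I x₀).target) :
    AEMeasurable (extChartAt I x₀).symm (volume.restrict K) :=
  (aemeasurable_extChartAt_symm x₀).mono_measure (Measure.restrict_mono hK le_rfl)

theorem riemannianVolume_restrict_apply (g : Metric I M) (x₀ : M)
    {K : Set (EuclideanSpace ℝ (Fin k))}
    (hK : K ⊆ (extChartAt I x₀).target) (hKm : MeasurableSet K) {A : Set M}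
    (hA : MeasurableSet A) :
    (riemannianVolume g).restrict ((extChartAt I x₀).symm '' K) A =
      ∫⁻ z in K ∩ (extChartAt I x₀).symm ⁻¹' A, ENNReal.ofReal (volumeDensity g x₀ z) := by
  have hm := measurableSet_symm_image x₀ hK hKm
  rw [Measure.restrict_apply hA, riemannianVolume_apply g x₀ (hA.inter hm)]
  · congr 2
    ext z
    constructor
    · rintro ⟨hz, hzA, w, hw, h⟩
      have : w = z := (extChartAt I x₀).symm.injOn (hK hw) hz h
      exact ⟨this ▸ hw, hzA⟩
    · rintro ⟨hz, hzA⟩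
      exact ⟨hK hz, hzA, z, hz, rfl⟩
  · rintro _ ⟨_, z, hz, rfl⟩
    exact (extChartAt I x₀).map_target (hK hz)

theorem map_symm_apply (x₀ : M) {K : Set (EuclideanSpace ℝ (Fin k))}
    (hK : K ⊆ (extChartAt I x₀).target) (hKm : MeasurableSet K) {A : Set M}
    (hA : MeasurableSet A) :
    (volume.restrict K).map (extChartAt I x₀).symm A =
      ∫⁻ _ in K ∩ (extChartAt I x₀).symm ⁻¹' A, 1 := by
  rw [Measure.map_apply_of_aemeasurable (aemeasurable_symm_restrict x₀ hK) hA,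
    Measure.restrict_apply' hKm, setLIntegral_one, inter_comm]

theorem measurableSet_inter_symm_preimage (x₀ : M) {K : Set (EuclideanSpace ℝ (Fin k))}
    (hK : K ⊆ (extChartAt I x₀).target) (hKm : MeasurableSet K) {A : Set M}
    (hA : MeasurableSet A) : MeasurableSet (K ∩ (extChartAt I x₀).symm ⁻¹' A) :=
  measurableSet_inter_preimage ((continuousOn_extChartAt_symm x₀).mono hK) hKm hA

theorem riemannianVolume_restrict_le (g : Metric I M) (x₀ : M)
    {K : Set (EuclideanSpace ℝ (Fin k))}
    (hK : K ⊆ (extChartAt I x₀).target) (hKm : MeasurableSet K) {C : ℝ}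
    (hC : ∀ z ∈ K, volumeDensity g x₀ z ≤ C) :
    (riemannianVolume g).restrict ((extChartAt I x₀).symm '' K) ≤
      ENNReal.ofReal C • (volume.restrict K).map (extChartAt I x₀).symm := by
  refine Measure.le_iff.2 fun A hA => ?_
  rw [riemannianVolume_restrict_apply g x₀ hK hKm hA, Measure.smul_apply,
    map_symm_apply x₀ hK hKm hA, smul_eq_mul, ← lintegral_const_mul _ measurable_const, mul_one]
  exact setLIntegral_mono' (measurableSet_inter_symm_preimage x₀ hK hKm hA)
    fun z hz => ENNReal.ofReal_le_ofReal (hC z hz.1)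

theorem map_symm_le (g : Metric I M) (x₀ : M)
    {K : Set (EuclideanSpace ℝ (Fin k))}
    (hK : K ⊆ (extChartAt I x₀).target) (hKm : MeasurableSet K) {C : ℝ} (hC0 : 0 ≤ C)
    (hC : ∀ z ∈ K, 1 ≤ C * volumeDensity g x₀ z) :
    (volume.restrict K).map (extChartAt I x₀).symm ≤
      ENNReal.ofReal C • (riemannianVolume g).restrict ((extChartAt I x₀).symm '' K) := by
  refine Measure.le_iff.2 fun A hA => ?_
  rw [Measure.smul_apply, riemannianVolume_restrict_apply g x₀ hK hKm hA,
    map_symm_apply x₀ hK hKm hA, smul_eq_mul]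
  rw [← lintegral_const_mul' _ _ ENNReal.ofReal_ne_top]
  refine setLIntegral_mono' (measurableSet_inter_symm_preimage x₀ hK hKm hA)
    fun z hz => ?_
  rw [← ENNReal.ofReal_mul hC0, ← ENNReal.ofReal_one]
  exact ENNReal.ofReal_le_ofReal (hC z hz.1)

/-- The compact manifold `M` has finite volume. -/
theorem isFiniteMeasure_riemannianVolume [CompactSpace M] (hI : IsBoundaryModel I)
    (g : Metric I M) : IsFiniteMeasure (riemannianVolume g) := by
  have : ∀ x₀ : M, (riemannianVolume g).FiniteAtFilter (𝓝 x₀) := by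
    intro x₀
    obtain ⟨K, hKc, -, hK, hKn⟩ := exists_patch hI x₀
    obtain ⟨C, -, hC⟩ := exists_volumeDensity_bounds g x₀ hKc hK
    refine ⟨_, hKn, ?_⟩
    have h := riemannianVolume_restrict_le g x₀ hK hKc.measurableSet (fun z hz => (hC z hz).1)
    have h2 := Measure.le_iff'.1 h univ
    rw [Measure.restrict_apply_univ] at h2
    refine h2.trans_lt ?_
    rw [Measure.smul_apply, map_symm_apply x₀ hK hKc.measurableSet MeasurableSet.univ,
      setLIntegral_one]
    exact ENNReal.mul_lt_top ENNReal.ofReal_lt_top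
      ((measure_mono inter_subset_left).trans_lt hKc.measure_lt_top)
  exact ⟨isCompact_univ.measure_lt_top_of_nhdsWithin fun x _ => by
    rw [nhdsWithin_univ]; exact this x⟩

theorem secondCountableTopology (I : ModelWithCorners ℝ (EuclideanSpace ℝ (Fin k)) H) (M : Type*)
    [TopologicalSpace M] [ChartedSpace H M] [CompactSpace M] : SecondCountableTopology M :=
  have := I.secondCountableTopology
  ChartedSpace.secondCountable_of_sigmaCompact H M

/-- The boundary of `M` is a null set: in a chart it lies in the frontier of a convex set. -/
theorem riemannianVolume_boundary [CompactSpace M] (hI : IsBoundaryModel I) (g : Metric I M) :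
    riemannianVolume g (I.boundary M) = 0 := by
  have := secondCountableTopology I M
  refine measure_null_of_locally_null _ fun x _ => ?_
  refine ⟨(extChartAt I x).source ∩ I.boundary M,
    inter_mem (nhdsWithin_le_nhds (extChartAt_source_mem_nhds x)) self_mem_nhdsWithin, ?_⟩
  have hbm : MeasurableSet (I.boundary M) :=
    (I.isClosed_boundary (M := M) (n := ∞) (by simp)).measurableSet
  rw [riemannianVolume_apply g x ((isOpen_extChartAt_source x).measurableSet.inter hbm)
    inter_subset_left]
  refine setLIntegral_measure_zero _ _
    (measure_mono_null ?_ (hI.convex_range.addHaar_frontier volume))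
  rintro z ⟨hz, hzs, hzb⟩
  rw [extChartAt_source] at hzs
  have h1 : z ∉ interior (extChartAt I x).target := by
    have := (I.isBoundaryPoint_iff_of_mem_atlas (n := ∞) (by simp) (chart_mem_atlas H x) hzs).1 hzb
    have h2 := this.2
    change (extChartAt I x) ((extChartAt I x).symm z) ∉ interior (extChartAt I x).target at h2
    rwa [(extChartAt I x).right_inv hz] at h2
  refine ⟨subset_closure (extChartAt_target_subset_range x hz), fun h3 => h1 ?_⟩
  have h4 : z ∈ I.symm ⁻¹' (chartAt H x).target ∩ range I := by rwa [← extChartAt_target]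
  have := (chartAt H x).mem_interior_extend_target (I := I) (y := I.symm z) h4.1
    (by rwa [I.right_inv h4.2])
  rwa [I.right_inv h4.2] at this

end Patches

/-! ### The Poincaré inequality on convex sets -/

section Poincare

/-- Cauchy–Schwarz for the square of an integral. -/
theorem sq_lintegral_le {α : Type*} [MeasurableSpace α] (μ : Measure α) {f : α → ℝ≥0∞}
    (hf : AEMeasurable f μ) : (∫⁻ a, f a ∂μ) ^ 2 ≤ μ univ * ∫⁻ a, f a ^ 2 ∂μ := by
  have h := ENNReal.lintegral_mul_le_Lp_mul_Lq μ (p := 2) (q := 2) Real.HolderConjugate.two_two hf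
    (g := fun _ => 1) aemeasurable_const
  simp only [Pi.mul_apply, mul_one, ENNReal.one_rpow, lintegral_one] at h
  calc (∫⁻ a, f a ∂μ) ^ 2
      ≤ ((∫⁻ a, f a ^ (2 : ℝ) ∂μ) ^ (1 / 2 : ℝ) * μ univ ^ (1 / 2 : ℝ)) ^ 2 := by gcongr
    _ = μ univ * ∫⁻ a, f a ^ 2 ∂μ := by
        rw [mul_pow, ← ENNReal.rpow_natCast, ← ENNReal.rpow_natCast, ← ENNReal.rpow_mul,
          ← ENNReal.rpow_mul]
        norm_num
        rw [mul_comm]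

variable {V : Type*} [NormedAddCommGroup V] [NormedSpace ℝ V] [FiniteDimensional ℝ V]
  [MeasurableSpace V] [BorelSpace V] (μ : Measure V) [μ.IsAddHaarMeasure]

theorem lintegral_comp_add_smul (G : V → ℝ≥0∞) (y : V) {t : ℝ} (ht : 1 / 2 ≤ t) :
    ∫⁻ x, G (y + t • x) ∂μ ≤ 2 ^ Module.finrank ℝ V * ∫⁻ x, G x ∂μ := by
  have ht0 : t ≠ 0 := by intro h; rw [h] at ht; norm_num at ht
  have htp : 0 < t := by linarith
  have h1 : ∫⁻ x, G (y + t • x) ∂μ = ∫⁻ x, G (y + x) ∂(μ.map (t • ·)) :=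
    ((Homeomorph.smulOfNeZero t ht0).measurableEmbedding.lintegral_map fun x => G (y + x)).symm
  rw [h1, Measure.map_addHaar_smul μ ht0, lintegral_smul_measure, lintegral_add_left_eq_self,
    smul_eq_mul]
  gcongr
  rw [abs_of_nonneg (by positivity), ← inv_pow]
  have : t⁻¹ ≤ 2 := by
    rw [inv_le_comm₀ htp (by norm_num)]; linarith
  calc ENNReal.ofReal (t⁻¹ ^ Module.finrank ℝ V) ≤ ENNReal.ofReal (2 ^ Module.finrank ℝ V) :=
        ENNReal.ofReal_le_ofReal (by gcongr)
    _ = 2 ^ Module.finrank ℝ V := by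
        rw [ENNReal.ofReal_pow (by norm_num)]; norm_num

/-- Averaging a function supported in `Q` along a segment whose end points vary over `Q`. One of the
end points moves the intermediate point with speed at least `1 / 2`. -/
theorem lintegral_lintegral_segment_le {Q : Set V} {G : V → ℝ≥0∞} (hG : Measurable G) (t : ℝ) :
    ∫⁻ x in Q, ∫⁻ y in Q, G (y + t • (x - y)) ∂μ ∂μ ≤
      2 ^ Module.finrank ℝ V * μ Q * ∫⁻ x, G x ∂μ := by
  have hcomm : ∀ (x y : V), y + t • (x - y) = t • x + (1 - t) • y := fun x y => by
    rw [smul_sub, sub_smul, one_smul]; abel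
  rcases le_total (1 / 2) t with ht | ht
  · rw [lintegral_lintegral_swap]
    · calc ∫⁻ y in Q, ∫⁻ x in Q, G (y + t • (x - y)) ∂μ ∂μ
          ≤ ∫⁻ y in Q, 2 ^ Module.finrank ℝ V * ∫⁻ x, G x ∂μ ∂μ := by
            refine lintegral_mono fun y => ?_
            refine (setLIntegral_le_lintegral _ _).trans ?_
            have h := lintegral_comp_add_smul μ G ((1 - t) • y) ht
            refine le_trans (le_of_eq ?_) h
            exact lintegral_congr fun x => by rw [hcomm, add_comm]
        _ = _ := by rw [setLIntegral_const]; ring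
    · exact (hG.comp (by fun_prop : Measurable fun p : V × V =>
        p.2 + t • (p.1 - p.2))).aemeasurable
  · calc ∫⁻ x in Q, ∫⁻ y in Q, G (y + t • (x - y)) ∂μ ∂μ
        ≤ ∫⁻ x in Q, 2 ^ Module.finrank ℝ V * ∫⁻ x, G x ∂μ ∂μ := by
          refine lintegral_mono fun x => ?_
          refine (setLIntegral_le_lintegral _ _).trans ?_
          have h := lintegral_comp_add_smul μ G (t • x) (t := 1 - t) (by linarith)
          refine le_trans (le_of_eq ?_) h
          exact lintegral_congr fun y => by rw [hcomm]
      _ = _ := by rw [setLIntegral_const]; ring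

/-- The increment of a function between two points of a convex set, in terms of its differential on
the segment which joins them. -/
theorem enorm_sub_sq_le_lintegral {Q : Set V} (hQ : Convex ℝ Q) {f : V → ℂ} {f' : V → V →L[ℝ] ℂ}
    (hf : ∀ z ∈ Q, HasFDerivWithinAt f (f' z) Q z) (hf' : ContinuousOn f' Q) {ρ : ℝ}
    {x y : V} (hx : x ∈ Q) (hy : y ∈ Q) (hρ : ‖x - y‖ ≤ ρ) :
    ‖f x - f y‖ₑ ^ 2 ≤ ENNReal.ofReal (ρ ^ 2) *
      ∫⁻ t in Icc (0 : ℝ) 1, ‖f' (y + t • (x - y))‖ₑ ^ 2 := by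
  have hρ0 : 0 ≤ ρ := (norm_nonneg _).trans hρ
  have hseg : MapsTo (fun t : ℝ => y + t • (x - y)) (Icc 0 1) Q := fun t ht =>
    hQ.add_smul_sub_mem hy hx ht
  have hcont : ContinuousOn (fun t : ℝ => f' (y + t • (x - y))) (Icc 0 1) :=
    hf'.comp (by fun_prop) hseg
  have hd : ∀ t ∈ Icc (0 : ℝ) 1, HasDerivWithinAt (fun t : ℝ => f (y + t • (x - y)))
      (f' (y + t • (x - y)) (x - y)) (Icc 0 1) t := by
    intro t ht
    have h1 : HasDerivWithinAt (fun t : ℝ => y + t • (x - y)) (x - y) (Icc 0 1) t := by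
      simpa using (((hasDerivAt_id t).smul_const (x - y)).const_add y).hasDerivWithinAt
    exact (hf _ (hseg ht)).comp_hasDerivWithinAt t h1 hseg
  have hci : ContinuousOn (fun t : ℝ => f' (y + t • (x - y)) (x - y)) (Icc 0 1) :=
    hcont.clm_apply continuousOn_const
  have hint : f x - f y = ∫ t in (0 : ℝ)..1, f' (y + t • (x - y)) (x - y) := by
    have := intervalIntegral.integral_eq_sub_of_hasDeriv_right_of_le (a := (0 : ℝ)) (b := 1)
      zero_le_one (fun t ht => (hd t ht).continuousWithinAt)
      (fun t ht => ((hd t (Ioo_subset_Icc_self ht)).mono_of_mem_nhdsWithin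
        (mem_nhdsWithin_of_mem_nhds (Icc_mem_nhds ht.1 ht.2))))
      (hci.intervalIntegrable_of_Icc zero_le_one)
    rw [this]
    simp
  have hmeas : AEMeasurable (fun t : ℝ => ‖f' (y + t • (x - y))‖ₑ)
      (volume.restrict (Icc (0 : ℝ) 1)) :=
    (hcont.aestronglyMeasurable measurableSet_Icc).enorm
  have h1 : ‖f x - f y‖ₑ ≤ ENNReal.ofReal ρ * ∫⁻ t in Icc (0 : ℝ) 1, ‖f' (y + t • (x - y))‖ₑ := by
    rw [hint, intervalIntegral.integral_of_le zero_le_one, ← integral_Icc_eq_integral_Ioc]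
    refine (enorm_integral_le_lintegral_enorm _).trans ?_
    rw [← lintegral_const_mul'' _ hmeas]
    refine lintegral_mono fun t => ?_
    refine (ContinuousLinearMap.le_opENorm _ _).trans ?_
    rw [mul_comm]
    gcongr
    rw [← ofReal_norm]
    exact ENNReal.ofReal_le_ofReal hρ
  calc ‖f x - f y‖ₑ ^ 2
      ≤ (ENNReal.ofReal ρ * ∫⁻ t in Icc (0 : ℝ) 1, ‖f' (y + t • (x - y))‖ₑ) ^ 2 := by gcongr
    _ ≤ _ := by
      rw [mul_pow, ENNReal.ofReal_pow hρ0]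
      gcongr
      simpa using sq_lintegral_le _ hmeas

/-- The Poincaré inequality on a convex set `Q` of diameter at most `ρ`, for the mean square of
the differences. -/
theorem poincare_convex {Q : Set V} (hQ : Convex ℝ Q) (hQm : MeasurableSet Q) {f : V → ℂ}
    {f' : V → V →L[ℝ] ℂ}
    (hf : ∀ z ∈ Q, HasFDerivWithinAt f (f' z) Q z) (hf' : ContinuousOn f' Q) {ρ : ℝ}
    (hρ : ∀ x ∈ Q, ∀ y ∈ Q, ‖x - y‖ ≤ ρ) :
    ∫⁻ x in Q, ∫⁻ y in Q, ‖f x - f y‖ₑ ^ 2 ∂μ ∂μ ≤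
      ENNReal.ofReal (ρ ^ 2) * 2 ^ Module.finrank ℝ V * μ Q * ∫⁻ x in Q, ‖f' x‖ₑ ^ 2 ∂μ := by
  -- extending the differential by zero off `Q` allows to translate and rescale in the whole space
  set G : V → ℝ≥0∞ := Q.indicator fun z => ‖f' z‖ₑ ^ 2 with hG
  have hGm : Measurable G := by
    have hc : ContinuousOn (fun z => ‖f' z‖ₑ ^ 2) Q :=
      (ENNReal.continuous_pow 2).comp_continuousOn (continuous_enorm.comp_continuousOn hf')
    classical
    rw [hG, ← Set.piecewise_eq_indicator]
    exact hc.measurable_piecewise continuousOn_const hQm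
  have hm3 : Measurable fun p : (V × V) × ℝ => G (p.1.2 + p.2 • (p.1.1 - p.1.2)) :=
    hGm.comp (by fun_prop)
  have step : ∀ x ∈ Q, ∀ y ∈ Q, ‖f x - f y‖ₑ ^ 2 ≤ ENNReal.ofReal (ρ ^ 2) *
      ∫⁻ t in Icc (0 : ℝ) 1, G (y + t • (x - y)) := by
    intro x hx y hy
    refine (enorm_sub_sq_le_lintegral hQ hf hf' hx hy (hρ x hx y hy)).trans (le_of_eq ?_)
    congr 1
    refine setLIntegral_congr_fun measurableSet_Icc fun t ht => ?_
    rw [hG, indicator_of_mem (hQ.add_smul_sub_mem hy hx ht)]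
  have hmi : Measurable fun p : V × V => ∫⁻ t in Icc (0 : ℝ) 1, G (p.2 + t • (p.1 - p.2)) :=
    Measurable.lintegral_prod_right' hm3
  calc ∫⁻ x in Q, ∫⁻ y in Q, ‖f x - f y‖ₑ ^ 2 ∂μ ∂μ
      ≤ ∫⁻ x in Q, ∫⁻ y in Q, (ENNReal.ofReal (ρ ^ 2) *
          ∫⁻ t in Icc (0 : ℝ) 1, G (y + t • (x - y))) ∂μ ∂μ :=
        setLIntegral_mono' hQm fun x hx => setLIntegral_mono' hQm fun y hy => step x hx y hy
    _ = ENNReal.ofReal (ρ ^ 2) * ∫⁻ x in Q, ∫⁻ t in Icc (0 : ℝ) 1,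
          ∫⁻ y in Q, G (y + t • (x - y)) ∂μ ∂volume ∂μ := by
        rw [← lintegral_const_mul' _ _ ENNReal.ofReal_ne_top]
        refine lintegral_congr fun x => ?_
        rw [lintegral_const_mul' _ _ ENNReal.ofReal_ne_top, lintegral_lintegral_swap]
        exact (hm3.comp (by fun_prop : Measurable fun p : V × ℝ => ((x, p.1), p.2))).aemeasurable
    _ = ENNReal.ofReal (ρ ^ 2) * ∫⁻ t in Icc (0 : ℝ) 1, ∫⁻ x in Q,
          ∫⁻ y in Q, G (y + t • (x - y)) ∂μ ∂μ ∂volume := by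
        rw [lintegral_lintegral_swap]
        refine Measurable.aemeasurable ?_
        exact Measurable.lintegral_prod_right' (f := fun p : (V × ℝ) × V =>
          G (p.2 + p.1.2 • (p.1.1 - p.2))) (hGm.comp (by fun_prop))
    _ ≤ ENNReal.ofReal (ρ ^ 2) * ∫⁻ t in Icc (0 : ℝ) 1,
          2 ^ Module.finrank ℝ V * μ Q * ∫⁻ x, G x ∂μ := by
        gcongr with t
        exact lintegral_lintegral_segment_le μ hGm t
    _ = _ := by
        rw [setLIntegral_const, Real.volume_Icc, hG, lintegral_indicator hQm]
        simp only [sub_zero, ENNReal.ofReal_one, mul_one, mul_assoc]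

/-- The mean square of a function is controlled by its differences and its mean. -/
theorem measure_mul_lintegral_sq_le {α : Type*} [MeasurableSpace α] (ν : Measure α)
    [IsFiniteMeasure ν] {u : α → ℂ} (hu : Integrable u ν) :
    ν univ * ∫⁻ p, ‖u p‖ₑ ^ 2 ∂ν ≤
      2 * ∫⁻ p, ∫⁻ p', ‖u p - u p'‖ₑ ^ 2 ∂ν ∂ν + 2 * ‖∫ p, u p ∂ν‖ₑ ^ 2 := by
  rcases eq_or_ne (ν univ) 0 with h0 | h0
  · simp [h0]
  have hpt : ∀ p, ν univ ^ 2 * ‖u p‖ₑ ^ 2 ≤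
      2 * (ν univ * ∫⁻ p', ‖u p - u p'‖ₑ ^ 2 ∂ν) + 2 * ‖∫ p, u p ∂ν‖ₑ ^ 2 := by
    intro p
    have hd : Integrable (fun p' => u p - u p') ν := (integrable_const _).sub hu
    have h1 : (ν.real univ : ℂ) * u p = (∫ p', (u p - u p') ∂ν) + ∫ p', u p' ∂ν := by
      rw [integral_sub (integrable_const _) hu, integral_const]
      simp
    have h2 : ν univ * ‖u p‖ₑ ≤ (∫⁻ p', ‖u p - u p'‖ₑ ∂ν) + ‖∫ p', u p' ∂ν‖ₑ := by
      have h3 : ν univ * ‖u p‖ₑ = ‖(ν.real univ : ℂ) * u p‖ₑ := by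
        rw [enorm_mul]
        congr 1
        rw [← ofReal_norm, Complex.norm_real, Real.norm_of_nonneg measureReal_nonneg,
          ofReal_measureReal]
      rw [h3, h1]
      refine (enorm_add_le _ _).trans ?_
      gcongr
      exact enorm_integral_le_lintegral_enorm _
    calc ν univ ^ 2 * ‖u p‖ₑ ^ 2 = (ν univ * ‖u p‖ₑ) ^ 2 := by ring
      _ ≤ ((∫⁻ p', ‖u p - u p'‖ₑ ∂ν) + ‖∫ p', u p' ∂ν‖ₑ) ^ 2 := by gcongr
      _ ≤ 2 * (∫⁻ p', ‖u p - u p'‖ₑ ∂ν) ^ 2 + 2 * ‖∫ p', u p' ∂ν‖ₑ ^ 2 := by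
        have := ENNReal.rpow_add_le_mul_rpow_add_rpow (∫⁻ p', ‖u p - u p'‖ₑ ∂ν)
          ‖∫ p', u p' ∂ν‖ₑ (p := 2) (by norm_num)
        norm_num at this
        rwa [mul_add] at this
      _ ≤ _ := by
        gcongr
        exact sq_lintegral_le ν hd.aestronglyMeasurable.enorm
  have h := lintegral_mono (μ := ν) hpt
  rw [lintegral_const_mul' _ _ (ENNReal.pow_ne_top (measure_ne_top _ _)),
    lintegral_add_right _ measurable_const, lintegral_const_mul' _ _ (by norm_num),
    lintegral_const_mul' _ _ (measure_ne_top _ _), lintegral_const] at h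
  have h' : ν univ * (ν univ * ∫⁻ p, ‖u p‖ₑ ^ 2 ∂ν) ≤ ν univ *
      (2 * ∫⁻ p, ∫⁻ p', ‖u p - u p'‖ₑ ^ 2 ∂ν ∂ν + 2 * ‖∫ p, u p ∂ν‖ₑ ^ 2) := by
    refine le_trans (le_of_eq (by ring)) (h.trans (le_of_eq (by ring)))
  exact (ENNReal.mul_le_mul_iff_right h0 (measure_ne_top _ _)).1 h'

end Poincare

/-! ### The measure on the cylinder -/

section CellMeasure

variable {k m : ℕ} {H : Type*} [TopologicalSpace H]
  {I : ModelWithCorners ℝ (EuclideanSpace ℝ (Fin k)) H}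
  {M : Type*} [TopologicalSpace M] [ChartedSpace H M] [IsManifold I ∞ M]
  (g : Metric I M) (b : Module.Basis (Fin m) ℝ (EuclideanSpace ℝ (Fin m)))
  [MeasurableSpace M] [BorelSpace M]

theorem isFiniteMeasure_cellMeasure [CompactSpace M] (hI : IsBoundaryModel I) :
    IsFiniteMeasure (cellMeasure g b) := by
  have := isFiniteMeasure_riemannianVolume hI g
  have : IsFiniteMeasure (volume.restrict (ZSpan.fundamentalDomain b)) :=
    ⟨by rw [Measure.restrict_apply_univ]
        exact (ZSpan.fundamentalDomain_isBounded b).measure_lt_top⟩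
  exact inferInstanceAs (IsFiniteMeasure (Measure.prod _ _))

theorem cellMeasure_eq_restrict [CompactSpace M] (hI : IsBoundaryModel I) : cellMeasure g b =
    (cellMeasure g b).restrict (univ ×ˢ ZSpan.fundamentalDomain b) := by
  have := isFiniteMeasure_riemannianVolume hI g
  conv_lhs => rw [cellMeasure, ← Measure.restrict_univ (μ := riemannianVolume g)]
  conv_rhs => rw [cellMeasure, ← Measure.prod_restrict,
    Measure.restrict_restrict (ZSpan.fundamentalDomain_measurableSet b), inter_self]

theorem ae_mem_fundamentalDomain [CompactSpace M] (hI : IsBoundaryModel I) :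
    ∀ᵐ p ∂(cellMeasure g b), p.2 ∈ ZSpan.fundamentalDomain b := by
  rw [cellMeasure_eq_restrict g b hI]
  filter_upwards [ae_restrict_mem (MeasurableSet.univ.prod
    (ZSpan.fundamentalDomain_measurableSet b))] with p hp using hp.2

theorem exists_bound_of_continuous [CompactSpace M] {F : M × EuclideanSpace ℝ (Fin m) → ℂ}
    (hF : Continuous F) {s : Set (EuclideanSpace ℝ (Fin m))} (hs : Bornology.IsBounded s) :
    ∃ C : ℝ, ∀ p : M × EuclideanSpace ℝ (Fin m), p.2 ∈ s → ‖F p‖ ≤ C := by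
  have hc : IsCompact ((univ : Set M) ×ˢ closure s) := isCompact_univ.prod hs.isCompact_closure
  obtain ⟨C, hC⟩ := hc.exists_bound_of_continuousOn hF.continuousOn
  exact ⟨C, fun p hp => hC p ⟨mem_univ _, subset_closure hp⟩⟩

theorem memLp_of_continuous [CompactSpace M] (hI : IsBoundaryModel I)
    {F : M × EuclideanSpace ℝ (Fin m) → ℂ} (hF : Continuous F) (p : ℝ≥0∞) :
    MemLp F p (cellMeasure g b) := by
  have := isFiniteMeasure_cellMeasure g b hI
  obtain ⟨C, hC⟩ := exists_bound_of_continuous hF (ZSpan.fundamentalDomain_isBounded b)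
  have := secondCountableTopology I M
  refine MemLp.of_bound hF.aestronglyMeasurable C ?_
  filter_upwards [ae_mem_fundamentalDomain g b hI] with p hp using hC p hp

theorem integrable_of_continuous [CompactSpace M] (hI : IsBoundaryModel I)
    {F : M × EuclideanSpace ℝ (Fin m) → ℂ} (hF : Continuous F) :
    Integrable F (cellMeasure g b) :=
  memLp_one_iff_integrable.1 (memLp_of_continuous g b hI hF 1)

variable {x₀ : M} {K : Set (EuclideanSpace ℝ (Fin k))}

/-- The subset of `M × ℝᵐ` which corresponds to the set `Q` in the chart at `x₀`. -/
def chartSet (I : ModelWithCorners ℝ (EuclideanSpace ℝ (Fin k)) H) (x₀ : M)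
    (Q : Set (EuclideanSpace ℝ (Fin k) × EuclideanSpace ℝ (Fin m))) :
    Set (M × EuclideanSpace ℝ (Fin m)) :=
  ((extChartAt I x₀).source ×ˢ univ) ∩ (fun p => (extChartAt I x₀ p.1, p.2)) ⁻¹' Q

theorem measurableSet_chartSet
    [SecondCountableTopology M]
    {Q : Set (EuclideanSpace ℝ (Fin k) × EuclideanSpace ℝ (Fin m))} (hQ : MeasurableSet Q) :
    MeasurableSet (chartSet I x₀ Q) := by
  refine measurableSet_inter_preimage ?_
    ((isOpen_extChartAt_source x₀).measurableSet.prod MeasurableSet.univ) hQ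
  exact ((continuousOn_extChartAt x₀).comp continuousOn_fst fun p hp => hp.1).prodMk
    continuousOn_snd

theorem aemeasurable_prodMap_symm (hK : K ⊆ (extChartAt I x₀).target) :
    AEMeasurable (Prod.map (extChartAt I x₀).symm (id : EuclideanSpace ℝ (Fin m) → _))
      ((volume.restrict K).prod (volume.restrict (ZSpan.fundamentalDomain b))) := by
  refine AEMeasurable.prodMk ?_ measurable_snd.aemeasurable
  exact (aemeasurable_symm_restrict x₀ hK).comp_quasiMeasurePreserving
    Measure.quasiMeasurePreserving_fst

theorem map_prodMap_symm (hK : K ⊆ (extChartAt I x₀).target) (hKc : IsCompact K) :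
    ((volume.restrict K).prod (volume.restrict (ZSpan.fundamentalDomain b))).map
        (Prod.map (extChartAt I x₀).symm id) =
      ((volume.restrict K).map (extChartAt I x₀).symm).prod
        (volume.restrict (ZSpan.fundamentalDomain b)) := by
  have : IsFiniteMeasure (volume.restrict K) := ⟨by
    rw [Measure.restrict_apply_univ]; exact hKc.measure_lt_top⟩
  symm
  refine Measure.prod_eq fun s t hs ht => ?_
  rw [Measure.map_apply_of_aemeasurable (aemeasurable_prodMap_symm b hK) (hs.prod ht),
    Measure.map_apply_of_aemeasurable (aemeasurable_symm_restrict x₀ hK) hs,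
    ← Measure.prod_prod]
  rfl

/-- Integrals over a subset of the chart, with respect to the image of Lebesgue measure. -/
theorem lintegral_chartSet_map [SecondCountableTopology M]
    (hK : K ⊆ (extChartAt I x₀).target) (hKm : MeasurableSet K)
    {Q : Set (EuclideanSpace ℝ (Fin k) × EuclideanSpace ℝ (Fin m))} (hQ : MeasurableSet Q)
    (hQK : Q ⊆ K ×ˢ ZSpan.fundamentalDomain b)
    {F : M × EuclideanSpace ℝ (Fin m) → ℝ≥0∞} (hF : Measurable F) :
    ∫⁻ p in chartSet I x₀ Q, F p
        ∂((volume.restrict K).prod (volume.restrict (ZSpan.fundamentalDomain b))).map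
        (Prod.map (extChartAt I x₀).symm id) =
      ∫⁻ p in Q, F ((extChartAt I x₀).symm p.1, p.2) := by
  have hA := measurableSet_chartSet (I := I) (x₀ := x₀) hQ
  rw [← lintegral_indicator hA, lintegral_map' (hF.indicator hA).aemeasurable
    (aemeasurable_prodMap_symm b hK), Measure.prod_restrict, ← Measure.volume_eq_prod,
    ← lintegral_indicator hQ,
    ← lintegral_indicator (hKm.prod (ZSpan.fundamentalDomain_measurableSet b))]
  refine lintegral_congr fun p => ?_
  by_cases hp : p ∈ K ×ˢ ZSpan.fundamentalDomain b
  · rw [indicator_of_mem hp]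
    by_cases hq : p ∈ Q
    · rw [indicator_of_mem hq, indicator_of_mem]
      · rfl
      · refine ⟨⟨(extChartAt I x₀).map_target (hK hp.1), mem_univ _⟩, ?_⟩
        simpa only [mem_preimage, Prod.map, id, (extChartAt I x₀).right_inv (hK hp.1)] using hq
    · rw [indicator_of_notMem hq, indicator_of_notMem]
      rintro ⟨-, h⟩
      simp only [mem_preimage, Prod.map, id, (extChartAt I x₀).right_inv (hK hp.1)] at h
      exact hq h
  · rw [indicator_of_notMem hp, indicator_of_notMem fun h => hp (hQK h)]

theorem chartSet_subset (hK : K ⊆ (extChartAt I x₀).target)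
    {Q : Set (EuclideanSpace ℝ (Fin k) × EuclideanSpace ℝ (Fin m))}
    (hQK : Q ⊆ K ×ˢ ZSpan.fundamentalDomain b) :
    chartSet I x₀ Q ⊆ ((extChartAt I x₀).symm '' K) ×ˢ univ := by
  rintro p ⟨hp, hpQ⟩
  refine ⟨?_, mem_univ _⟩
  rw [symm_image_eq x₀ hK]
  exact ⟨hp.1, (hQK hpQ).1⟩

theorem cellMeasure_restrict_prod [SFinite (riemannianVolume g)] (S : Set M) :
    (cellMeasure g b).restrict (S ×ˢ univ) =
      ((riemannianVolume g).restrict S).prod (volume.restrict (ZSpan.fundamentalDomain b)) := by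
  rw [cellMeasure, ← Measure.prod_restrict, Measure.restrict_univ]

/-- On a compact set in a chart, the measure of the cylinder is at most a multiple of Lebesgue
measure. -/
theorem lintegral_chartSet_le [CompactSpace M] (hI : IsBoundaryModel I)
    (hK : K ⊆ (extChartAt I x₀).target) (hKc : IsCompact K) {C : ℝ}
    (hC : ∀ z ∈ K, volumeDensity g x₀ z ≤ C)
    {Q : Set (EuclideanSpace ℝ (Fin k) × EuclideanSpace ℝ (Fin m))} (hQ : MeasurableSet Q)
    (hQK : Q ⊆ K ×ˢ ZSpan.fundamentalDomain b)
    {F : M × EuclideanSpace ℝ (Fin m) → ℝ≥0∞} (hF : Measurable F) :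
    ∫⁻ p in chartSet I x₀ Q, F p ∂(cellMeasure g b) ≤
      ENNReal.ofReal C * ∫⁻ p in Q, F ((extChartAt I x₀).symm p.1, p.2) := by
  have := isFiniteMeasure_riemannianVolume hI g
  have := secondCountableTopology I M
  rw [← lintegral_chartSet_map b hK hKc.measurableSet hQ hQK hF, map_prodMap_symm b hK hKc,
    ← Measure.restrict_restrict_of_subset (chartSet_subset b hK hQK),
    cellMeasure_restrict_prod, ← smul_eq_mul, ← lintegral_smul_measure, ← Measure.restrict_smul,
    ← Measure.prod_smul_left]
  refine lintegral_mono' (Measure.restrict_mono le_rfl ?_) le_rfl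
  exact Measure.prod_mono (riemannianVolume_restrict_le g x₀ hK hKc.measurableSet hC) le_rfl

/-- On a compact set in a chart, Lebesgue measure is at most a multiple of the measure of the
cylinder. -/
theorem lintegral_le_chartSet [CompactSpace M] (hI : IsBoundaryModel I)
    (hK : K ⊆ (extChartAt I x₀).target) (hKc : IsCompact K) {C : ℝ} (hC0 : 0 ≤ C)
    (hC : ∀ z ∈ K, 1 ≤ C * volumeDensity g x₀ z)
    {Q : Set (EuclideanSpace ℝ (Fin k) × EuclideanSpace ℝ (Fin m))} (hQ : MeasurableSet Q)
    (hQK : Q ⊆ K ×ˢ ZSpan.fundamentalDomain b)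
    {F : M × EuclideanSpace ℝ (Fin m) → ℝ≥0∞} (hF : Measurable F) :
    ∫⁻ p in Q, F ((extChartAt I x₀).symm p.1, p.2) ≤
      ENNReal.ofReal C * ∫⁻ p in chartSet I x₀ Q, F p ∂(cellMeasure g b) := by
  have := isFiniteMeasure_riemannianVolume hI g
  have := secondCountableTopology I M
  rw [← lintegral_chartSet_map b hK hKc.measurableSet hQ hQK hF, map_prodMap_symm b hK hKc,
    ← Measure.restrict_restrict_of_subset (chartSet_subset b hK hQK) (μ := cellMeasure g b),
    cellMeasure_restrict_prod, ← smul_eq_mul, ← lintegral_smul_measure, ← Measure.restrict_smul,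
    ← Measure.prod_smul_left]
  refine lintegral_mono' (Measure.restrict_mono le_rfl ?_) le_rfl
  exact Measure.prod_mono (map_symm_le g x₀ hK hKc.measurableSet hC0 hC) le_rfl

end CellMeasure

/-! ### Rellich's inequality -/

section Rellich

variable {k m : ℕ}

/-- The coordinates of a point of `ℝᵏ × ℝᵐ`. -/
def coordFun (i : Fin k ⊕ Fin m) (p : EuclideanSpace ℝ (Fin k) × EuclideanSpace ℝ (Fin m)) : ℝ :=
  Sum.elim (fun i => p.1 i) (fun j => p.2 j) i

/-- The standard basis of `ℝᵏ × ℝᵐ`. -/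
noncomputable def coordBasis (i : Fin k ⊕ Fin m) :
    EuclideanSpace ℝ (Fin k) × EuclideanSpace ℝ (Fin m) :=
  Sum.elim (fun i => (EuclideanSpace.single i 1, 0)) (fun j => (0, EuclideanSpace.single j 1)) i

theorem isLinearMap_coordFun (i : Fin k ⊕ Fin m) :
    IsLinearMap ℝ (coordFun (k := k) (m := m) i) := by
  cases i <;> exact ⟨fun _ _ => rfl, fun _ _ => rfl⟩

theorem continuous_coordFun (i : Fin k ⊕ Fin m) : Continuous (coordFun (k := k) (m := m) i) := by
  cases i with
  | inl i =>
    exact (EuclideanSpace.proj i : EuclideanSpace ℝ (Fin _) →L[ℝ] ℝ).continuous.comp continuous_fst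
  | inr j =>
    exact (EuclideanSpace.proj j : EuclideanSpace ℝ (Fin _) →L[ℝ] ℝ).continuous.comp continuous_snd

theorem sum_coordFun_smul (p : EuclideanSpace ℝ (Fin k) × EuclideanSpace ℝ (Fin m)) :
    ∑ i, coordFun i p • coordBasis i = p := by
  have h : ∀ {n : ℕ} (v : EuclideanSpace ℝ (Fin n)),
      ∑ i, v i • EuclideanSpace.single i (1 : ℝ) = v := by
    intro n v
    have := (EuclideanSpace.basisFun (Fin n) ℝ).sum_repr v
    simpa using this
  rw [Fintype.sum_sum_type]
  ext1
  · simp [coordFun, coordBasis, Prod.fst_sum, h p.1]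
  · simp [coordFun, coordBasis, Prod.snd_sum, h p.2]

theorem norm_coordBasis (i : Fin k ⊕ Fin m) : ‖(coordBasis i : EuclideanSpace ℝ (Fin k) ×
    EuclideanSpace ℝ (Fin m))‖ = 1 := by
  cases i <;> simp [coordBasis, Prod.norm_def]

theorem abs_coordFun_le (i : Fin k ⊕ Fin m)
    (p : EuclideanSpace ℝ (Fin k) × EuclideanSpace ℝ (Fin m)) : |coordFun i p| ≤ ‖p‖ := by
  cases i with
  | inl i => exact (PiLp.norm_apply_le p.1 i).trans (norm_fst_le p)
  | inr i => exact (PiLp.norm_apply_le p.2 i).trans (norm_snd_le p)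

theorem norm_le_sum_coordFun (p : EuclideanSpace ℝ (Fin k) × EuclideanSpace ℝ (Fin m)) :
    ‖p‖ ≤ ∑ i, |coordFun i p| := by
  conv_lhs => rw [← sum_coordFun_smul p]
  refine (norm_sum_le _ _).trans (Finset.sum_le_sum fun i _ => ?_)
  rw [norm_smul, norm_coordBasis, mul_one, Real.norm_eq_abs]

theorem norm_sq_le_sum (L : EuclideanSpace ℝ (Fin k) × EuclideanSpace ℝ (Fin m) →L[ℝ] ℂ) :
    ‖L‖ ^ 2 ≤ ((k + m : ℕ) : ℝ) * ∑ i, ‖L (coordBasis i)‖ ^ 2 := by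
  have h1 : ‖L‖ ≤ ∑ i, ‖L (coordBasis i)‖ := by
    refine L.opNorm_le_bound (Finset.sum_nonneg fun _ _ => norm_nonneg _) fun p => ?_
    conv_lhs => rw [← sum_coordFun_smul p]
    rw [map_sum, Finset.sum_mul]
    refine (norm_sum_le _ _).trans (Finset.sum_le_sum fun i _ => ?_)
    rw [map_smul, norm_smul, mul_comm, Real.norm_eq_abs]
    exact mul_le_mul_of_nonneg_left (abs_coordFun_le i p) (norm_nonneg _)
  refine (pow_le_pow_left₀ (norm_nonneg _) h1 2).trans ?_
  have := sq_sum_le_card_mul_sum_sq (s := Finset.univ) (f := fun i => ‖L (coordBasis i)‖)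
  simpa using this

/-- The grid cell of mesh `δ` which contains a point. -/
noncomputable def gridIndex (δ : ℝ) (p : EuclideanSpace ℝ (Fin k) × EuclideanSpace ℝ (Fin m)) :
    Fin k ⊕ Fin m → ℤ :=
  fun i => ⌊coordFun i p / δ⌋

theorem measurable_gridIndex (δ : ℝ) : Measurable (gridIndex (k := k) (m := m) δ) :=
  measurable_pi_lambda _ fun i => Int.measurable_floor.comp
    ((continuous_coordFun i).measurable.div_const δ)

theorem convex_gridCell {δ : ℝ} (n : Fin k ⊕ Fin m → ℤ) :
    Convex ℝ (gridIndex (k := k) (m := m) δ ⁻¹' {n}) := by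
  have h : gridIndex (k := k) (m := m) δ ⁻¹' {n} =
      ⋂ i, (fun p => coordFun i p / δ) ⁻¹' Ico (n i : ℝ) (n i + 1) := by
    ext p
    simp only [mem_preimage, mem_singleton_iff, mem_iInter, mem_Ico, ← Int.floor_eq_iff]
    exact ⟨fun h i => congrFun h i, fun h => funext h⟩
  rw [h]
  refine convex_iInter fun i => ?_
  have hl : IsLinearMap ℝ fun p : EuclideanSpace ℝ (Fin k) × EuclideanSpace ℝ (Fin m) =>
      coordFun i p / δ :=
    ⟨fun x y => by rw [(isLinearMap_coordFun i).map_add, add_div],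
      fun c x => by rw [(isLinearMap_coordFun i).map_smul, smul_eq_mul, smul_eq_mul, mul_div_assoc]⟩
  exact (convex_Ico _ _).is_linear_preimage hl

theorem norm_sub_le_of_gridIndex_eq {δ : ℝ} (hδ : 0 < δ)
    {p p' : EuclideanSpace ℝ (Fin k) × EuclideanSpace ℝ (Fin m)}
    (h : gridIndex δ p = gridIndex δ p') : ‖p - p'‖ ≤ ((k + m : ℕ) : ℝ) * δ := by
  refine (norm_le_sum_coordFun _).trans ?_
  have : ∀ i, |coordFun i (p - p')| ≤ δ := fun i => by
    have h1 := Int.abs_sub_lt_one_of_floor_eq_floor (congrFun h i)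
    have h2 : coordFun i (p - p') = coordFun i p - coordFun i p' :=
      (isLinearMap_coordFun i).map_sub _ _
    rw [h2]
    have h3 : |coordFun i p - coordFun i p'| / δ < 1 := by
      rwa [← sub_div, abs_div, abs_of_pos hδ] at h1
    rw [div_lt_one hδ] at h3
    exact h3.le
  refine (Finset.sum_le_sum fun i _ => this i).trans ?_
  simp

theorem finite_gridIndex_image {δ : ℝ} (hδ : 0 < δ)
    {S : Set (EuclideanSpace ℝ (Fin k) × EuclideanSpace ℝ (Fin m))} (hS : Bornology.IsBounded S) :
    (gridIndex δ '' S).Finite := by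
  obtain ⟨R, hR⟩ := hS.exists_norm_le
  refine (Set.finite_Icc (fun _ => ⌊-(R / δ)⌋) (fun _ => ⌊R / δ⌋)).subset ?_
  rintro _ ⟨p, hp, rfl⟩
  have h : ∀ i, -(R / δ) ≤ coordFun i p / δ ∧ coordFun i p / δ ≤ R / δ := fun i => by
    have := abs_le.1 ((abs_coordFun_le i p).trans (hR p hp))
    refine ⟨?_, by gcongr; exact this.2⟩
    rw [← neg_div]; gcongr; exact this.1
  exact ⟨fun i => Int.floor_mono (h i).1, fun i => Int.floor_mono (h i).2⟩

variable {H : Type*} [TopologicalSpace H]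
  {I : ModelWithCorners ℝ (EuclideanSpace ℝ (Fin k)) H}
  {M : Type*} [TopologicalSpace M] [ChartedSpace H M] [IsManifold I ∞ M]
  (g : Metric I M) (b : Module.Basis (Fin m) ℝ (EuclideanSpace ℝ (Fin m)))

/-- The square of the length of the gradient, `|∇_x u|² + |∇_y u|²`. -/
noncomputable def gradSq (u : M × EuclideanSpace ℝ (Fin m) → ℂ)
    (p : M × EuclideanSpace ℝ (Fin m)) : ℝ :=
  (covectorInner g p.1 (diffX I u p) (diffX I u p)).re + ∑ j, ‖diffY u j p‖ ^ 2

theorem gradSq_nonneg (u : M × EuclideanSpace ℝ (Fin m) → ℂ) (p : M × EuclideanSpace ℝ (Fin m)) :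
    0 ≤ gradSq g u p :=
  add_nonneg (covectorInner_self_nonneg g _ _) (Finset.sum_nonneg fun _ _ => sq_nonneg _)

theorem continuous_gradSq {u : M × EuclideanSpace ℝ (Fin m) → ℂ}
    (hu : ContMDiff (I.prod 𝓘(ℝ, EuclideanSpace ℝ (Fin m))) 𝓘(ℝ, ℂ) ∞ u) :
    Continuous (gradSq g u) :=
  (Complex.continuous_re.comp (continuous_covectorInner_diffX g hu hu)).add
    (continuous_finsetSum _ fun j _ => (continuous_diffY hu j).norm.pow 2)

/-- On a compact set in a chart, the Euclidean length of the differential is controlled by its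
Riemannian length. -/
theorem exists_localDiff_bound {x₀ : M} {K : Set (EuclideanSpace ℝ (Fin k))}
    (hK : K ⊆ (extChartAt I x₀).target) (hKc : IsCompact K) :
    ∃ C : ℝ, 0 ≤ C ∧ ∀ u : M × EuclideanSpace ℝ (Fin m) → ℂ,
      ContMDiff (I.prod 𝓘(ℝ, EuclideanSpace ℝ (Fin m))) 𝓘(ℝ, ℂ) ∞ u →
      ∀ z ∈ K, ∀ y, ‖localDiff I x₀ u (z, y)‖ ^ 2 ≤
        C * gradSq g u ((extChartAt I x₀).symm z, y) := by
  have hb : ∀ i : Fin k, ∃ C : ℝ, ∀ z ∈ K,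
      ‖g.inner ((extChartAt I x₀).symm z) (coordVec x₀ z i) (coordVec x₀ z i)‖ ≤ C := fun i =>
    hKc.exists_bound_of_continuousOn
      ((continuous_apply_apply i i).comp_continuousOn ((continuousOn_gram_coordVec g x₀).mono hK))
  choose G hG using hb
  refine ⟨((k + m : ℕ) : ℝ) * (1 + ∑ i, |G i|), by positivity, fun u hu z hz y => ?_⟩
  refine (norm_sq_le_sum _).trans ?_
  rw [mul_assoc]
  refine mul_le_mul_of_nonneg_left ?_ (by positivity)
  rw [Fintype.sum_sum_type]
  set p : M × EuclideanSpace ℝ (Fin m) := ((extChartAt I x₀).symm z, y) with hp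
  have hcov : 0 ≤ (covectorInner g p.1 (diffX I u p) (diffX I u p)).re :=
    covectorInner_self_nonneg g _ _
  have hY : 0 ≤ ∑ j, ‖diffY u j p‖ ^ 2 := Finset.sum_nonneg fun _ _ => sq_nonneg _
  have h1 : ∀ i : Fin k, ‖localDiff I x₀ u (z, y) (coordBasis (Sum.inl i))‖ ^ 2 ≤
      |G i| * (covectorInner g p.1 (diffX I u p) (diffX I u p)).re := fun i => by
    have := norm_sq_apply_le g p.1 (diffX I u p) (coordVec x₀ z i)
    rw [diffX_coordVec x₀ hu (hK hz)] at this
    refine this.trans (mul_le_mul_of_nonneg_right ?_ hcov)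
    exact (le_abs_self _).trans ((hG i z hz).trans (le_abs_self _))
  have h2 : ∀ j : Fin m, localDiff I x₀ u (z, y) (coordBasis (Sum.inr j)) = diffY u j p :=
    fun j => (diffY_localDiff x₀ hu (hK hz) y j).symm
  simp only [h2]
  have h3 := Finset.sum_le_sum fun (i : Fin k) (_ : i ∈ Finset.univ) => h1 i
  rw [← Finset.sum_mul] at h3
  have h4 : 0 ≤ ∑ i, |G i| := Finset.sum_nonneg fun _ _ => abs_nonneg _
  rw [gradSq]
  nlinarith [mul_nonneg h4 hY]

variable [MeasurableSpace M] [BorelSpace M] [CompactSpace M]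

/-- The Poincaré inequality on a small convex piece `Q` of a coordinate patch. The constant `D` does
not depend on `Q`, and is multiplied by the square of the diameter of `Q`. -/
theorem exists_piece_bound (hI : IsBoundaryModel I) {x₀ : M} {K : Set (EuclideanSpace ℝ (Fin k))}
    (hK : K ⊆ (extChartAt I x₀).target) (hKc : IsCompact K) :
    ∃ D : ℝ, 0 ≤ D ∧ ∀ (ρ : ℝ) (Q : Set (EuclideanSpace ℝ (Fin k) × EuclideanSpace ℝ (Fin m))),
      Convex ℝ Q → MeasurableSet Q → Q ⊆ K ×ˢ ZSpan.fundamentalDomain b →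
      (∀ x ∈ Q, ∀ y ∈ Q, ‖x - y‖ ≤ ρ) →
      ∃ C : ℝ, 0 ≤ C ∧ ∀ u : M × EuclideanSpace ℝ (Fin m) → ℂ,
      ContMDiff (I.prod 𝓘(ℝ, EuclideanSpace ℝ (Fin m))) 𝓘(ℝ, ℂ) ∞ u →
      ∫⁻ p in chartSet I x₀ Q, ‖u p‖ₑ ^ 2 ∂(cellMeasure g b) ≤
        ENNReal.ofReal (D * ρ ^ 2) *
          ∫⁻ p in chartSet I x₀ Q, ENNReal.ofReal (gradSq g u p) ∂(cellMeasure g b) +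
        ENNReal.ofReal C * ‖∫ p in chartSet I x₀ Q, u p ∂(cellMeasure g b)‖ₑ ^ 2 := by
  have := isFiniteMeasure_cellMeasure g b hI
  have := secondCountableTopology I M
  obtain ⟨C₁, hC₁0, hC₁⟩ := exists_volumeDensity_bounds g x₀ hKc hK
  obtain ⟨C₂, hC₂0, hC₂⟩ := exists_localDiff_bound (m := m) g hK hKc
  set d := Module.finrank ℝ (EuclideanSpace ℝ (Fin k) × EuclideanSpace ℝ (Fin m))
  -- two factors `C₁` pass from mean square differences on `M` to the chart, one compares the
  -- volumes of `Q`, and one brings the Dirichlet integral back to `M`; `C₂` compares the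
  -- differentials
  refine ⟨2 * C₁ ^ 4 * 2 ^ d * C₂, by positivity, fun ρ Q hQ hQm hQK hρ => ?_⟩
  set A := chartSet I x₀ Q with hA
  set ν := (cellMeasure g b).restrict A with hν
  have hνu : ν univ = cellMeasure g b A := Measure.restrict_apply_univ _
  -- the inequality will be divided by the volume of the piece
  rcases eq_or_ne (ν univ) 0 with h0 | h0
  · refine ⟨0, le_rfl, fun u _ => ?_⟩
    rw [Measure.measure_univ_eq_zero] at h0
    rw [h0]; simp
  refine ⟨2 / (ν univ).toReal, by positivity, fun u hu => ?_⟩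
  have hle1 : ∀ F : M × EuclideanSpace ℝ (Fin m) → ℝ≥0∞, Measurable F → ∫⁻ p, F p ∂ν ≤
      ENNReal.ofReal C₁ * ∫⁻ p in Q, F ((extChartAt I x₀).symm p.1, p.2) := fun F hF =>
    lintegral_chartSet_le g b hI hK hKc (fun z hz => (hC₁ z hz).1) hQm hQK hF
  have hle2 : ∀ F : M × EuclideanSpace ℝ (Fin m) → ℝ≥0∞, Measurable F →
      ∫⁻ p in Q, F ((extChartAt I x₀).symm p.1, p.2) ≤ ENNReal.ofReal C₁ * ∫⁻ p, F p ∂ν :=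
    fun F hF => lintegral_le_chartSet g b hI hK hKc hC₁0.le (fun z hz => (hC₁ z hz).2) hQm hQK hF
  have huc : Continuous u := hu.continuous
  have hint : Integrable u ν := (integrable_of_continuous g b hI huc).restrict
  have h1 := measure_mul_lintegral_sq_le ν hint
  have hQs : Q ⊆ (extChartAt I x₀).target ×ˢ univ := fun p hp => ⟨hK (hQK hp).1, mem_univ _⟩
  have h2 : ∫⁻ p, ∫⁻ p', ‖u p - u p'‖ₑ ^ 2 ∂ν ∂ν ≤ ENNReal.ofReal C₁ ^ 2 *
      ∫⁻ p in Q, ∫⁻ p' in Q, ‖localRep I x₀ u p - localRep I x₀ u p'‖ₑ ^ 2 := by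
    have hm : Measurable fun p : (M × EuclideanSpace ℝ (Fin m)) × (M × EuclideanSpace ℝ (Fin m)) =>
        ‖u p.1 - u p.2‖ₑ ^ 2 :=
      ((huc.comp continuous_fst).sub (huc.comp continuous_snd)).enorm.measurable.pow_const 2
    calc ∫⁻ p, ∫⁻ p', ‖u p - u p'‖ₑ ^ 2 ∂ν ∂ν
        ≤ ∫⁻ p, (ENNReal.ofReal C₁ * ∫⁻ p' in Q, ‖u p - localRep I x₀ u p'‖ₑ ^ 2) ∂ν :=
          lintegral_mono fun p => hle1 _ (hm.comp measurable_prodMk_left)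
      _ = ENNReal.ofReal C₁ * ∫⁻ p' in Q, ∫⁻ p, ‖u p - localRep I x₀ u p'‖ₑ ^ 2 ∂ν := by
          rw [lintegral_const_mul' _ _ ENNReal.ofReal_ne_top, lintegral_lintegral_swap]
          have hc : AEMeasurable (localRep I x₀ u) (volume.restrict Q) :=
            ((contDiffOn_localRep x₀ hu).continuousOn.mono hQs).aemeasurable hQm
          have hc' := hc.comp_quasiMeasurePreserving
            (Measure.quasiMeasurePreserving_snd (μ := ν) (ν := volume.restrict Q))
          have hu' : AEMeasurable (fun q : (M × EuclideanSpace ℝ (Fin m)) ×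
              (EuclideanSpace ℝ (Fin k) × EuclideanSpace ℝ (Fin m)) => u q.1)
              (ν.prod (volume.restrict Q)) := (huc.measurable.comp measurable_fst).aemeasurable
          exact (hu'.sub hc').enorm.pow_const 2
      _ ≤ ENNReal.ofReal C₁ * ∫⁻ p' in Q, (ENNReal.ofReal C₁ *
            ∫⁻ p in Q, ‖localRep I x₀ u p - localRep I x₀ u p'‖ₑ ^ 2) := by
          gcongr with p'
          exact hle1 (fun p => ‖u p - localRep I x₀ u p'‖ₑ ^ 2)
            ((huc.sub continuous_const).enorm.measurable.pow_const 2)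
      _ = _ := by
          rw [lintegral_const_mul' _ _ ENNReal.ofReal_ne_top, ← mul_assoc, ← sq]
          congr 1
          exact lintegral_congr fun p => lintegral_congr fun p' => by rw [enorm_sub_rev]
  have : (volume :
      Measure (EuclideanSpace ℝ (Fin k) × EuclideanSpace ℝ (Fin m))).IsAddHaarMeasure := by
    rw [Measure.volume_eq_prod]; infer_instance
  have h3 := poincare_convex volume hQ hQm
    (fun p hp => (hasFDerivWithinAt_localRep x₀ hu (hQs hp).1).mono hQs)
    ((continuousOn_localDiff x₀ hu).mono hQs) hρ
  have h4 : volume Q ≤ ENNReal.ofReal C₁ * ν univ := by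
    simpa using hle2 (fun _ => 1) measurable_const
  have h5 : ∫⁻ p in Q, ‖localDiff I x₀ u p‖ₑ ^ 2 ≤ ENNReal.ofReal C₂ * (ENNReal.ofReal C₁ *
      ∫⁻ p, ENNReal.ofReal (gradSq g u p) ∂ν) := by
    calc ∫⁻ p in Q, ‖localDiff I x₀ u p‖ₑ ^ 2
        ≤ ∫⁻ p in Q, (ENNReal.ofReal C₂ *
            ENNReal.ofReal (gradSq g u ((extChartAt I x₀).symm p.1, p.2))) := by
          refine setLIntegral_mono' hQm fun p hp => ?_
          rw [← ofReal_norm, ← ENNReal.ofReal_pow (norm_nonneg _), ← ENNReal.ofReal_mul hC₂0]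
          exact ENNReal.ofReal_le_ofReal (hC₂ u hu p.1 (hQK hp).1 p.2)
      _ ≤ _ := by
          rw [lintegral_const_mul' _ _ ENNReal.ofReal_ne_top]
          gcongr
          exact hle2 _ (ENNReal.measurable_ofReal.comp (continuous_gradSq g hu).measurable)
  have h6 : ν univ * ∫⁻ p, ‖u p‖ₑ ^ 2 ∂ν ≤ ν univ * (ENNReal.ofReal
      (2 * C₁ ^ 4 * 2 ^ d * C₂ * ρ ^ 2) * ∫⁻ p, ENNReal.ofReal (gradSq g u p) ∂ν +
      ENNReal.ofReal (2 / (ν univ).toReal) * ‖∫ p, u p ∂ν‖ₑ ^ 2) := by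
    have hinv : ν univ * ENNReal.ofReal (2 / (ν univ).toReal) = 2 := by
      have hpos : 0 < (ν univ).toReal := ENNReal.toReal_pos h0 (measure_ne_top _ _)
      calc ν univ * ENNReal.ofReal (2 / (ν univ).toReal)
          = ENNReal.ofReal (ν univ).toReal * ENNReal.ofReal (2 / (ν univ).toReal) := by
            rw [ENNReal.ofReal_toReal (measure_ne_top ν univ)]
        _ = 2 := by
            rw [← ENNReal.ofReal_mul ENNReal.toReal_nonneg, mul_div_cancel₀ _ hpos.ne']
            simp
    rw [mul_add, ← mul_assoc (ν univ) (ENNReal.ofReal (2 / _)), hinv]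
    refine h1.trans (add_le_add ?_ le_rfl)
    calc 2 * ∫⁻ p, ∫⁻ p', ‖u p - u p'‖ₑ ^ 2 ∂ν ∂ν
        ≤ 2 * (ENNReal.ofReal C₁ ^ 2 * (ENNReal.ofReal (ρ ^ 2) * 2 ^ d *
          (ENNReal.ofReal C₁ * ν univ) * (ENNReal.ofReal C₂ * (ENNReal.ofReal C₁ *
            ∫⁻ p, ENNReal.ofReal (gradSq g u p) ∂ν)))) := by
          gcongr 2 * ?_
          exact h2.trans (mul_le_mul_right (h3.trans (mul_le_mul' (mul_le_mul_right h4 _) h5)) _)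
      _ = ν univ * (ENNReal.ofReal (2 * C₁ ^ 4 * 2 ^ d * C₂ * ρ ^ 2) *
            ∫⁻ p, ENNReal.ofReal (gradSq g u p) ∂ν) := by
          rw [ENNReal.ofReal_mul (by positivity), ENNReal.ofReal_mul (by positivity),
            ENNReal.ofReal_mul (by positivity), ENNReal.ofReal_mul (by positivity),
            ENNReal.ofReal_pow hC₁0.le, ENNReal.ofReal_pow (p := 2) (by norm_num),
            ENNReal.ofReal_ofNat]
          ring
  exact (ENNReal.mul_le_mul_iff_right h0 (measure_ne_top _ _)).1 h6

end Rellich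

section Rellich

variable {k m : ℕ} {H : Type*} [TopologicalSpace H]
  {I : ModelWithCorners ℝ (EuclideanSpace ℝ (Fin k)) H}
  {M : Type*} [TopologicalSpace M] [ChartedSpace H M] [IsManifold I ∞ M]
  (g : Metric I M) (b : Module.Basis (Fin m) ℝ (EuclideanSpace ℝ (Fin m)))
  [MeasurableSpace M] [BorelSpace M] [CompactSpace M]

theorem setLIntegral_finset_biUnion_le {α β : Type*} [MeasurableSpace α] (μ : Measure α)
    (t : Finset β) (s : β → Set α) (f : α → ℝ≥0∞) :
    ∫⁻ a in ⋃ i ∈ t, s i, f a ∂μ ≤ ∑ i ∈ t, ∫⁻ a in s i, f a ∂μ := by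
  classical
  induction t using Finset.induction_on with
  | empty => simp
  | insert i t hi ih =>
    rw [Finset.set_biUnion_insert, Finset.sum_insert hi]
    exact (lintegral_union_le _ _ _).trans (add_le_add le_rfl ih)

theorem convex_fundamentalDomain : Convex ℝ (ZSpan.fundamentalDomain b) := by
  have h : ZSpan.fundamentalDomain b = ⋂ i, (fun y => b.repr y i) ⁻¹' Ico (0 : ℝ) 1 := by
    ext y; simp [ZSpan.mem_fundamentalDomain]
  rw [h]
  exact convex_iInter fun i => (convex_Ico _ _).is_linear_preimage
    ⟨fun x y => by simp, fun c x => by simp⟩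

/-- Rellich's inequality on a coordinate patch: the sets `A` are the pieces of the patch which
correspond to the cells of a fine grid in the chart. -/
theorem exists_patch_bound (hI : IsBoundaryModel I) {x₀ : M} {K : Set (EuclideanSpace ℝ (Fin k))}
    (hK : K ⊆ (extChartAt I x₀).target) (hKc : IsCompact K) (hKv : Convex ℝ K) {ε : ℝ}
    (hε : 0 < ε) :
    ∃ (s : Finset (Set (M × EuclideanSpace ℝ (Fin m)))) (C : ℝ), 0 ≤ C ∧
      (∀ A ∈ s, MeasurableSet A) ∧ ∀ u : M × EuclideanSpace ℝ (Fin m) → ℂ,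
      ContMDiff (I.prod 𝓘(ℝ, EuclideanSpace ℝ (Fin m))) 𝓘(ℝ, ℂ) ∞ u →
      ∫⁻ p in chartSet I x₀ (K ×ˢ ZSpan.fundamentalDomain b), ‖u p‖ₑ ^ 2 ∂(cellMeasure g b) ≤
        ENNReal.ofReal ε * ∫⁻ p, ENNReal.ofReal (gradSq g u p) ∂(cellMeasure g b) +
        ENNReal.ofReal C * ∑ A ∈ s, ‖∫ p in A, u p ∂(cellMeasure g b)‖ₑ ^ 2 := by
  classical
  have := secondCountableTopology I M
  obtain ⟨D, hD0, hD⟩ := exists_piece_bound g b hI hK hKc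
  -- a mesh for which the pieces have diameter at most `ρ`, where `D ρ² ≤ ε`
  set ρ := min 1 (ε / (D + 1)) with hρdef
  have hρ : 0 < ρ := by positivity
  set δ := ρ / (((k + m : ℕ) : ℝ) + 1) with hδdef
  have hδ : 0 < δ := by positivity
  set S := K ×ˢ ZSpan.fundamentalDomain b with hS
  have hSm : MeasurableSet S := hKc.measurableSet.prod (ZSpan.fundamentalDomain_measurableSet b)
  have hDρ : D * ρ ^ 2 ≤ ε := by
    have h1 : ρ ≤ 1 := min_le_left _ _
    have h2 : ρ * (D + 1) ≤ ε := (le_div_iff₀ (by positivity)).1 (min_le_right _ _)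
    nlinarith [mul_nonneg hD0 hρ.le]
  set N := (finite_gridIndex_image hδ
    (hKc.isBounded.prod (ZSpan.fundamentalDomain_isBounded b))).toFinset with hN
  set Q : (Fin k ⊕ Fin m → ℤ) → Set (EuclideanSpace ℝ (Fin k) × EuclideanSpace ℝ (Fin m)) :=
    fun n => gridIndex δ ⁻¹' {n} ∩ S with hQ
  have hQm : ∀ n, MeasurableSet (Q n) := fun n =>
    (measurable_gridIndex δ (measurableSet_singleton n)).inter hSm
  choose C hC0 hC using fun n => hD ρ (Q n)
    ((convex_gridCell n).inter (hKv.prod (convex_fundamentalDomain b))) (hQm n) inter_subset_right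
    (fun x hx y hy => by
      refine (norm_sub_le_of_gridIndex_eq hδ (hx.1.trans hy.1.symm)).trans ?_
      rw [hδdef, mul_div_assoc', div_le_iff₀ (by positivity)]
      nlinarith)
  have hcover : chartSet I x₀ S ⊆ ⋃ n ∈ N, chartSet I x₀ (Q n) := by
    rintro p ⟨hp, hpS⟩
    refine mem_iUnion₂.2 ⟨gridIndex δ (extChartAt I x₀ p.1, p.2), ?_, hp, rfl, hpS⟩
    rw [hN, Set.Finite.mem_toFinset]
    exact ⟨_, hpS, rfl⟩
  have hdisj : Set.PairwiseDisjoint (N : Set (Fin k ⊕ Fin m → ℤ)) fun n => chartSet I x₀ (Q n) := by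
    intro n _ n' _ hne
    refine Set.disjoint_left.2 fun p hp hp' => hne ?_
    exact (show _ = n from hp.2.1).symm.trans hp'.2.1
  refine ⟨N.image fun n => chartSet I x₀ (Q n), ∑ n ∈ N, C n,
    Finset.sum_nonneg fun n _ => hC0 n, ?_, fun u hu => ?_⟩
  · intro A hA
    obtain ⟨n, -, rfl⟩ := Finset.mem_image.1 hA
    exact measurableSet_chartSet (hQm n)
  set s := N.image fun n => chartSet I x₀ (Q n) with hs
  have hterm : ∀ n ∈ N, ENNReal.ofReal (C n) *
      ‖∫ p in chartSet I x₀ (Q n), u p ∂(cellMeasure g b)‖ₑ ^ 2 ≤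
      ENNReal.ofReal (C n) * ∑ A ∈ s, ‖∫ p in A, u p ∂(cellMeasure g b)‖ₑ ^ 2 := fun n hn => by
    gcongr
    exact Finset.single_le_sum (f := fun A => ‖∫ p in A, u p ∂(cellMeasure g b)‖ₑ ^ 2)
      (fun _ _ => zero_le) (Finset.mem_image_of_mem _ hn)
  calc ∫⁻ p in chartSet I x₀ S, ‖u p‖ₑ ^ 2 ∂(cellMeasure g b)
      ≤ ∫⁻ p in ⋃ n ∈ N, chartSet I x₀ (Q n), ‖u p‖ₑ ^ 2 ∂(cellMeasure g b) :=
        lintegral_mono_set hcover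
    _ ≤ ∑ n ∈ N, ∫⁻ p in chartSet I x₀ (Q n), ‖u p‖ₑ ^ 2 ∂(cellMeasure g b) :=
        setLIntegral_finset_biUnion_le _ _ _ _
    _ ≤ ∑ n ∈ N, (ENNReal.ofReal (D * ρ ^ 2) * ∫⁻ p in chartSet I x₀ (Q n),
          ENNReal.ofReal (gradSq g u p) ∂(cellMeasure g b) +
          ENNReal.ofReal (C n) * ∑ A ∈ s, ‖∫ p in A, u p ∂(cellMeasure g b)‖ₑ ^ 2) :=
        Finset.sum_le_sum fun n hn => (hC n u hu).trans (add_le_add le_rfl (hterm n hn))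
    _ ≤ _ := by
        rw [Finset.sum_add_distrib, ← Finset.mul_sum, ← Finset.sum_mul,
          ← ENNReal.ofReal_sum_of_nonneg fun n _ => hC0 n,
          ← lintegral_biUnion_finset hdisj fun n _ => measurableSet_chartSet (hQm n)]
        gcongr
        exact Measure.restrict_le_self

/-- **Rellich's theorem** as an inequality: up to finitely many mean values, the `L₂` norm of a
smooth function is a small multiple of its Dirichlet integral. -/
theorem rellich (hI : IsBoundaryModel I) {ε : ℝ} (hε : 0 < ε) :
    ∃ (s : Finset (Set (M × EuclideanSpace ℝ (Fin m)))) (C : ℝ), 0 ≤ C ∧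
      (∀ A ∈ s, MeasurableSet A) ∧ ∀ u : M × EuclideanSpace ℝ (Fin m) → ℂ,
      ContMDiff (I.prod 𝓘(ℝ, EuclideanSpace ℝ (Fin m))) 𝓘(ℝ, ℂ) ∞ u →
      ∫⁻ p, ‖u p‖ₑ ^ 2 ∂(cellMeasure g b) ≤
        ENNReal.ofReal ε * ∫⁻ p, ENNReal.ofReal (gradSq g u p) ∂(cellMeasure g b) +
        ENNReal.ofReal C * ∑ A ∈ s, ‖∫ p in A, u p ∂(cellMeasure g b)‖ₑ ^ 2 := by
  classical
  choose K hKc hKv hK hKn using fun x : M => exists_patch hI x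
  obtain ⟨t, -, ht⟩ := isCompact_univ.elim_nhds_subcover _ fun x _ => hKn x
  have hcover : (univ ×ˢ ZSpan.fundamentalDomain b : Set (M × EuclideanSpace ℝ (Fin m))) ⊆
      ⋃ x ∈ t, chartSet I x (K x ×ˢ ZSpan.fundamentalDomain b) := by
    intro p hp
    obtain ⟨x, hx, hpx⟩ := mem_iUnion₂.1 (ht (mem_univ p.1))
    rw [symm_image_eq x (hK x)] at hpx
    exact mem_iUnion₂.2 ⟨x, hx, ⟨hpx.1, mem_univ _⟩, hpx.2, hp.2⟩
  -- each of the patches contributes its own multiple of the Dirichlet integral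
  set δ := ε / (t.card + 1) with hδdef
  have hδ : 0 < δ := by positivity
  choose s C hC0 hsm hC using fun x : M => exists_patch_bound g b hI (hK x) (hKc x) (hKv x) hδ
  refine ⟨t.biUnion s, ∑ x ∈ t, C x, Finset.sum_nonneg fun n _ => hC0 n, ?_, fun u hu => ?_⟩
  · intro A hA
    obtain ⟨x, -, hA⟩ := Finset.mem_biUnion.1 hA
    exact hsm x A hA
  calc ∫⁻ p, ‖u p‖ₑ ^ 2 ∂(cellMeasure g b)
      = ∫⁻ p in univ ×ˢ ZSpan.fundamentalDomain b, ‖u p‖ₑ ^ 2 ∂(cellMeasure g b) := by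
        conv_lhs => rw [cellMeasure_eq_restrict g b hI]
    _ ≤ ∑ x ∈ t, ∫⁻ p in chartSet I x (K x ×ˢ ZSpan.fundamentalDomain b), ‖u p‖ₑ ^ 2
          ∂(cellMeasure g b) :=
        (lintegral_mono_set hcover).trans (setLIntegral_finset_biUnion_le _ _ _ _)
    _ ≤ ∑ x ∈ t, (ENNReal.ofReal δ * ∫⁻ p, ENNReal.ofReal (gradSq g u p) ∂(cellMeasure g b) +
          ENNReal.ofReal (C x) * ∑ A ∈ t.biUnion s, ‖∫ p in A, u p ∂(cellMeasure g b)‖ₑ ^ 2) := by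
        refine Finset.sum_le_sum fun x hx => (hC x u hu).trans (add_le_add le_rfl ?_)
        gcongr
        exact Finset.subset_biUnion_of_mem s hx
    _ ≤ _ := by
        rw [Finset.sum_add_distrib, ← Finset.sum_mul, ← Finset.sum_mul,
          ← ENNReal.ofReal_sum_of_nonneg fun n _ => hC0 n,
          ← ENNReal.ofReal_sum_of_nonneg fun n _ => hδ.le]
        gcongr
        rw [Finset.sum_const, nsmul_eq_mul, hδdef, mul_div_assoc', div_le_iff₀ (by positivity)]
        nlinarith

end Rellich

/-! ### The form on smooth functions -/

section Form

variable {k m : ℕ} {H : Type*} [TopologicalSpace H]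
  {I : ModelWithCorners ℝ (EuclideanSpace ℝ (Fin k)) H}
  {M : Type*} [TopologicalSpace M] [ChartedSpace H M] [IsManifold I ∞ M]
  (g : Metric I M) (b : Module.Basis (Fin m) ℝ (EuclideanSpace ℝ (Fin m)))

variable {u v w : M × EuclideanSpace ℝ (Fin m) → ℂ}

theorem mdifferentiableAt_fst
    (hu : ContMDiff (I.prod 𝓘(ℝ, EuclideanSpace ℝ (Fin m))) 𝓘(ℝ, ℂ) ∞ u)
    (p : M × EuclideanSpace ℝ (Fin m)) : MDifferentiableAt I 𝓘(ℝ, ℂ) (fun x => u (x, p.2)) p.1 := by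
  have : ContMDiff I 𝓘(ℝ, ℂ) ∞ (fun x => u (x, p.2)) :=
    hu.comp (contMDiff_id.prodMk contMDiff_const)
  exact this.mdifferentiable (by simp) _

theorem contDiff_snd (hu : ContMDiff (I.prod 𝓘(ℝ, EuclideanSpace ℝ (Fin m))) 𝓘(ℝ, ℂ) ∞ u)
    (x : M) : ContDiff ℝ ∞ (fun y => u (x, y)) := by
  have : ContMDiff 𝓘(ℝ, EuclideanSpace ℝ (Fin m)) 𝓘(ℝ, ℂ) ∞ (fun y => u (x, y)) :=
    hu.comp (contMDiff_const.prodMk contMDiff_id)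
  exact this.contDiff

theorem differentiableAt_snd
    (hu : ContMDiff (I.prod 𝓘(ℝ, EuclideanSpace ℝ (Fin m))) 𝓘(ℝ, ℂ) ∞ u)
    (p : M × EuclideanSpace ℝ (Fin m)) : DifferentiableAt ℝ (fun y => u (p.1, y)) p.2 :=
  (contDiff_snd hu p.1).differentiable (by simp) _

theorem diffX_add (hu : ContMDiff (I.prod 𝓘(ℝ, EuclideanSpace ℝ (Fin m))) 𝓘(ℝ, ℂ) ∞ u)
    (hv : ContMDiff (I.prod 𝓘(ℝ, EuclideanSpace ℝ (Fin m))) 𝓘(ℝ, ℂ) ∞ v)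
    (p : M × EuclideanSpace ℝ (Fin m)) :
    diffX I (u + v) p = diffX I u p + diffX I v p :=
  mfderiv_add (mdifferentiableAt_fst hu p) (mdifferentiableAt_fst hv p)

theorem diffX_smul (hu : ContMDiff (I.prod 𝓘(ℝ, EuclideanSpace ℝ (Fin m))) 𝓘(ℝ, ℂ) ∞ u) (c : ℂ)
    (p : M × EuclideanSpace ℝ (Fin m)) (X : TangentSpace I p.1) :
    diffX I (c • u) p X = c * diffX I u p X := by
  have h := (((ContinuousLinearMap.mul ℝ ℂ c).hasFDerivAt (x := u (p.1, p.2))).hasMFDerivAt).comp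
    p.1 (mdifferentiableAt_fst hu p).hasMFDerivAt
  have h2 : diffX I (c • u) p = _ := h.mfderiv
  rw [h2]
  rfl

theorem diffY_add (hu : ContMDiff (I.prod 𝓘(ℝ, EuclideanSpace ℝ (Fin m))) 𝓘(ℝ, ℂ) ∞ u)
    (hv : ContMDiff (I.prod 𝓘(ℝ, EuclideanSpace ℝ (Fin m))) 𝓘(ℝ, ℂ) ∞ v) (j : Fin m)
    (p : M × EuclideanSpace ℝ (Fin m)) :
    diffY (u + v) j p = diffY u j p + diffY v j p := by
  have := fderiv_add (differentiableAt_snd hu p) (differentiableAt_snd hv p)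
  exact congrArg (fun L => L (EuclideanSpace.single j 1)) this

theorem diffY_smul (hu : ContMDiff (I.prod 𝓘(ℝ, EuclideanSpace ℝ (Fin m))) 𝓘(ℝ, ℂ) ∞ u) (c : ℂ)
    (j : Fin m) (p : M × EuclideanSpace ℝ (Fin m)) :
    diffY (c • u) j p = c * diffY u j p := by
  have := fderiv_const_smul (differentiableAt_snd hu p) c
  exact congrArg (fun L => L (EuclideanSpace.single j 1)) this

/-- The integrand of `freeForm`. -/
noncomputable def formDensity (ζ : EuclideanSpace ℂ (Fin m))
    (u v : M × EuclideanSpace ℝ (Fin m) → ℂ) (p : M × EuclideanSpace ℝ (Fin m)) : ℂ :=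
  covectorInner g p.1 (diffX I u p) (diffX I v p) +
    ∑ j, (diffY u j p + Complex.I * ζ j * u p) *
      conj (diffY v j p + Complex.I * conj (ζ j) * v p)

theorem continuous_formDensity (ζ : EuclideanSpace ℂ (Fin m))
    (hu : ContMDiff (I.prod 𝓘(ℝ, EuclideanSpace ℝ (Fin m))) 𝓘(ℝ, ℂ) ∞ u)
    (hv : ContMDiff (I.prod 𝓘(ℝ, EuclideanSpace ℝ (Fin m))) 𝓘(ℝ, ℂ) ∞ v) :
    Continuous (formDensity g ζ u v) := by
  refine (continuous_covectorInner_diffX g hu hv).add (continuous_finsetSum _ fun j _ => ?_)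
  have h1 := hu.continuous
  have h2 := hv.continuous
  exact ((continuous_diffY hu j).add (continuous_const.mul h1)).mul
    (Complex.continuous_conj.comp ((continuous_diffY hv j).add (continuous_const.mul h2)))

theorem formDensity_add_left (ζ : EuclideanSpace ℂ (Fin m))
    (hu : ContMDiff (I.prod 𝓘(ℝ, EuclideanSpace ℝ (Fin m))) 𝓘(ℝ, ℂ) ∞ u)
    (hv : ContMDiff (I.prod 𝓘(ℝ, EuclideanSpace ℝ (Fin m))) 𝓘(ℝ, ℂ) ∞ v)
    (p : M × EuclideanSpace ℝ (Fin m)) :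
    formDensity g ζ (u + v) w p = formDensity g ζ u w p + formDensity g ζ v w p := by
  simp only [formDensity, covectorInner, diffX_add hu hv, diffY_add hu hv, Pi.add_apply,
    _root_.add_apply]
  have h (a b c d : ℂ) : a + b + (c + d) = (a + c) + (b + d) := by ring
  rw [h]
  simp only [← Finset.sum_add_distrib]
  congr 1 <;> refine Finset.sum_congr rfl fun i _ => ?_
  · exact Finset.sum_congr rfl fun j _ => by ring
  · ring

theorem formDensity_smul_left (ζ : EuclideanSpace ℂ (Fin m))
    (hu : ContMDiff (I.prod 𝓘(ℝ, EuclideanSpace ℝ (Fin m))) 𝓘(ℝ, ℂ) ∞ u) (c : ℂ)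
    (p : M × EuclideanSpace ℝ (Fin m)) :
    formDensity g ζ (c • u) w p = c * formDensity g ζ u w p := by
  simp only [formDensity, covectorInner, diffX_smul hu, diffY_smul hu, Pi.smul_apply, mul_add,
    Finset.mul_sum, smul_eq_mul]
  congr 1 <;> refine Finset.sum_congr rfl fun i _ => ?_
  · exact Finset.sum_congr rfl fun j _ => by ring
  · ring

/-- For real `ζ` the form is Hermitian. -/
theorem conj_formDensity {ζ : EuclideanSpace ℂ (Fin m)} (hζ : ∀ j, conj (ζ j) = ζ j)
    (p : M × EuclideanSpace ℝ (Fin m)) :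
    conj (formDensity g ζ u v p) = formDensity g ζ v u p := by
  simp only [formDensity, map_add, map_sum, covectorInner_conj]
  congr 1
  refine Finset.sum_congr rfl fun j _ => ?_
  simp only [map_mul, map_add, map_neg, Complex.conj_conj, hζ, Complex.conj_I]
  ring

theorem formDensity_self_re {ζ : EuclideanSpace ℂ (Fin m)} (hζ : ∀ j, conj (ζ j) = ζ j)
    (p : M × EuclideanSpace ℝ (Fin m)) :
    (formDensity g ζ u u p).re = (covectorInner g p.1 (diffX I u p) (diffX I u p)).re +
      ∑ j, ‖diffY u j p + Complex.I * ζ j * u p‖ ^ 2 := by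
  simp only [formDensity, Complex.add_re, Complex.re_sum, hζ, Complex.mul_conj,
    Complex.normSq_eq_norm_sq, Complex.ofReal_re]

theorem formDensity_self_nonneg {ζ : EuclideanSpace ℂ (Fin m)} (hζ : ∀ j, conj (ζ j) = ζ j)
    (p : M × EuclideanSpace ℝ (Fin m)) : 0 ≤ (formDensity g ζ u u p).re := by
  rw [formDensity_self_re g hζ]
  exact add_nonneg (covectorInner_self_nonneg g _ _) (Finset.sum_nonneg fun _ _ => sq_nonneg _)

theorem formDensity_zero_re (p : M × EuclideanSpace ℝ (Fin m)) :
    (formDensity g 0 u u p).re = gradSq g u p := by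
  rw [formDensity_self_re g (by simp)]
  simp [gradSq]

/-- Forms with different real quasimomenta are comparable. -/
theorem formDensity_self_le {ζ ζ' : EuclideanSpace ℂ (Fin m)} (hζ : ∀ j, conj (ζ j) = ζ j)
    (hζ' : ∀ j, conj (ζ' j) = ζ' j) (p : M × EuclideanSpace ℝ (Fin m)) :
    (formDensity g ζ u u p).re ≤
      2 * (formDensity g ζ' u u p).re + 2 * (∑ j, ‖ζ j - ζ' j‖ ^ 2) * ‖u p‖ ^ 2 := by
  rw [formDensity_self_re g hζ, formDensity_self_re g hζ']
  have h0 := covectorInner_self_nonneg g p.1 (diffX I u p)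
  have : ∑ j, ‖diffY u j p + Complex.I * ζ j * u p‖ ^ 2 ≤
      ∑ j, (2 * ‖diffY u j p + Complex.I * ζ' j * u p‖ ^ 2 +
        2 * (‖ζ j - ζ' j‖ ^ 2 * ‖u p‖ ^ 2)) := by
    refine Finset.sum_le_sum fun j _ => ?_
    have h1 : diffY u j p + Complex.I * ζ j * u p = (diffY u j p + Complex.I * ζ' j * u p) +
        Complex.I * (ζ j - ζ' j) * u p := by ring
    have h2 := norm_add_le (diffY u j p + Complex.I * ζ' j * u p) (Complex.I * (ζ j - ζ' j) * u p)
    rw [← h1, norm_mul, norm_mul, Complex.norm_I, one_mul] at h2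
    have h3 := pow_le_pow_left₀ (norm_nonneg _) h2 2
    nlinarith [sq_nonneg (‖diffY u j p + Complex.I * ζ' j * u p‖ - ‖ζ j - ζ' j‖ * ‖u p‖)]
  rw [Finset.sum_add_distrib, ← Finset.mul_sum, ← Finset.mul_sum, ← Finset.sum_mul] at this
  linarith

/-- The derivative of `u` along the basis vector `b 0`. -/
noncomputable def diffB [NeZero m] (u : M × EuclideanSpace ℝ (Fin m) → ℂ)
    (p : M × EuclideanSpace ℝ (Fin m)) : ℂ :=
  fderiv ℝ (fun y => u (p.1, y)) p.2 (b 0)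

theorem diffB_eq_sum [NeZero m] (p : M × EuclideanSpace ℝ (Fin m)) :
    diffB b u p = ∑ j, (b 0 j : ℂ) * diffY u j p := by
  have h : b 0 = ∑ j, (b 0 j) • EuclideanSpace.single j (1 : ℝ) := by
    conv_lhs => rw [← (EuclideanSpace.basisFun (Fin m) ℝ).sum_repr (b 0)]
    simp
  conv_lhs => rw [diffB, h]
  rw [map_sum]
  refine Finset.sum_congr rfl fun j _ => ?_
  rw [map_smul, diffY, Complex.real_smul]

theorem continuous_diffB [NeZero m]
    (hu : ContMDiff (I.prod 𝓘(ℝ, EuclideanSpace ℝ (Fin m))) 𝓘(ℝ, ℂ) ∞ u) :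
    Continuous (diffB b u) := by
  have : diffB b u = fun p => ∑ j, (b 0 j : ℂ) * diffY u j p := funext fun p => diffB_eq_sum b p
  rw [this]
  exact continuous_finsetSum _ fun j _ => continuous_const.mul (continuous_diffY hu j)

theorem diffB_add [NeZero m]
    (hu : ContMDiff (I.prod 𝓘(ℝ, EuclideanSpace ℝ (Fin m))) 𝓘(ℝ, ℂ) ∞ u)
    (hv : ContMDiff (I.prod 𝓘(ℝ, EuclideanSpace ℝ (Fin m))) 𝓘(ℝ, ℂ) ∞ v)
    (p : M × EuclideanSpace ℝ (Fin m)) :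
    diffB b (u + v) p = diffB b u p + diffB b v p :=
  congrArg (fun L => L (b 0)) (fderiv_add (differentiableAt_snd hu p) (differentiableAt_snd hv p))

theorem diffB_smul [NeZero m]
    (hu : ContMDiff (I.prod 𝓘(ℝ, EuclideanSpace ℝ (Fin m))) 𝓘(ℝ, ℂ) ∞ u) (c : ℂ)
    (p : M × EuclideanSpace ℝ (Fin m)) :
    diffB b (c • u) p = c * diffB b u p :=
  congrArg (fun L => L (b 0)) (fderiv_const_smul (differentiableAt_snd hu p) c)

theorem sum_sq_eq_one [NeZero m] (hb : ‖b 0‖ = 1) : ∑ j, ((b 0 j : ℂ)) * (b 0 j : ℂ) = 1 := by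
  have := EuclideanSpace.norm_sq_eq (b 0)
  rw [hb] at this
  have h2 : ∑ j, b 0 j * b 0 j = 1 := by
    rw [one_pow] at this
    rw [this]
    exact Finset.sum_congr rfl fun j _ => by rw [Real.norm_eq_abs, sq_abs]; ring
  exact_mod_cast h2

theorem sum_mul_eq_zero [NeZero m] {ξ : EuclideanSpace ℝ (Fin m)} (hξ : inner ℝ ξ (b 0) = 0) :
    ∑ j, ((b 0 j : ℂ)) * (ξ j : ℂ) = 0 := by
  rw [PiLp.inner_apply] at hξ
  have h2 : ∑ j, b 0 j * ξ j = 0 := by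
    rw [← hξ]
    exact Finset.sum_congr rfl fun j _ => by simp
  exact_mod_cast h2

theorem conj_quasimomentum_zero [NeZero m] (ξ : EuclideanSpace ℝ (Fin m)) (j : Fin m) :
    conj (quasimomentum b ξ 0 j) = quasimomentum b ξ 0 j := by
  simp [quasimomentum]

/-- The component of `∇ + iζ` along `b 0` is `∂ + iπ`, since `b 0` is a unit vector orthogonal
to `ξ`. -/
theorem sum_mul_quasimomentum [NeZero m] (hb : ‖b 0‖ = 1) {ξ : EuclideanSpace ℝ (Fin m)}
    (hξ : inner ℝ ξ (b 0) = 0) (p : M × EuclideanSpace ℝ (Fin m)) :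
    ∑ j, (b 0 j : ℂ) * (diffY u j p + Complex.I * quasimomentum b ξ 0 j * u p) =
      diffB b u p + Complex.I * Real.pi * u p := by
  have h1 := sum_sq_eq_one b hb
  have h2 := sum_mul_eq_zero b hξ
  have : ∑ j, (b 0 j : ℂ) * (diffY u j p + Complex.I * quasimomentum b ξ 0 j * u p) =
      ∑ j, (b 0 j : ℂ) * diffY u j p + Complex.I * Real.pi * u p * ∑ j, (b 0 j : ℂ) * (b 0 j : ℂ) +
        Complex.I * u p * ∑ j, (b 0 j : ℂ) * (ξ j : ℂ) := by
    simp only [Finset.mul_sum, ← Finset.sum_add_distrib]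
    refine Finset.sum_congr rfl fun j _ => ?_
    simp [quasimomentum]
    ring
  rw [this, h1, h2, diffB_eq_sum]
  ring

/-- The dependence of the form on the imaginary part of the quasimomentum. -/
theorem formDensity_quasimomentum [NeZero m] (hb : ‖b 0‖ = 1) {ξ : EuclideanSpace ℝ (Fin m)}
    (hξ : inner ℝ ξ (b 0) = 0) (τ : ℝ) (p : M × EuclideanSpace ℝ (Fin m)) :
    formDensity g (quasimomentum b ξ τ) u v p =
      formDensity g (quasimomentum b ξ 0) u v p - (τ : ℂ) ^ 2 * (u p * conj (v p)) +
        τ * ((diffB b u p + Complex.I * Real.pi * u p) * conj (v p) -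
          u p * conj (diffB b v p + Complex.I * Real.pi * v p)) := by
  have hq (j) : quasimomentum b ξ τ j = quasimomentum b ξ 0 j + Complex.I * τ * (b 0 j : ℂ) := by
    simp [quasimomentum]; ring
  rw [← sum_mul_quasimomentum b hb hξ p (u := u), ← sum_mul_quasimomentum b hb hξ p (u := v)]
  have h1 := sum_sq_eq_one b hb
  have : (τ : ℂ) ^ 2 * (u p * conj (v p)) =
    (∑ j, ((b 0 j : ℂ)) * (b 0 j : ℂ)) * ((τ : ℂ) ^ 2 * (u p * conj (v p))) := by rw [h1, one_mul]
  rw [this]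
  simp only [formDensity, map_sum, mul_sub, Finset.sum_mul, Finset.mul_sum]
  rw [add_sub_assoc, add_assoc]
  congr 1
  rw [← Finset.sum_sub_distrib, ← Finset.sum_sub_distrib, ← Finset.sum_add_distrib]
  refine Finset.sum_congr rfl fun j _ => ?_
  rw [hq]
  simp only [map_add, map_mul, map_neg, Complex.conj_I, Complex.conj_ofReal,
    conj_quasimomentum_zero]
  have hI := Complex.I_sq
  set A := diffY u j p
  set B := diffY v j p
  linear_combination (τ * (b 0 j : ℂ) * u p *
      (conj B - Complex.I * quasimomentum b ξ 0 j * conj (v p)) +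
    (- τ * (b 0 j : ℂ)) * conj (v p) * (A + Complex.I * quasimomentum b ξ 0 j * u p)
      - τ * τ * (b 0 j : ℂ) * (b 0 j : ℂ) * u p * conj (v p) * (Complex.I ^ 2 - 1)) * hI

/-- By Cauchy–Schwarz, the component of `∇ + iζ` along the unit vector `b 0` is bounded by the
form. -/
theorem norm_sq_diffB_le [NeZero m] (hb : ‖b 0‖ = 1) {ξ : EuclideanSpace ℝ (Fin m)}
    (hξ : inner ℝ ξ (b 0) = 0) (p : M × EuclideanSpace ℝ (Fin m)) :
    ‖diffB b u p + Complex.I * Real.pi * u p‖ ^ 2 ≤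
      (formDensity g (quasimomentum b ξ 0) u u p).re := by
  rw [formDensity_self_re g (conj_quasimomentum_zero b ξ), ← sum_mul_quasimomentum b hb hξ p]
  have h0 := covectorInner_self_nonneg g p.1 (diffX I u p)
  set A := fun j => diffY u j p + Complex.I * quasimomentum b ξ 0 j * u p
  have h1 : ‖∑ j, (b 0 j : ℂ) * A j‖ ≤ ∑ j, |b 0 j| * ‖A j‖ :=
    (norm_sum_le _ _).trans (le_of_eq (by simp))
  have h2 := Finset.sum_mul_sq_le_sq_mul_sq Finset.univ (fun j => |b 0 j|) (fun j => ‖A j‖)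
  have h3 : ∑ j, |b 0 j| ^ 2 = 1 := by
    have := EuclideanSpace.norm_sq_eq (b 0)
    rw [hb, one_pow] at this
    simpa using this.symm
  rw [h3, one_mul] at h2
  have h4 := pow_le_pow_left₀ (norm_nonneg _) h1 2
  linarith

end Form

/-! ### Completion of a space with an inner product -/

universe u₁

/-- The Hilbert space completion of a complex vector space with a positive semidefinite Hermitian
form. -/
theorem exists_hilbert_completion {D : Type u₁} [AddCommGroup D] [Module ℂ D]
    (c : PreInnerProductSpace.Core ℂ D) :
    ∃ (W : Type u₁) (_ : NormedAddCommGroup W) (_ : InnerProductSpace ℂ W) (_ : CompleteSpace W)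
      (κ : D →ₗ[ℂ] W), DenseRange κ ∧ ∀ u v, inner ℂ (κ u) (κ v) = c.inner u v := by
  letI : SeminormedAddCommGroup D := InnerProductSpace.Core.toSeminormedAddCommGroup (c := c)
  letI : InnerProductSpace ℂ D := InnerProductSpace.ofCore c
  refine ⟨UniformSpace.Completion D, inferInstance, inferInstance, inferInstance,
    (UniformSpace.Completion.toComplL : D →L[ℂ] UniformSpace.Completion D).toLinearMap, ?_, ?_⟩
  · exact UniformSpace.Completion.denseRange_coe
  · intro u v
    exact UniformSpace.Completion.inner_coe u v

/-! ### The Hilbert space of the form -/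

section FormSpace

variable {k m : ℕ} {H : Type*} [TopologicalSpace H]
  {I : ModelWithCorners ℝ (EuclideanSpace ℝ (Fin k)) H}
  {M : Type*} [TopologicalSpace M] [ChartedSpace H M] [IsManifold I ∞ M]
  (g : Metric I M) (b : Module.Basis (Fin m) ℝ (EuclideanSpace ℝ (Fin m)))

theorem IsCoreFunction.add {bc : BoundaryCondition} {u v : M × EuclideanSpace ℝ (Fin m) → ℂ}
    (hu : IsCoreFunction b I bc u) (hv : IsCoreFunction b I bc v) :
    IsCoreFunction b I bc (u + v) := by
  refine ⟨hu.1.add hv.1, fun x y j => ?_, ?_⟩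
  · simp only [Pi.add_apply, hu.2.1 x y j, hv.2.1 x y j]
  · cases bc
    · obtain ⟨K, hK, hKi, h⟩ := hu.2.2
      obtain ⟨K', hK', hKi', h'⟩ := hv.2.2
      refine ⟨K ∪ K', hK.union hK', union_subset hKi hKi', fun x hx y => ?_⟩
      simp only [mem_union, not_or] at hx
      simp [h x hx.1 y, h' x hx.2 y]
    · trivial

theorem IsCoreFunction.smul {bc : BoundaryCondition} {u : M × EuclideanSpace ℝ (Fin m) → ℂ}
    (hu : IsCoreFunction b I bc u) (c : ℂ) : IsCoreFunction b I bc (c • u) := by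
  refine ⟨(ContinuousLinearMap.mul ℝ ℂ c).contMDiff.comp hu.1, fun x y j => ?_, ?_⟩
  · simp only [Pi.smul_apply, hu.2.1 x y j]
  · cases bc
    · obtain ⟨K, hK, hKi, h⟩ := hu.2.2
      exact ⟨K, hK, hKi, fun x hx y => by simp [h x hx y]⟩
    · trivial

theorem IsCoreFunction.zero (bc : BoundaryCondition) :
    IsCoreFunction (M := M) b I bc (0 : M × EuclideanSpace ℝ (Fin m) → ℂ) := by
  refine ⟨contMDiff_const, fun x y j => rfl, ?_⟩
  cases bc
  · exact ⟨∅, isCompact_empty, empty_subset _, fun _ _ _ => rfl⟩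
  · trivial

/-- The complex vector space of core functions. -/
def coreSpace (I : ModelWithCorners ℝ (EuclideanSpace ℝ (Fin k)) H) (M : Type*)
    [TopologicalSpace M] [ChartedSpace H M] [IsManifold I ∞ M] (bc : BoundaryCondition) :
    Submodule ℂ (M × EuclideanSpace ℝ (Fin m) → ℂ) where
  carrier := {u | IsCoreFunction b I bc u}
  add_mem' := IsCoreFunction.add b
  zero_mem' := IsCoreFunction.zero b bc
  smul_mem' c _ hu := IsCoreFunction.smul b hu c

variable [MeasurableSpace M] [BorelSpace M] [CompactSpace M]

/-- The class in `L₂(M × 𝕋)` of a core function. -/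
noncomputable def coreToL2 (hI : IsBoundaryModel I) (bc : BoundaryCondition) :
    coreSpace b I M bc →ₗ[ℂ] L2 g b where
  toFun u := (memLp_of_continuous g b hI u.2.1.continuous 2).toLp u
  map_add' _ _ := rfl
  map_smul' _ _ := rfl

theorem coeFn_coreToL2 (hI : IsBoundaryModel I) {bc : BoundaryCondition} (u : coreSpace b I M bc) :
    ⇑(coreToL2 g b hI bc u) =ᵐ[cellMeasure g b] u.1 :=
  (memLp_of_continuous g b hI u.2.1.continuous 2).coeFn_toLp

theorem inner_L2 (u v : L2 g b) : inner ℂ u v = ∫ p, v p * conj (u p) ∂(cellMeasure g b) :=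
  L2.inner_def u v

theorem inner_coreToL2 (hI : IsBoundaryModel I) {bc : BoundaryCondition}
    (u v : coreSpace b I M bc) :
    inner ℂ (coreToL2 g b hI bc u) (coreToL2 g b hI bc v) =
      ∫ p, v.1 p * conj (u.1 p) ∂(cellMeasure g b) := by
  rw [inner_L2]
  refine integral_congr_ae ?_
  filter_upwards [coeFn_coreToL2 g b hI u, coeFn_coreToL2 g b hI v] with p h1 h2
  rw [h1, h2]

theorem freeForm_eq (ζ : EuclideanSpace ℂ (Fin m)) (u v : M × EuclideanSpace ℝ (Fin m) → ℂ) :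
    freeForm g b ζ u v = ∫ p, formDensity g ζ u v p ∂(cellMeasure g b) := rfl

variable {u v w : M × EuclideanSpace ℝ (Fin m) → ℂ}

theorem integrable_formDensity (hI : IsBoundaryModel I) (ζ : EuclideanSpace ℂ (Fin m))
    (hu : ContMDiff (I.prod 𝓘(ℝ, EuclideanSpace ℝ (Fin m))) 𝓘(ℝ, ℂ) ∞ u)
    (hv : ContMDiff (I.prod 𝓘(ℝ, EuclideanSpace ℝ (Fin m))) 𝓘(ℝ, ℂ) ∞ v) :
    Integrable (formDensity g ζ u v) (cellMeasure g b) :=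
  integrable_of_continuous g b hI (continuous_formDensity g ζ hu hv)

theorem freeForm_add_left (hI : IsBoundaryModel I) (ζ : EuclideanSpace ℂ (Fin m))
    (hu : ContMDiff (I.prod 𝓘(ℝ, EuclideanSpace ℝ (Fin m))) 𝓘(ℝ, ℂ) ∞ u)
    (hv : ContMDiff (I.prod 𝓘(ℝ, EuclideanSpace ℝ (Fin m))) 𝓘(ℝ, ℂ) ∞ v)
    (hw : ContMDiff (I.prod 𝓘(ℝ, EuclideanSpace ℝ (Fin m))) 𝓘(ℝ, ℂ) ∞ w) :
    freeForm g b ζ (u + v) w = freeForm g b ζ u w + freeForm g b ζ v w := by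
  simp only [freeForm_eq, formDensity_add_left g ζ hu hv]
  exact integral_add (integrable_formDensity g b hI ζ hu hw) (integrable_formDensity g b hI ζ hv hw)

theorem freeForm_smul_left (ζ : EuclideanSpace ℂ (Fin m))
    (hu : ContMDiff (I.prod 𝓘(ℝ, EuclideanSpace ℝ (Fin m))) 𝓘(ℝ, ℂ) ∞ u) (c : ℂ) :
    freeForm g b ζ (c • u) w = c * freeForm g b ζ u w := by
  simp only [freeForm_eq, formDensity_smul_left g ζ hu]
  exact integral_const_mul _ _

theorem freeForm_conj {ζ : EuclideanSpace ℂ (Fin m)} (hζ : ∀ j, conj (ζ j) = ζ j) :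
    conj (freeForm g b ζ u v) = freeForm g b ζ v u := by
  simp only [freeForm_eq, ← integral_conj, conj_formDensity g hζ]

theorem freeForm_self_re (hI : IsBoundaryModel I) (ζ : EuclideanSpace ℂ (Fin m))
    (hu : ContMDiff (I.prod 𝓘(ℝ, EuclideanSpace ℝ (Fin m))) 𝓘(ℝ, ℂ) ∞ u) :
    (freeForm g b ζ u u).re = ∫ p, (formDensity g ζ u u p).re ∂(cellMeasure g b) := by
  rw [freeForm_eq]
  exact (integral_re (integrable_formDensity g b hI ζ hu hu)).symm

theorem freeForm_self_nonneg (hI : IsBoundaryModel I) {ζ : EuclideanSpace ℂ (Fin m)}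
    (hζ : ∀ j, conj (ζ j) = ζ j)
    (hu : ContMDiff (I.prod 𝓘(ℝ, EuclideanSpace ℝ (Fin m))) 𝓘(ℝ, ℂ) ∞ u) :
    0 ≤ (freeForm g b ζ u u).re := by
  rw [freeForm_self_re g b hI ζ hu]
  exact integral_nonneg fun p => formDensity_self_nonneg g hζ p

theorem freeForm_self_le (hI : IsBoundaryModel I) {ζ ζ' : EuclideanSpace ℂ (Fin m)}
    (hζ : ∀ j, conj (ζ j) = ζ j) (hζ' : ∀ j, conj (ζ' j) = ζ' j) {bc : BoundaryCondition}
    (u : coreSpace b I M bc) :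
    (freeForm g b ζ u.1 u.1).re ≤ 2 * (freeForm g b ζ' u.1 u.1).re +
      2 * (∑ j, ‖ζ j - ζ' j‖ ^ 2) * ‖coreToL2 g b hI bc u‖ ^ 2 := by
  have hu := u.2.1
  have h1 : ‖coreToL2 g b hI bc u‖ ^ 2 = ∫ p, ‖u.1 p‖ ^ 2 ∂(cellMeasure g b) := by
    rw [← inner_self_eq_norm_sq (𝕜 := ℂ), inner_coreToL2]
    have hc : Integrable (fun p => u.1 p * conj (u.1 p)) (cellMeasure g b) :=
      integrable_of_continuous g b hI
        (hu.continuous.mul (Complex.continuous_conj.comp hu.continuous))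
    rw [← integral_re hc]
    refine integral_congr_ae (ae_of_all _ fun p => ?_)
    simp only [Complex.mul_conj, Complex.normSq_eq_norm_sq]
    exact Complex.ofReal_re _
  rw [h1, freeForm_self_re g b hI ζ hu, freeForm_self_re g b hI ζ' hu,
    ← integral_const_mul, ← integral_const_mul]
  have i1 : Integrable (fun p => (formDensity g ζ u.1 u.1 p).re) (cellMeasure g b) :=
    (integrable_formDensity g b hI ζ hu hu).re
  have i2 : Integrable (fun p => (formDensity g ζ' u.1 u.1 p).re) (cellMeasure g b) :=
    (integrable_formDensity g b hI ζ' hu hu).re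
  have i3 : Integrable (fun p => ‖u.1 p‖ ^ 2) (cellMeasure g b) :=
    (memLp_of_continuous g b hI hu.continuous 2).integrable_norm_pow (by simp)
  rw [← integral_add (i2.const_mul 2) (i3.const_mul _)]
  exact integral_mono i1 ((i2.const_mul 2).add (i3.const_mul _)) fun p =>
    formDensity_self_le g hζ hζ' p

/-- The inner product of the form space, `(u, v) + h(ζ)[u, v]` for the free form with a real
quasimomentum `ζ`; Mathlib's inner products are antilinear in the first variable. -/
noncomputable def formCore (hI : IsBoundaryModel I) (bc : BoundaryCondition)
    {ζ : EuclideanSpace ℂ (Fin m)} (hζ : ∀ j, conj (ζ j) = ζ j) :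
    PreInnerProductSpace.Core ℂ (coreSpace b I M bc) where
  inner u v := inner ℂ (coreToL2 g b hI bc u) (coreToL2 g b hI bc v) + freeForm g b ζ v.1 u.1
  conj_inner_symm u v := by
    rw [map_add, inner_conj_symm, freeForm_conj g b hζ]
  re_inner_nonneg u := by
    rw [map_add]
    exact add_nonneg inner_self_nonneg (freeForm_self_nonneg g b hI hζ u.2.1)
  add_left u v w := by
    rw [map_add, inner_add_left, ← freeForm_conj g b hζ, ← freeForm_conj g b hζ (u := u.1),
      ← freeForm_conj g b hζ (u := v.1), Submodule.coe_add,
      freeForm_add_left g b hI ζ u.2.1 v.2.1 w.2.1, map_add]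
    ring
  smul_left u v c := by
    rw [map_smul, inner_smul_left, ← freeForm_conj g b hζ, ← freeForm_conj g b hζ (u := u.1),
      Submodule.coe_smul, freeForm_smul_left g b ζ u.2.1, map_mul]
    ring

/-- `W` is the form domain `H¹` or `H¹₀`, normed by the free form with quasimomentum
`π b₁ + ξ`, up to isomorphism: the completion of the core functions. Here `κ` is the inclusion of
the core functions, `J` the embedding into `L₂`, and `δ` the extension of `∂ + iπ`, where `∂` is
the derivative along `b₁`. -/
structure IsFormSpace [NeZero m] (hI : IsBoundaryModel I) (bc : BoundaryCondition)
    (ξ : EuclideanSpace ℝ (Fin m)) {W : Type*} [NormedAddCommGroup W] [InnerProductSpace ℂ W]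
    (κ : coreSpace b I M bc →ₗ[ℂ] W) (J δ : W →L[ℂ] L2 g b) : Prop where
  dense : DenseRange κ
  inner_eq : ∀ u v, inner ℂ (κ u) (κ v) =
    inner ℂ (coreToL2 g b hI bc u) (coreToL2 g b hI bc v) +
      freeForm g b (quasimomentum b ξ 0) v.1 u.1
  embed : ∀ u, J (κ u) = coreToL2 g b hI bc u
  deriv : ∀ u, δ (κ u) =ᵐ[cellMeasure g b] fun p => diffB b u.1 p + Complex.I * Real.pi * u.1 p

theorem norm_sq_of_inner_eq {W : Type*} [NormedAddCommGroup W] [InnerProductSpace ℂ W]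
    {hI : IsBoundaryModel I} {bc : BoundaryCondition} {ζ : EuclideanSpace ℂ (Fin m)}
    {κ : coreSpace b I M bc →ₗ[ℂ] W}
    (h : ∀ u v, inner ℂ (κ u) (κ v) =
      inner ℂ (coreToL2 g b hI bc u) (coreToL2 g b hI bc v) + freeForm g b ζ v.1 u.1)
    (u : coreSpace b I M bc) :
    ‖κ u‖ ^ 2 = ‖coreToL2 g b hI bc u‖ ^ 2 + (freeForm g b ζ u.1 u.1).re := by
  rw [← inner_self_eq_norm_sq (𝕜 := ℂ), h, map_add, inner_self_eq_norm_sq]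
  rfl

theorem memLp_diffB [NeZero m] (hI : IsBoundaryModel I) {bc : BoundaryCondition}
    (u : coreSpace b I M bc) :
    MemLp (fun p => diffB b u.1 p + Complex.I * Real.pi * u.1 p) 2 (cellMeasure g b) :=
  memLp_of_continuous g b hI
    ((continuous_diffB b u.2.1).add (continuous_const.mul u.2.1.continuous)) 2

/-- `∂ + iπ` on core functions, with values in `L₂`. -/
noncomputable def coreDeriv [NeZero m] (hI : IsBoundaryModel I) (bc : BoundaryCondition) :
    coreSpace b I M bc →ₗ[ℂ] L2 g b where
  toFun u := (memLp_diffB g b hI u).toLp _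
  map_add' u v := by
    rw [← MemLp.toLp_add]
    congr 1
    funext p
    simp only [Pi.add_apply, Submodule.coe_add, diffB_add b u.2.1 v.2.1]
    ring
  map_smul' c u := by
    rw [← MemLp.toLp_const_smul]
    congr 1
    funext p
    simp only [Pi.smul_apply, Submodule.coe_smul, diffB_smul b u.2.1, smul_eq_mul, RingHom.id_apply]
    ring

/-- The derivative `∂ + iπ` along `b₁` is bounded by the form. -/
theorem norm_sq_coreDeriv_le [NeZero m] (hI : IsBoundaryModel I) (hb : ‖b 0‖ = 1)
    {ξ : EuclideanSpace ℝ (Fin m)} (hξ : inner ℝ ξ (b 0) = 0) {bc : BoundaryCondition}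
    (u : coreSpace b I M bc) :
    ‖coreDeriv g b hI bc u‖ ^ 2 ≤ (freeForm g b (quasimomentum b ξ 0) u.1 u.1).re := by
  have hm := memLp_diffB g b hI u
  have h1 : ‖coreDeriv g b hI bc u‖ ^ 2 =
      ∫ p, ‖diffB b u.1 p + Complex.I * Real.pi * u.1 p‖ ^ 2 ∂(cellMeasure g b) := by
    rw [← inner_self_eq_norm_sq (𝕜 := ℂ), L2.inner_def]
    have hc : Integrable (fun p => inner ℂ (coreDeriv g b hI bc u p) (coreDeriv g b hI bc u p))
      (cellMeasure g b) := L2.integrable_inner _ _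
    rw [← integral_re hc]
    have : ⇑(coreDeriv g b hI bc u) =ᵐ[cellMeasure g b]
      fun p => diffB b u.1 p + Complex.I * Real.pi * u.1 p := hm.coeFn_toLp
    refine integral_congr_ae ?_
    filter_upwards [this] with p hp
    rw [hp, inner_self_eq_norm_sq]
  rw [h1, freeForm_self_re g b hI _ u.2.1]
  exact integral_mono (hm.integrable_norm_pow (by simp))
    (integrable_formDensity g b hI _ u.2.1 u.2.1).re
    fun p => norm_sq_diffB_le g b hb hξ p

/-- The form space exists: the embedding in `L₂` and the derivative are bounded in the norm of the
form, so that they extend to the completion. -/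
theorem exists_isFormSpace.{u} {M : Type u} [TopologicalSpace M] [ChartedSpace H M]
    [IsManifold I ∞ M] (g : Metric I M) [MeasurableSpace M] [BorelSpace M] [CompactSpace M]
    [NeZero m] (hI : IsBoundaryModel I) (hb : ‖b 0‖ = 1)
    {ξ : EuclideanSpace ℝ (Fin m)} (hξ : inner ℝ ξ (b 0) = 0) (bc : BoundaryCondition) :
    ∃ (W : Type u) (_ : NormedAddCommGroup W) (_ : InnerProductSpace ℂ W) (_ : CompleteSpace W)
      (κ : coreSpace b I M bc →ₗ[ℂ] W) (J δ : W →L[ℂ] L2 g b), IsFormSpace g b hI bc ξ κ J δ := by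
  obtain ⟨W, i1, i2, i3, κ, hκ, hin⟩ :=
    exists_hilbert_completion (formCore g b hI bc (conj_quasimomentum_zero b ξ))
  have hn := norm_sq_of_inner_eq g b hin
  have hJ : ∀ u, ‖coreToL2 g b hI bc u‖ ≤ 1 * ‖κ u‖ := by
    intro u
    rw [one_mul]
    refine le_of_sq_le_sq ?_ (norm_nonneg _)
    rw [hn]
    linarith [freeForm_self_nonneg g b hI (conj_quasimomentum_zero b ξ) u.2.1]
  have hδ : ∀ u, ‖coreDeriv g b hI bc u‖ ≤ 1 * ‖κ u‖ := by
    intro u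
    rw [one_mul]
    refine le_of_sq_le_sq ?_ (norm_nonneg _)
    rw [hn]
    linarith [norm_sq_coreDeriv_le g b hI hb hξ u, sq_nonneg ‖coreToL2 g b hI bc u‖]
  refine ⟨W, i1, i2, i3, κ, (coreToL2 g b hI bc).extendOfNorm κ,
    (coreDeriv g b hI bc).extendOfNorm κ, hκ, hin, fun u => ?_, fun u => ?_⟩
  · exact LinearMap.extendOfNorm_eq hκ ⟨1, hJ⟩ u
  · rw [LinearMap.extendOfNorm_eq hκ ⟨1, hδ⟩ u]
    exact (memLp_diffB g b hI u).coeFn_toLp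

end FormSpace

/-! ### The Schrödinger operator in terms of the form space -/

/-- The form of `H((π + iτ) b₁ + ξ)` with `V = 0`, on the form space. -/
noncomputable def twistedForm {W 𝓗 : Type*} [NormedAddCommGroup W] [InnerProductSpace ℂ W]
    [NormedAddCommGroup 𝓗] [InnerProductSpace ℂ 𝓗] (J δ : W →L[ℂ] 𝓗) (τ : ℝ) (w z : W) : ℂ :=
  inner ℂ z w - (1 + (τ : ℂ) ^ 2) * inner ℂ (J z) (J w) +
    τ * (inner ℂ (J z) (δ w) - inner ℂ (δ z) (J w))

theorem tendsto_twistedForm {W 𝓗 α : Type*} [NormedAddCommGroup W] [InnerProductSpace ℂ W]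
    [NormedAddCommGroup 𝓗] [InnerProductSpace ℂ 𝓗] (J δ : W →L[ℂ] 𝓗) (τ : ℝ) {l : Filter α}
    {w z : α → W} {w₀ z₀ : W} (hw : Tendsto w l (𝓝 w₀)) (hz : Tendsto z l (𝓝 z₀)) :
    Tendsto (fun n => twistedForm J δ τ (w n) (z n)) l (𝓝 (twistedForm J δ τ w₀ z₀)) := by
  have hJw := (J.continuous.tendsto _).comp hw
  have hJz := (J.continuous.tendsto _).comp hz
  have hδw := (δ.continuous.tendsto _).comp hw
  have hδz := (δ.continuous.tendsto _).comp hz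
  exact ((hz.inner hw).sub ((hJz.inner hJw).const_mul _)).add
    (((hJz.inner hδw).sub (hδz.inner hJw)).const_mul _)

section FormSpace

variable {k m : ℕ} {H : Type*} [TopologicalSpace H]
  {I : ModelWithCorners ℝ (EuclideanSpace ℝ (Fin k)) H}
  {M : Type*} [TopologicalSpace M] [ChartedSpace H M] [IsManifold I ∞ M]
  {g : Metric I M} {b : Module.Basis (Fin m) ℝ (EuclideanSpace ℝ (Fin m))}
  [MeasurableSpace M] [BorelSpace M] [CompactSpace M] [NeZero m] {hI : IsBoundaryModel I}
  {bc : BoundaryCondition} {ξ : EuclideanSpace ℝ (Fin m)} {W : Type*} [NormedAddCommGroup W]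
  [InnerProductSpace ℂ W] {κ : coreSpace b I M bc →ₗ[ℂ] W} {J δ : W →L[ℂ] L2 g b}

theorem IsFormSpace.norm_sq (h : IsFormSpace g b hI bc ξ κ J δ) (u : coreSpace b I M bc) :
    ‖κ u‖ ^ 2 = ‖coreToL2 g b hI bc u‖ ^ 2 +
      (freeForm g b (quasimomentum b ξ 0) u.1 u.1).re :=
  norm_sq_of_inner_eq g b h.inner_eq u

theorem IsFormSpace.norm_embed_le (h : IsFormSpace g b hI bc ξ κ J δ) (w : W) : ‖J w‖ ≤ ‖w‖ := by
  refine h.dense.induction_on w (isClosed_le (by fun_prop) (by fun_prop)) fun u => ?_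
  refine le_of_sq_le_sq ?_ (norm_nonneg _)
  rw [h.norm_sq, h.embed]
  linarith [freeForm_self_nonneg g b hI (conj_quasimomentum_zero b ξ) u.2.1]

theorem IsFormSpace.norm_deriv_le (h : IsFormSpace g b hI bc ξ κ J δ) (hb : ‖b 0‖ = 1)
    (hξ : inner ℝ ξ (b 0) = 0) (w : W) : ‖δ w‖ ≤ ‖w‖ := by
  refine h.dense.induction_on w (isClosed_le (by fun_prop) (by fun_prop)) fun u => ?_
  have h1 : δ (κ u) = coreDeriv g b hI bc u :=
    Lp.ext ((h.deriv u).trans (memLp_diffB g b hI u).coeFn_toLp.symm)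
  refine le_of_sq_le_sq ?_ (norm_nonneg _)
  rw [h.norm_sq, h1]
  linarith [norm_sq_coreDeriv_le g b hI hb hξ u, sq_nonneg ‖coreToL2 g b hI bc u‖]

theorem tendsto_coreToL2_iff {w : ℕ → M × EuclideanSpace ℝ (Fin m) → ℂ}
    (hw : ∀ n, IsCoreFunction b I bc (w n)) (u : L2 g b) :
    Tendsto (fun n => coreToL2 g b hI bc ⟨w n, hw n⟩) atTop (𝓝 u) ↔
      Tendsto (fun n => eLpNorm (w n - ⇑u) 2 (cellMeasure g b)) atTop (𝓝 0) := by
  rw [Lp.tendsto_Lp_iff_tendsto_eLpNorm']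
  refine tendsto_congr fun n => eLpNorm_congr_ae ?_
  exact (coeFn_coreToL2 g b hI (⟨w n, hw n⟩ : coreSpace b I M bc)).sub (ae_eq_refl _)

/-- A sequence which converges in `H¹` converges in the form space. -/
theorem IsFormSpace.exists_of_tendstoH1 [CompleteSpace W] (h : IsFormSpace g b hI bc ξ κ J δ)
    {w : ℕ → M × EuclideanSpace ℝ (Fin m) → ℂ} {u : L2 g b} (hw : TendstoH1 g b bc w u) :
    ∃ w₀ : W, Tendsto (fun n => κ ⟨w n, hw.1 n⟩) atTop (𝓝 w₀) ∧ J w₀ = u := by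
  have hι := (tendsto_coreToL2_iff (hI := hI) hw.1 u).2 hw.2.1
  set S : ℝ := ∑ j, ‖quasimomentum b ξ 0 j - (0 : EuclideanSpace ℂ (Fin m)) j‖ ^ 2
  have hS : 0 ≤ S := Finset.sum_nonneg fun _ _ => sq_nonneg _
  have hc : CauchySeq (fun n => κ (⟨w n, hw.1 n⟩ : coreSpace b I M bc)) := by
    refine Metric.cauchySeq_iff.2 fun ε hε => ?_
    have hη : 0 < ε ^ 2 / (4 * (1 + S)) := by positivity
    obtain ⟨N₁, h₁⟩ := Metric.cauchySeq_iff.1 hι.cauchySeq _ (Real.sqrt_pos.2 hη)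
    obtain ⟨N₂, h₂⟩ := hw.2.2 (ε ^ 2 / 4) (by positivity)
    refine ⟨max N₁ N₂, fun n hn l hl => ?_⟩
    have e1 := h₁ n (le_trans (le_max_left _ _) hn) l (le_trans (le_max_left _ _) hl)
    have e2 := h₂ n (le_trans (le_max_right _ _) hn) l (le_trans (le_max_right _ _) hl)
    rw [dist_eq_norm, ← map_sub] at e1 ⊢
    have e3 := freeForm_self_le g b hI (conj_quasimomentum_zero b ξ) (ζ' := 0) (by simp)
      ((⟨w n, hw.1 n⟩ : coreSpace b I M bc) - ⟨w l, hw.1 l⟩)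
    have e4 := h.norm_sq ((⟨w n, hw.1 n⟩ : coreSpace b I M bc) - ⟨w l, hw.1 l⟩)
    have e5 := (Real.lt_sqrt (norm_nonneg _)).1 e1
    have e6 : (1 + S) * ‖coreToL2 g b hI bc ((⟨w n, hw.1 n⟩ : coreSpace b I M bc) -
        ⟨w l, hw.1 l⟩)‖ ^ 2 < ε ^ 2 / 4 := by
      have := mul_lt_mul_of_pos_left e5 (by positivity : 0 < 1 + S)
      refine this.trans_eq ?_
      field_simp
    refine lt_of_pow_lt_pow_left₀ 2 hε.le ?_
    rw [e4]
    change (freeForm g b 0 (w n - w l) (w n - w l)).re < _ at e2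
    change (freeForm g b _ (w n - w l) (w n - w l)).re ≤ 2 * (freeForm g b 0 (w n - w l)
      (w n - w l)).re + 2 * S * _ at e3
    change _ + (freeForm g b _ (w n - w l) (w n - w l)).re < _
    nlinarith [sq_nonneg ‖coreToL2 g b hI bc ((⟨w n, hw.1 n⟩ : coreSpace b I M bc) -
        ⟨w l, hw.1 l⟩)‖]
  obtain ⟨w₀, hw₀⟩ := cauchySeq_tendsto_of_complete hc
  refine ⟨w₀, hw₀, tendsto_nhds_unique ?_ hι⟩
  simp only [← h.embed]
  exact (J.continuous.tendsto _).comp hw₀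

/-- Every element of the form space is a limit in `H¹` of core functions. -/
theorem IsFormSpace.exists_tendstoH1 (h : IsFormSpace g b hI bc ξ κ J δ) (w₀ : W) :
    ∃ (w : ℕ → M × EuclideanSpace ℝ (Fin m) → ℂ) (hw : ∀ n, IsCoreFunction b I bc (w n)),
      TendstoH1 g b bc w (J w₀) ∧ Tendsto (fun n => κ ⟨w n, hw n⟩) atTop (𝓝 w₀) := by
  obtain ⟨x, hx, hlim⟩ := mem_closure_iff_seq_limit.1 (h.dense w₀)
  choose u hu using hx
  have hx' : x = fun n => κ (u n) := funext fun n => (hu n).symm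
  rw [hx'] at hlim
  refine ⟨fun n => (u n).1, fun n => (u n).2, ⟨fun n => (u n).2, ?_, ?_⟩, hlim⟩
  · refine (tendsto_coreToL2_iff (hI := hI) (fun n => (u n).2) (J w₀)).1 ?_
    have := (J.continuous.tendsto _).comp hlim
    refine this.congr fun n => ?_
    exact h.embed _
  · intro ε hε
    set S : ℝ := ∑ j, ‖(0 : EuclideanSpace ℂ (Fin m)) j - quasimomentum b ξ 0 j‖ ^ 2
    have hS : 0 ≤ S := Finset.sum_nonneg fun _ _ => sq_nonneg _
    have hη : 0 < ε / (2 + 2 * S) := by positivity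
    obtain ⟨N, hN⟩ := Metric.cauchySeq_iff.1 hlim.cauchySeq _ (Real.sqrt_pos.2 hη)
    refine ⟨N, fun n hn l hl => ?_⟩
    have e1 := hN n hn l hl
    rw [dist_eq_norm, ← map_sub] at e1
    have e3 := freeForm_self_le g b hI (ζ := 0) (by simp) (conj_quasimomentum_zero b ξ) (u n - u l)
    have e4 := h.norm_sq (u n - u l)
    have e5 := (Real.lt_sqrt (norm_nonneg _)).1 e1
    have e7 := freeForm_self_nonneg g b hI (conj_quasimomentum_zero b ξ) (u n - u l).2.1
    have e6 : (2 + 2 * S) * ‖κ (u n - u l)‖ ^ 2 < ε := by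
      have := mul_lt_mul_of_pos_left e5 (by positivity : 0 < 2 + 2 * S)
      refine this.trans_eq ?_
      field_simp
    change (freeForm g b 0 (u n - u l).1 (u n - u l).1).re < _
    rw [e4] at e6
    nlinarith [sq_nonneg ‖coreToL2 g b hI bc (u n - u l)‖]

/-- `twistedForm` extends the form `h((π + iτ) b₁ + ξ)` without potential from the core. -/
theorem IsFormSpace.freeForm_eq_twistedForm (h : IsFormSpace g b hI bc ξ κ J δ) (hb : ‖b 0‖ = 1)
    (hξ : inner ℝ ξ (b 0) = 0) (τ : ℝ) (u v : coreSpace b I M bc) :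
    freeForm g b (quasimomentum b ξ τ) u.1 v.1 = twistedForm J δ τ (κ u) (κ v) := by
  have hu := u.2.1
  have hv := v.2.1
  have cu := hu.continuous
  have cv := hv.continuous
  have cdu := continuous_diffB b hu
  have cdv := continuous_diffB b hv
  have cc := Complex.continuous_conj
  have i1 := integrable_formDensity g b hI (quasimomentum b ξ 0) hu hv
  have i2 : Integrable (fun p => u.1 p * conj (v.1 p)) (cellMeasure g b) :=
    integrable_of_continuous g b hI (by fun_prop)
  have i3 : Integrable (fun p => (diffB b u.1 p + Complex.I * Real.pi * u.1 p) * conj (v.1 p))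
    (cellMeasure g b) := integrable_of_continuous g b hI (by fun_prop)
  have i4 : Integrable (fun p => u.1 p * conj (diffB b v.1 p + Complex.I * Real.pi * v.1 p))
    (cellMeasure g b) := integrable_of_continuous g b hI (by fun_prop)
  have e3 : inner ℂ (J (κ v)) (δ (κ u)) =
      ∫ p, (diffB b u.1 p + Complex.I * Real.pi * u.1 p) * conj (v.1 p) ∂(cellMeasure g b) := by
    rw [h.embed, inner_L2]
    refine integral_congr_ae ?_
    filter_upwards [coeFn_coreToL2 g b hI v, h.deriv u] with p h1 h2
    rw [h1, h2]
  have e4 : inner ℂ (δ (κ v)) (J (κ u)) =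
      ∫ p, u.1 p * conj (diffB b v.1 p + Complex.I * Real.pi * v.1 p) ∂(cellMeasure g b) := by
    rw [h.embed, inner_L2]
    refine integral_congr_ae ?_
    filter_upwards [coeFn_coreToL2 g b hI u, h.deriv v] with p h1 h2
    rw [h1, h2]
  rw [twistedForm, h.inner_eq, e3, e4, h.embed, h.embed, inner_coreToL2, freeForm_eq]
  simp only [formDensity_quasimomentum g b hb hξ τ]
  have e5 := integral_add (i1.sub (i2.const_mul ((τ : ℂ) ^ 2))) ((i3.sub i4).const_mul (τ : ℂ))
  have e6 := integral_sub i1 (i2.const_mul ((τ : ℂ) ^ 2))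
  have e7 := integral_sub i3 i4
  simp only [Pi.sub_apply] at e5
  rw [e5, e6, integral_const_mul, integral_const_mul, e7, freeForm_eq]
  ring

/-- `H(τ) u = f` in terms of the form space. -/
theorem IsFormSpace.isSchrodinger_iff [CompleteSpace W] (h : IsFormSpace g b hI bc ξ κ J δ)
    (hb : ‖b 0‖ = 1) (hξ : inner ℝ ξ (b 0) = 0) (τ : ℝ) (V : M × EuclideanSpace ℝ (Fin m) → ℝ)
    (u f : L2 g b) :
    IsSchrodinger g b bc V (quasimomentum b ξ τ) u f ↔
      ∃ w : W, J w = u ∧ ∀ z : W,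
        Integrable (fun p => (V p : ℂ) * u p * conj (J z p)) (cellMeasure g b) ∧
        twistedForm J δ τ w z + ∫ p, (V p : ℂ) * u p * conj (J z p) ∂(cellMeasure g b) =
          inner ℂ (J z) f := by
  constructor
  · rintro ⟨w, hw, hz⟩
    obtain ⟨w₀, hw₀, hJ⟩ := h.exists_of_tendstoH1 hw
    refine ⟨w₀, hJ, fun z₀ => ?_⟩
    obtain ⟨z, hzc, hzz, hlim⟩ := h.exists_tendstoH1 z₀
    obtain ⟨h1, h2⟩ := hz _ z hzz
    refine ⟨h1, tendsto_nhds_unique ?_ (inner_L2 g b (J z₀) f ▸ h2)⟩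
    have := (tendsto_twistedForm J δ τ hw₀ hlim).add_const
      (∫ p, (V p : ℂ) * u p * conj (J z₀ p) ∂(cellMeasure g b))
    refine this.congr fun n => ?_
    rw [← h.freeForm_eq_twistedForm hb hξ]
  · rintro ⟨w₀, rfl, hz⟩
    obtain ⟨w, hwc, hw, hw₀⟩ := h.exists_tendstoH1 w₀
    refine ⟨w, hw, fun v z hzv => ?_⟩
    obtain ⟨z₀, hlim, rfl⟩ := h.exists_of_tendstoH1 hzv
    refine ⟨(hz z₀).1, ?_⟩
    rw [← inner_L2 g b (J z₀) f, ← (hz z₀).2]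
    have := (tendsto_twistedForm J δ τ hw₀ hlim).add_const
      (∫ p, (V p : ℂ) * (J w₀) p * conj (J z₀ p) ∂(cellMeasure g b))
    refine this.congr fun n => ?_
    rw [← h.freeForm_eq_twistedForm hb hξ]

end FormSpace

/-! ### Translations along the torus -/

section Translations

variable {k m : ℕ} {H : Type*} [TopologicalSpace H]
  {I : ModelWithCorners ℝ (EuclideanSpace ℝ (Fin k)) H}
  {M : Type*} [TopologicalSpace M] [ChartedSpace H M] [IsManifold I ∞ M]
  (g : Metric I M) (b : Module.Basis (Fin m) ℝ (EuclideanSpace ℝ (Fin m)))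

/-- The translate `u(x, y + a)` of a function. -/
def translate {α : Type*} (a : EuclideanSpace ℝ (Fin m)) (u : M × EuclideanSpace ℝ (Fin m) → α)
    (p : M × EuclideanSpace ℝ (Fin m)) : α :=
  u (p.1, p.2 + a)

variable {u v : M × EuclideanSpace ℝ (Fin m) → ℂ}

theorem contMDiff_translate (a : EuclideanSpace ℝ (Fin m))
    (hu : ContMDiff (I.prod 𝓘(ℝ, EuclideanSpace ℝ (Fin m))) 𝓘(ℝ, ℂ) ∞ u) :
    ContMDiff (I.prod 𝓘(ℝ, EuclideanSpace ℝ (Fin m))) 𝓘(ℝ, ℂ) ∞ (translate a u) := by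
  have : ContMDiff 𝓘(ℝ, EuclideanSpace ℝ (Fin m)) 𝓘(ℝ, EuclideanSpace ℝ (Fin m)) ∞
      (fun y : EuclideanSpace ℝ (Fin m) => y + a) :=
    (contDiff_id.add contDiff_const).contMDiff
  exact hu.comp (contMDiff_id.prodMap this)

theorem isCoreFunction_translate (a : EuclideanSpace ℝ (Fin m)) {bc : BoundaryCondition}
    (hu : IsCoreFunction b I bc u) : IsCoreFunction b I bc (translate a u) := by
  refine ⟨contMDiff_translate a hu.1, fun x y j => ?_, ?_⟩
  · simp only [translate]
    rw [add_right_comm, hu.2.1]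
  · cases bc
    · obtain ⟨K, hK, hKi, h⟩ := hu.2.2
      exact ⟨K, hK, hKi, fun x hx y => h x hx _⟩
    · trivial

theorem diffY_translate (a : EuclideanSpace ℝ (Fin m)) (j : Fin m)
    (p : M × EuclideanSpace ℝ (Fin m)) :
    diffY (translate a u) j p = diffY u j (p.1, p.2 + a) := by
  simp only [diffY, translate, fderiv_comp_add_right a (f := fun y => u (p.1, y))]

theorem formDensity_translate (a : EuclideanSpace ℝ (Fin m)) (ζ : EuclideanSpace ℂ (Fin m))
    (p : M × EuclideanSpace ℝ (Fin m)) :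
    formDensity g ζ (translate a u) (translate a v) p = formDensity g ζ u v (p.1, p.2 + a) := by
  simp only [formDensity, diffY_translate]
  rfl

theorem isPeriodic_formDensity (ζ : EuclideanSpace ℂ (Fin m)) (hu : IsPeriodic b u)
    (hv : IsPeriodic b v) : IsPeriodic b (formDensity g ζ u v) := by
  intro x y j
  have hu' : translate (b j) u = u := funext fun p => hu p.1 p.2 j
  have hv' : translate (b j) v = v := funext fun p => hv p.1 p.2 j
  have := formDensity_translate g (u := u) (v := v) (b j) ζ (x, y)
  rw [hu', hv'] at this
  exact this.symm

theorem isPeriodic_span {α : Type*} {F : M × EuclideanSpace ℝ (Fin m) → α} (hF : IsPeriodic b F)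
    {γ : EuclideanSpace ℝ (Fin m)} (hγ : γ ∈ Submodule.span ℤ (range b)) (x : M)
    (y : EuclideanSpace ℝ (Fin m)) : F (x, y + γ) = F (x, y) := by
  induction hγ using Submodule.span_induction generalizing y with
  | mem γ h =>
    obtain ⟨j, rfl⟩ := h
    exact hF x y j
  | zero => rw [add_zero]
  | add γ γ' _ _ h h' => rw [← add_assoc, h', h]
  | smul n γ _ h =>
    have hn : ∀ (n : ℕ) y, F (x, y + n • γ) = F (x, y) := by
      intro n
      induction n with
      | zero => simp
      | succ n ih => intro y; rw [succ_nsmul, ← add_assoc, h, ih]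
    obtain ⟨n, rfl | rfl⟩ := n.eq_nat_or_neg
    · rw [natCast_zsmul, hn]
    · rw [neg_smul, natCast_zsmul]
      have := hn n (y + -(n • γ))
      rw [neg_add_cancel_right] at this
      exact this.symm

open scoped Pointwise in
/-- The integral of a periodic function over a cell is invariant under translations, since a
translate of a fundamental domain is again a fundamental domain. -/
theorem setIntegral_translate {f : EuclideanSpace ℝ (Fin m) → ℂ}
    (hf : ∀ γ ∈ Submodule.span ℤ (range b), ∀ y, f (y + γ) = f y) (a : EuclideanSpace ℝ (Fin m)) :
    ∫ y in ZSpan.fundamentalDomain b, f (y + a) = ∫ y in ZSpan.fundamentalDomain b, f y := by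
  have h1 := ZSpan.isAddFundamentalDomain b (volume : Measure (EuclideanSpace ℝ (Fin m)))
  have h2 := h1.vadd_of_comm a
  have h3 := (measurePreserving_add_right (volume : Measure (EuclideanSpace ℝ (Fin m)))
    a).setIntegral_image_emb (measurableEmbedding_addRight a) f (ZSpan.fundamentalDomain b)
  have h4 : (fun y => y + a) '' ZSpan.fundamentalDomain b = a +ᵥ ZSpan.fundamentalDomain b := by
    ext y
    simp only [mem_image, Set.mem_vadd_set, vadd_eq_add, add_comm]
  have : VAddInvariantMeasure (Submodule.span ℤ (range b)) (EuclideanSpace ℝ (Fin m)) volume :=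
    inferInstanceAs <| VAddInvariantMeasure (Submodule.span ℤ (range b)).toAddSubgroup
      (EuclideanSpace ℝ (Fin m)) volume
  rw [← h3, h4]
  refine h2.setIntegral_eq h1 fun γ y => ?_
  have := hf γ.1 γ.2 y
  rw [add_comm] at this
  exact this

theorem continuous_translate {F : M × EuclideanSpace ℝ (Fin m) → ℂ} (hF : Continuous F)
    (a : EuclideanSpace ℝ (Fin m)) : Continuous (translate a F) :=
  hF.comp (continuous_fst.prodMk (continuous_snd.add continuous_const))

variable [MeasurableSpace M] [BorelSpace M] [CompactSpace M]

theorem integral_translate (hI : IsBoundaryModel I) {F : M × EuclideanSpace ℝ (Fin m) → ℂ}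
    (hF : Continuous F) (hp : IsPeriodic b F) (a : EuclideanSpace ℝ (Fin m)) :
    ∫ p, F (p.1, p.2 + a) ∂(cellMeasure g b) = ∫ p, F p ∂(cellMeasure g b) := by
  have := isFiniteMeasure_riemannianVolume hI g
  have h1 := integrable_of_continuous g b hI hF
  have h2 := integrable_of_continuous g b hI (continuous_translate hF a)
  unfold cellMeasure at h1 h2 ⊢
  rw [integral_prod _ h1]
  refine (integral_prod _ h2).trans ?_
  refine integral_congr_ae (ae_of_all _ fun x => ?_)
  exact setIntegral_translate b (f := fun y => F (x, y))
    (fun γ hγ y => isPeriodic_span b hp hγ x y) a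

/-- Translation along `b 0`, as an operator on the core functions. -/
noncomputable def coreTranslate [NeZero m] (bc : BoundaryCondition) (s : ℝ) :
    coreSpace b I M bc →ₗ[ℂ] coreSpace b I M bc where
  toFun u := ⟨translate (s • b 0) u.1, isCoreFunction_translate b _ u.2⟩
  map_add' _ _ := rfl
  map_smul' _ _ := rfl

omit [MeasurableSpace M] [BorelSpace M] [CompactSpace M] in
theorem coreTranslate_add [NeZero m] (bc : BoundaryCondition) (s t : ℝ) (u : coreSpace b I M bc) :
    coreTranslate b bc (s + t) u = coreTranslate b bc s (coreTranslate b bc t u) := by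
  refine Subtype.ext (funext fun p => ?_)
  change u.1 (p.1, p.2 + (s + t) • b 0) = u.1 (p.1, p.2 + s • b 0 + t • b 0)
  rw [add_smul, add_assoc]

omit [MeasurableSpace M] [BorelSpace M] [CompactSpace M] in
theorem coreTranslate_zero [NeZero m] (bc : BoundaryCondition) (u : coreSpace b I M bc) :
    coreTranslate b bc 0 u = u := by
  refine Subtype.ext (funext fun p => ?_)
  change u.1 (p.1, p.2 + (0 : ℝ) • b 0) = u.1 p
  rw [zero_smul, add_zero]

omit [MeasurableSpace M] [BorelSpace M] [CompactSpace M] in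
theorem coreTranslate_one [NeZero m] (bc : BoundaryCondition) (u : coreSpace b I M bc) :
    coreTranslate b bc 1 u = u := by
  refine Subtype.ext (funext fun p => ?_)
  change u.1 (p.1, p.2 + (1 : ℝ) • b 0) = u.1 p
  rw [one_smul]
  exact u.2.2.1 p.1 p.2 0

theorem inner_coreToL2_translate [NeZero m] (hI : IsBoundaryModel I) {bc : BoundaryCondition}
    (s : ℝ) (u v : coreSpace b I M bc) :
    inner ℂ (coreToL2 g b hI bc (coreTranslate b bc s u))
      (coreToL2 g b hI bc (coreTranslate b bc s v)) =
      inner ℂ (coreToL2 g b hI bc u) (coreToL2 g b hI bc v) := by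
  rw [inner_coreToL2, inner_coreToL2]
  refine integral_translate g b hI (F := fun p => v.1 p * conj (u.1 p))
    (v.2.1.continuous.mul (Complex.continuous_conj.comp u.2.1.continuous)) ?_ _
  intro x y j
  simp only [u.2.2.1 x y j, v.2.2.1 x y j]

theorem freeForm_translate [NeZero m] (hI : IsBoundaryModel I) {bc : BoundaryCondition}
    (ζ : EuclideanSpace ℂ (Fin m)) (s : ℝ) (u v : coreSpace b I M bc) :
    freeForm g b ζ (coreTranslate b bc s u).1 (coreTranslate b bc s v).1 =
      freeForm g b ζ u.1 v.1 := by
  rw [freeForm_eq, freeForm_eq, ← integral_translate g b hI (continuous_formDensity g ζ u.2.1 v.2.1)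
    (isPeriodic_formDensity g b ζ u.2.2.1 v.2.2.1) (s • b 0)]
  simp only [← formDensity_translate]
  rfl

omit [MeasurableSpace M] [BorelSpace M] [CompactSpace M] in
theorem hasDerivAt_translate [NeZero m]
    (hu : ContMDiff (I.prod 𝓘(ℝ, EuclideanSpace ℝ (Fin m))) 𝓘(ℝ, ℂ) ∞ u)
    (p : M × EuclideanSpace ℝ (Fin m)) (s : ℝ) :
    HasDerivAt (fun s : ℝ => u (p.1, p.2 + s • b 0)) (diffB b u (p.1, p.2 + s • b 0)) s := by
  have h1 : HasDerivAt (fun s : ℝ => p.2 + s • b 0) (b 0) s := by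
    simpa using ((hasDerivAt_id s).smul_const (b 0)).const_add p.2
  exact (differentiableAt_snd hu (p.1, p.2 + s • b 0)).hasFDerivAt.comp_hasDerivAt s h1

/-- Differentiation of an integral with respect to a translation. -/
theorem hasDerivAt_integral_translate [NeZero m] (hI : IsBoundaryModel I)
    (hu : ContMDiff (I.prod 𝓘(ℝ, EuclideanSpace ℝ (Fin m))) 𝓘(ℝ, ℂ) ∞ u)
    {h : M × EuclideanSpace ℝ (Fin m) → ℂ} (hh : Integrable h (cellMeasure g b)) :
    HasDerivAt (fun s : ℝ => ∫ p, u (p.1, p.2 + s • b 0) * h p ∂(cellMeasure g b))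
      (∫ p, diffB b u p * h p ∂(cellMeasure g b)) 0 := by
  have := secondCountableTopology I M
  obtain ⟨C, hC⟩ := exists_bound_of_continuous (continuous_diffB b hu)
    ((ZSpan.fundamentalDomain_isBounded b).cthickening (δ := ‖b 0‖))
  obtain ⟨C', hC'⟩ := exists_bound_of_continuous hu.continuous
    (ZSpan.fundamentalDomain_isBounded b)
  have key := hasDerivAt_integral_of_dominated_loc_of_deriv_le
    (μ := cellMeasure g b) (F := fun (s : ℝ) p => u (p.1, p.2 + s • b 0) * h p)
    (F' := fun (s : ℝ) p => diffB b u (p.1, p.2 + s • b 0) * h p) (x₀ := (0 : ℝ))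
    (s := Metric.ball 0 1) (bound := fun p => C * ‖h p‖) (Metric.ball_mem_nhds _ one_pos)
    (Eventually.of_forall fun s =>
      (continuous_translate hu.continuous (s • b 0)).aestronglyMeasurable.mul hh.1)
    ?_ (((continuous_translate (continuous_diffB b hu) ((0 : ℝ) • b 0)).aestronglyMeasurable).mul
      hh.1) ?_ (hh.norm.const_mul C) ?_
  · simpa using key.2
  · simp only [zero_smul, add_zero]
    refine hh.bdd_mul hu.continuous.aestronglyMeasurable (c := C') ?_
    filter_upwards [ae_mem_fundamentalDomain g b hI] with p hp using hC' p hp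
  · filter_upwards [ae_mem_fundamentalDomain g b hI] with p hp s hs
    rw [norm_mul]
    refine mul_le_mul_of_nonneg_right (hC (p.1, p.2 + s • b 0)
      (Metric.mem_cthickening_of_dist_le _ p.2 _ _ hp ?_)) (norm_nonneg _)
    rw [dist_eq_norm, add_sub_cancel_left, norm_smul]
    rw [mem_ball_zero_iff] at hs
    exact mul_le_of_le_one_left (norm_nonneg _) hs.le
  · exact ae_of_all _ fun p s _ => (hasDerivAt_translate b hu p s).mul_const _

/-- The integral of a derivative of a periodic function vanishes. -/
theorem integral_diffB [NeZero m] (hI : IsBoundaryModel I)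
    (hu : ContMDiff (I.prod 𝓘(ℝ, EuclideanSpace ℝ (Fin m))) 𝓘(ℝ, ℂ) ∞ u) (hp : IsPeriodic b u) :
    ∫ p, diffB b u p ∂(cellMeasure g b) = 0 := by
  have := isFiniteMeasure_cellMeasure g b hI
  have h1 := hasDerivAt_integral_translate g b hI hu (integrable_const (1 : ℂ))
  simp only [mul_one, integral_translate g b hI hu.continuous hp] at h1
  exact h1.unique (hasDerivAt_const _ _)

/-- Integration by parts in the direction of `b 0`. -/
theorem integral_diffB_mul_conj [NeZero m] (hI : IsBoundaryModel I) {bc : BoundaryCondition}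
    (u v : coreSpace b I M bc) :
    ∫ p, (diffB b u.1 p * conj (v.1 p) + u.1 p * conj (diffB b v.1 p)) ∂(cellMeasure g b) = 0 := by
  have hs : ContMDiff (I.prod 𝓘(ℝ, EuclideanSpace ℝ (Fin m))) 𝓘(ℝ, ℂ) ∞
      (fun p => u.1 p * conj (v.1 p)) := by
    have h : ContDiff ℝ ∞ (fun z : ℂ × ℂ => z.1 * conj z.2) :=
      _root_.contDiff_fst.mul
        (Complex.conjCLE.toContinuousLinearMap.contDiff.comp _root_.contDiff_snd)
    exact h.contMDiff.comp (u.2.1.prodMk_space v.2.1)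
  rw [← integral_diffB g b hI hs fun x y j => by simp only [u.2.2.1 x y j, v.2.2.1 x y j]]
  refine integral_congr_ae (ae_of_all _ fun p => ?_)
  have h1 := hasDerivAt_translate b u.2.1 p 0
  have h2 := hasDerivAt_translate b v.2.1 p 0
  have h3 := h1.mul h2.star
  have h4 := h3.unique (hasDerivAt_translate b hs p 0)
  simpa using h4

section FormSpace

variable {g b} [NeZero m] {hI : IsBoundaryModel I}
  {bc : BoundaryCondition} {ξ : EuclideanSpace ℝ (Fin m)} {W : Type*} [NormedAddCommGroup W]
  [InnerProductSpace ℂ W] {κ : coreSpace b I M bc →ₗ[ℂ] W} {J δ : W →L[ℂ] L2 g b}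

theorem IsFormSpace.inner_translate (h : IsFormSpace g b hI bc ξ κ J δ) (s : ℝ)
    (u v : coreSpace b I M bc) :
    inner ℂ (κ (coreTranslate b bc s u)) (κ (coreTranslate b bc s v)) = inner ℂ (κ u) (κ v) := by
  rw [h.inner_eq, h.inner_eq, inner_coreToL2_translate, freeForm_translate g b hI]

/-- The generator of the translations is `∂ = δ - iπ`, in the weak sense. -/
theorem IsFormSpace.hasDerivAt_translate (h : IsFormSpace g b hI bc ξ κ J δ) (f : L2 g b)
    (u : coreSpace b I M bc) :
    HasDerivAt (fun s : ℝ => inner ℂ f (coreToL2 g b hI bc (coreTranslate b bc s u)))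
      (inner ℂ f (δ (κ u) - (Complex.I * Real.pi) • J (κ u))) 0 := by
  have := isFiniteMeasure_cellMeasure g b hI
  have hf : Integrable (fun p => conj (f p)) (cellMeasure g b) := by
    have h1 : Integrable f (cellMeasure g b) := (Lp.memLp f).integrable (by norm_num)
    exact (Complex.conjCLE.toContinuousLinearMap).integrable_comp h1
  have h1 := hasDerivAt_integral_translate g b hI u.2.1 hf
  have e1 : inner ℂ f (δ (κ u) - (Complex.I * Real.pi) • J (κ u)) =
      ∫ p, diffB b u.1 p * conj (f p) ∂(cellMeasure g b) := by
    rw [inner_L2, h.embed]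
    refine integral_congr_ae ?_
    filter_upwards [Lp.coeFn_sub (δ (κ u)) ((Complex.I * Real.pi) • coreToL2 g b hI bc u),
      Lp.coeFn_smul (Complex.I * Real.pi : ℂ) (coreToL2 g b hI bc u), h.deriv u,
      coeFn_coreToL2 g b hI u] with p h1 h2 h3 h4
    rw [h1, Pi.sub_apply, h2, Pi.smul_apply, h3, h4, smul_eq_mul, add_sub_cancel_right]
  rw [e1]
  refine h1.congr_of_eventuallyEq (Eventually.of_forall fun s => ?_)
  simp only [inner_L2]
  refine integral_congr_ae ?_
  filter_upwards [coeFn_coreToL2 g b hI (coreTranslate b bc s u)] with p hp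
  rw [hp]
  rfl

/-- The derivative along `b 0` is skew-symmetric. -/
theorem IsFormSpace.inner_deriv (h : IsFormSpace g b hI bc ξ κ J δ) (w z : W) :
    inner ℂ (J z) (δ w) = - inner ℂ (δ z) (J w) := by
  have hc (F G : W → ℂ) (hF : Continuous F) (hG : Continuous G) (hh : ∀ u, F (κ u) = G (κ u)) :
      ∀ w, F w = G w :=
    fun w => h.dense.induction_on w (isClosed_eq hF hG) hh
  revert w
  refine hc _ _ (by fun_prop) (by fun_prop) fun u => ?_
  revert z
  refine hc _ _ (by fun_prop) (by fun_prop) fun v => ?_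
  have cu := u.2.1.continuous
  have cv := v.2.1.continuous
  have cdu := continuous_diffB b u.2.1
  have cdv := continuous_diffB b v.2.1
  have cc := Complex.continuous_conj
  have e3 : inner ℂ (J (κ v)) (δ (κ u)) =
      ∫ p, (diffB b u.1 p + Complex.I * Real.pi * u.1 p) * conj (v.1 p) ∂(cellMeasure g b) := by
    rw [h.embed, inner_L2]
    refine integral_congr_ae ?_
    filter_upwards [coeFn_coreToL2 g b hI v, h.deriv u] with p h1 h2
    rw [h1, h2]
  have e4 : inner ℂ (δ (κ v)) (J (κ u)) =
      ∫ p, u.1 p * conj (diffB b v.1 p + Complex.I * Real.pi * v.1 p) ∂(cellMeasure g b) := by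
    rw [h.embed, inner_L2]
    refine integral_congr_ae ?_
    filter_upwards [coeFn_coreToL2 g b hI u, h.deriv v] with p h1 h2
    rw [h1, h2]
  have i3 : Integrable (fun p => (diffB b u.1 p + Complex.I * Real.pi * u.1 p) * conj (v.1 p))
    (cellMeasure g b) := integrable_of_continuous g b hI (by fun_prop)
  have i4 : Integrable (fun p => u.1 p * conj (diffB b v.1 p + Complex.I * Real.pi * v.1 p))
    (cellMeasure g b) := integrable_of_continuous g b hI (by fun_prop)
  rw [e3, e4, eq_neg_iff_add_eq_zero, ← integral_add i3 i4, ← integral_diffB_mul_conj g b hI u v]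
  refine integral_congr_ae (ae_of_all _ fun p => ?_)
  simp only [map_add, map_mul, Complex.conj_I, Complex.conj_ofReal]
  ring

end FormSpace

end Translations

/-! ### Density of the core functions -/

section Density

variable {k m : ℕ} {H : Type*} [TopologicalSpace H]
  {I : ModelWithCorners ℝ (EuclideanSpace ℝ (Fin k)) H}
  {M : Type*} [TopologicalSpace M] [ChartedSpace H M] [IsManifold I ∞ M]
  (g : Metric I M) (b : Module.Basis (Fin m) ℝ (EuclideanSpace ℝ (Fin m)))

/-- The periodic extension in `y` of the restriction of a function to the elementary cell. -/
noncomputable def periodize (φ : M × EuclideanSpace ℝ (Fin m) → ℝ)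
    (p : M × EuclideanSpace ℝ (Fin m)) : ℂ :=
  φ (p.1, ZSpan.fract b p.2)

theorem isPeriodic_periodize (φ : M × EuclideanSpace ℝ (Fin m) → ℝ) :
    IsPeriodic b (periodize b φ) := by
  intro x y j
  simp only [periodize]
  rw [ZSpan.fract_add_ZSpan b y (Submodule.subset_span (mem_range_self j))]

/-- Near every point, the periodic extension is a finite sum of translates. -/
theorem contMDiff_periodize {φ : M × EuclideanSpace ℝ (Fin m) → ℝ}
    (hφ : ContMDiff (I.prod 𝓘(ℝ, EuclideanSpace ℝ (Fin m))) 𝓘(ℝ, ℝ) ∞ φ)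
    (hs : ∀ p, φ p ≠ 0 → p.2 ∈ ZSpan.fundamentalDomain b) :
    ContMDiff (I.prod 𝓘(ℝ, EuclideanSpace ℝ (Fin m))) 𝓘(ℝ, ℂ) ∞ (periodize b φ) := by
  intro p₀
  obtain ⟨R, hR⟩ := (ZSpan.fundamentalDomain_isBounded b).subset_closedBall 0
  have hfin := ZSpan.setFinite_inter b
    (Metric.isBounded_closedBall (x := (0 : EuclideanSpace ℝ (Fin m))) (r := ‖p₀.2‖ + 1 + R))
  have hsum : ContMDiff (I.prod 𝓘(ℝ, EuclideanSpace ℝ (Fin m))) 𝓘(ℝ, ℂ) ∞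
      (fun p : M × EuclideanSpace ℝ (Fin m) =>
        ∑ γ ∈ hfin.toFinset, ((φ (p.1, p.2 - γ) : ℝ) : ℂ)) := by
    refine contMDiff_finsetSum fun γ _ => ?_
    have h1 : ContMDiff 𝓘(ℝ, EuclideanSpace ℝ (Fin m)) 𝓘(ℝ, EuclideanSpace ℝ (Fin m)) ∞
      (fun y : EuclideanSpace ℝ (Fin m) => y - γ) := (contDiff_id.sub contDiff_const).contMDiff
    exact Complex.ofRealCLM.contMDiff.comp (hφ.comp (contMDiff_id.prodMap h1))
  refine (hsum p₀).congr_of_eventuallyEq ?_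
  have hn : {p : M × EuclideanSpace ℝ (Fin m) | p.2 ∈ Metric.ball p₀.2 1} ∈ 𝓝 p₀ :=
    continuous_snd.continuousAt.preimage_mem_nhds (Metric.ball_mem_nhds _ one_pos)
  filter_upwards [hn] with p hp
  have hfr := ZSpan.fract_mem_fundamentalDomain b p.2
  refine (Finset.sum_eq_single (f := fun γ => ((φ (p.1, p.2 - γ) : ℝ) : ℂ))
    (ZSpan.floor b p.2 : EuclideanSpace ℝ (Fin m)) ?_ ?_).symm
  · intro γ hγ hne
    rw [Finite.mem_toFinset] at hγ
    rw [Complex.ofReal_eq_zero]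
    by_contra h0
    -- the translates of the elementary cell by different lattice vectors are disjoint
    have h1 := hs _ h0
    rw [← ZSpan.fract_eq_self] at h1
    have h2 : ZSpan.fract b (p.2 - γ) = ZSpan.fract b p.2 := by
      rw [sub_eq_add_neg]
      exact ZSpan.fract_add_ZSpan b _ (Submodule.neg_mem _ hγ.2)
    rw [h2, ZSpan.fract_apply] at h1
    exact hne (sub_right_injective h1).symm
  · intro h
    refine absurd ?_ h
    rw [Finite.mem_toFinset]
    refine ⟨?_, (ZSpan.floor b p.2).2⟩
    have h1 : (ZSpan.floor b p.2 : EuclideanSpace ℝ (Fin m)) = p.2 - ZSpan.fract b p.2 := by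
      rw [ZSpan.fract_apply]; abel
    have h2 := hR hfr
    rw [mem_closedBall_zero_iff] at h2 ⊢
    have h3 : ‖p.2 - p₀.2‖ < 1 := by simpa [dist_eq_norm] using hp
    have h4 : p.2 - ZSpan.fract b p.2 = p₀.2 + (p.2 - p₀.2) - ZSpan.fract b p.2 := by abel
    rw [h1, h4]
    exact (norm_sub_le _ _).trans (add_le_add ((norm_add_le _ _).trans
      (add_le_add le_rfl h3.le)) h2)

variable [MeasurableSpace M] [BorelSpace M] [CompactSpace M]

/-- Almost every point of `M × Ω` is an interior point. -/
theorem ae_mem_interior (hI : IsBoundaryModel I) :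
    ∀ᵐ p ∂(cellMeasure g b), p ∈ I.interior M ×ˢ interior (ZSpan.fundamentalDomain b) := by
  have := isFiniteMeasure_riemannianVolume hI g
  have h1 : ∀ᵐ x ∂(riemannianVolume g), x ∈ I.interior M := by
    have := measure_eq_zero_iff_ae_notMem.1 (riemannianVolume_boundary hI g)
    filter_upwards [this] with x hx
    rwa [← I.compl_boundary]
  have h2 : ∀ᵐ y ∂(volume.restrict (ZSpan.fundamentalDomain b)),
      y ∈ interior (ZSpan.fundamentalDomain b) := by
    have h3 := measure_eq_zero_iff_ae_notMem.1
      ((convex_fundamentalDomain b).addHaar_frontier volume)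
    filter_upwards [ae_restrict_mem (ZSpan.fundamentalDomain_measurableSet b),
      ae_restrict_of_ae h3] with y hy hy'
    rw [← self_sdiff_frontier]
    exact ⟨hy, hy'⟩
  filter_upwards [Measure.quasiMeasurePreserving_fst.ae h1,
    Measure.quasiMeasurePreserving_snd.ae h2] with p h h' using ⟨h, h'⟩

/-- The core functions are dense in `L₂`: among them are the periodic extensions of test functions
supported in the interior of `M × Ω`, which has full measure. -/
theorem denseRange_coreToL2 [T2Space M] (hI : IsBoundaryModel I) (bc : BoundaryCondition) :
    DenseRange (coreToL2 g b hI bc) := by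
  have := isFiniteMeasure_cellMeasure g b hI
  have := secondCountableTopology I M
  have hd : (LinearMap.range (coreToL2 g b hI bc)).topologicalClosure = ⊤ := by
    rw [Submodule.topologicalClosure_eq_top_iff, Submodule.eq_bot_iff]
    intro f hf
    rw [Submodule.mem_orthogonal] at hf
    have hU : IsOpen (I.interior M ×ˢ interior (ZSpan.fundamentalDomain b)) :=
      (I.isOpen_interior (n := ∞) (by simp)).prod isOpen_interior
    have hint : Integrable f (cellMeasure g b) := (Lp.memLp f).integrable (by norm_num)
    have key := hU.ae_eq_zero_of_integral_contMDiff_smul_eq_zero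
      (I.prod 𝓘(ℝ, EuclideanSpace ℝ (Fin m))) (hint.locallyIntegrable.locallyIntegrableOn _) ?_
    · refine Lp.ext ?_
      filter_upwards [key, ae_mem_interior g b hI, Lp.coeFn_zero ℂ 2 (cellMeasure g b)]
        with p h1 h2 h3
      rw [h1 h2, h3]
      rfl
    · intro φ hφ hc hsub
      have hcore : IsCoreFunction b I bc (periodize b φ) := by
        refine ⟨contMDiff_periodize b hφ fun p hp => ?_, isPeriodic_periodize b φ, ?_⟩
        · exact interior_subset (hsub (subset_tsupport φ hp)).2
        · cases bc
          · refine ⟨Prod.fst '' tsupport φ, hc.isCompact.image continuous_fst, ?_, fun x hx y => ?_⟩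
            · rintro _ ⟨p, hp, rfl⟩
              exact (hsub hp).1
            · simp only [periodize]
              rw [Complex.ofReal_eq_zero]
              by_contra h0
              exact hx ⟨_, subset_tsupport φ h0, rfl⟩
          · trivial
      rw [← hf _ ⟨⟨_, hcore⟩, rfl⟩, inner_L2]
      refine integral_congr_ae ?_
      filter_upwards [coeFn_coreToL2 g b hI (⟨_, hcore⟩ : coreSpace b I M bc),
        ae_mem_fundamentalDomain g b hI] with p h1 h2
      rw [h1]
      simp only [periodize]
      rw [ZSpan.fract_eq_self.2 h2, Complex.conj_ofReal, Complex.real_smul, mul_comm]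
  intro f
  have := Submodule.mem_top (R := ℂ) (x := f)
  rw [← hd] at this
  exact this

end Density

/-! ### Joint diagonalization of the form and of the translations -/

section JointDiagonalization

variable {D W 𝓗 : Type*} [AddCommGroup D] [Module ℂ D]
  [NormedAddCommGroup W] [InnerProductSpace ℂ W] [CompleteSpace W]
  [NormedAddCommGroup 𝓗] [InnerProductSpace ℂ 𝓗] [CompleteSpace 𝓗]

/-- A one-parameter family `U` of translations with period `1`, defined on a space `D` which is
dense in `W` and in `𝓗`, and isometric for both inner products. `P : W → 𝓗` is its generator. -/
structure IsTranslationFamily (κ : D →ₗ[ℂ] W) (J P : W →L[ℂ] 𝓗) (U : ℝ → D →ₗ[ℂ] D) : Prop where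
  dense : DenseRange κ
  dense_embed : DenseRange fun u => J (κ u)
  add : ∀ s t u, U (s + t) u = U s (U t u)
  zero : ∀ u, U 0 u = u
  one : ∀ u, U 1 u = u
  inner_form : ∀ s u v, inner ℂ (κ (U s u)) (κ (U s v)) = inner ℂ (κ u) (κ v)
  inner_embed : ∀ s u v, inner ℂ (J (κ (U s u))) (J (κ (U s v))) = inner ℂ (J (κ u)) (J (κ v))
  hasDerivAt : ∀ f u, HasDerivAt (fun s : ℝ => inner ℂ f (J (κ (U s u)))) (inner ℂ f (P (κ u))) 0
  skew : ∀ w z, inner ℂ (J z) (P w) = - inner ℂ (P z) (J w)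

namespace IsTranslationFamily

variable {κ : D →ₗ[ℂ] W} {J P : W →L[ℂ] 𝓗} {U : ℝ → D →ₗ[ℂ] D}
  (h : IsTranslationFamily κ J P U)

include h

/-- Weak differentiability at an arbitrary time, from that at time zero and the group law. -/
theorem hasDerivAt_inner (w : W) (u : D) (s : ℝ) :
    HasDerivAt (fun s : ℝ => inner ℂ (J w) (J (κ (U s u))))
      (- inner ℂ (P w) (J (κ (U s u)))) s := by
  have h1 := h.hasDerivAt (J w) (U s u)
  rw [h.skew] at h1
  have h2 : HasDerivAt (fun t : ℝ => t - s) 1 s := (hasDerivAt_id s).sub_const s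
  have h3 := HasDerivAt.scomp_of_eq s h1 h2 (sub_self s).symm
  rw [one_smul] at h3
  refine h3.congr_of_eventuallyEq (Eventually.of_forall fun t => ?_)
  simp only [Function.comp, ← h.add, sub_add_cancel]

theorem norm_embed (s : ℝ) (u : D) : ‖J (κ (U s u))‖ = ‖J (κ u)‖ := by
  rw [@norm_eq_sqrt_re_inner ℂ, h.inner_embed, ← @norm_eq_sqrt_re_inner ℂ]

theorem norm_form (s : ℝ) (u : D) : ‖κ (U s u)‖ = ‖κ u‖ := by
  rw [@norm_eq_sqrt_re_inner ℂ, h.inner_form, ← @norm_eq_sqrt_re_inner ℂ]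

theorem norm_inner_sub_le (w : W) (u : D) (s : ℝ) :
    ‖inner ℂ (J w) (J (κ (U s u)) - J (κ u))‖ ≤ ‖P w‖ * ‖J (κ u)‖ * |s| := by
  have := (convex_univ (𝕜 := ℝ) (E := ℝ)).norm_image_sub_le_of_norm_hasDerivWithin_le
    (f := fun s : ℝ => (inner ℂ (J w) (J (κ (U s u))) : ℂ))
    (f' := fun s => - inner ℂ (P w) (J (κ (U s u)))) (C := ‖P w‖ * ‖J (κ u)‖)
    (fun t _ => (h.hasDerivAt_inner w u t).hasDerivWithinAt)
    (fun t _ => by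
      rw [norm_neg, ← h.norm_embed t u]
      exact norm_inner_le_norm _ _) (mem_univ 0) (mem_univ s)
  simpa [h.zero, inner_sub_right] using this

/-- The translations extend to operators on `𝓗`, and the extensions commute with `J J†` because they
are unitary both in `W` and in `𝓗`. -/
theorem exists_extension (s : ℝ) : ∃ A : 𝓗 →L[ℂ] 𝓗, (∀ u, A (J (κ u)) = J (κ (U s u))) ∧
    ∀ f, A (J (J.adjoint f)) = J (J.adjoint (A f)) := by
  have hA : DenseRange (J.toLinearMap ∘ₗ κ) := h.dense_embed
  let A : 𝓗 →L[ℂ] 𝓗 := (J.toLinearMap ∘ₗ κ ∘ₗ U s).extendOfNorm (J.toLinearMap ∘ₗ κ)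
  have hA1 : ∀ u, A (J (κ u)) = J (κ (U s u)) := fun u =>
    LinearMap.extendOfNorm_eq (f := J.toLinearMap ∘ₗ κ ∘ₗ U s) hA
      ⟨1, fun u => by rw [one_mul]; exact (h.norm_embed s u).le⟩ u
  let B : W →L[ℂ] W := (κ ∘ₗ U s).extendOfNorm κ
  have hB1 : ∀ u, B (κ u) = κ (U s u) := fun u =>
    LinearMap.extendOfNorm_eq (f := κ ∘ₗ U s) h.dense
      ⟨1, fun u => by rw [one_mul]; exact (h.norm_form s u).le⟩ u
  have hJ : ∀ w, J (B w) = A (J w) := fun w =>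
    h.dense.induction_on w (isClosed_eq (by fun_prop) (by fun_prop)) fun u => by rw [hB1, hA1]
  have hU (u) : U s (U (-s) u) = u := by rw [← h.add, add_neg_cancel, h.zero]
  have hB2 : ∀ v w, inner ℂ (κ v) (B w) = inner ℂ (κ (U (-s) v)) w := fun v w =>
    h.dense.induction_on w (isClosed_eq (by fun_prop) (by fun_prop)) fun u => by
      rw [hB1, ← h.inner_form s (U (-s) v) u, hU]
  have hA2 : ∀ v f, inner ℂ (J (κ v)) (A f) = inner ℂ (J (κ (U (-s) v))) f := fun v f =>
    h.dense_embed.induction_on f (isClosed_eq (by fun_prop) (by fun_prop)) fun u => by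
      rw [hA1, ← h.inner_embed s (U (-s) v) u, hU]
  refine ⟨A, hA1, fun f => ?_⟩
  rw [← hJ]
  congr 1
  refine h.dense.eq_of_inner_right ℂ fun v => ?_
  rw [hB2, ContinuousLinearMap.adjoint_inner_right, ContinuousLinearMap.adjoint_inner_right, hA2]

/-- The generator commutes with `J J†`, since the translations do. -/
theorem generator_comm (f : 𝓗) :
    P (J.adjoint (J (J.adjoint f))) = J (J.adjoint (P (J.adjoint f))) := by
  choose A hA1 hA2 using h.exists_extension
  -- weak differentiability of the extended translations, at an arbitrary vector
  have hlip : ∀ w s f, ‖inner ℂ (J w) (A s f - f)‖ ≤ ‖P w‖ * ‖f‖ * |s| := fun w s f =>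
    h.dense_embed.induction_on f (isClosed_le (by fun_prop) (by fun_prop)) fun u => by
      rw [hA1]; exact h.norm_inner_sub_le w u s
  have hder : ∀ w f, HasDerivAt (fun s => inner ℂ (J w) (A s f)) (- inner ℂ (P w) f) 0 := by
    intro w f
    rw [hasDerivAt_iff_isLittleO, Asymptotics.isLittleO_iff]
    intro c hc
    have hA0 : ∀ f, A 0 f = f := fun f =>
      h.dense_embed.induction_on f (isClosed_eq (by fun_prop) (by fun_prop)) fun u => by
        rw [hA1, h.zero]
    obtain ⟨_, ⟨u, rfl⟩, hu⟩ := Metric.mem_closure_iff.1 (h.dense_embed f)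
      (c / (4 * (‖P w‖ + 1))) (by positivity)
    have h1 := h.hasDerivAt_inner w u 0
    rw [hasDerivAt_iff_isLittleO, Asymptotics.isLittleO_iff] at h1
    filter_upwards [h1 (c := c / 2) (by positivity)] with s hs
    simp only [sub_zero, hA0, h.zero] at hs ⊢
    set r := f - J (κ u)
    have hr : ‖P w‖ * ‖r‖ ≤ c / 4 := by
      rw [dist_eq_norm] at hu
      calc ‖P w‖ * ‖r‖ ≤ (‖P w‖ + 1) * (c / (4 * (‖P w‖ + 1))) :=
            mul_le_mul (by linarith) hu.le (norm_nonneg _) (by positivity)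
        _ = c / 4 := by field_simp
    have hf : f = J (κ u) + r := by simp [r]
    have e : inner ℂ (J w) (A s f) - inner ℂ (J w) f - s • (- inner ℂ (P w) f) =
        (inner ℂ (J w) (J (κ (U s u))) - inner ℂ (J w) (J (κ u)) -
          s • (- inner ℂ (P w) (J (κ u)))) + inner ℂ (J w) (A s r - r) +
          s • inner ℂ (P w) r := by
      rw [hf, map_add, hA1]
      simp only [inner_add_right, inner_sub_right, smul_neg, smul_add]
      ring
    rw [e]
    have h2 := hlip w s r
    have h3 : ‖s • (inner ℂ (P w) r : ℂ)‖ ≤ |s| * (c / 4) := by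
      rw [norm_smul, Real.norm_eq_abs]
      exact mul_le_mul_of_nonneg_left ((norm_inner_le_norm _ _).trans hr) (abs_nonneg _)
    have h4 : ‖P w‖ * ‖r‖ * |s| ≤ c / 4 * |s| := mul_le_mul_of_nonneg_right hr (abs_nonneg _)
    rw [Real.norm_eq_abs] at hs ⊢
    refine (norm_add_le _ _).trans ((add_le_add (norm_add_le _ _) h3).trans ?_)
    linarith
  -- compare the derivatives at zero of `⟪J J† J J† f, A s y⟫ = ⟪J J† f, A s (J J† y)⟫`
  refine ext_inner_right ℂ fun y => ?_
  have h1 := hder (J.adjoint (J (J.adjoint f))) y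
  have h2 := hder (J.adjoint f) (J (J.adjoint y))
  have hT : ∀ x y, inner ℂ (J (J.adjoint x)) y = inner ℂ x (J (J.adjoint y)) := fun x y => by
    rw [← ContinuousLinearMap.adjoint_inner_right, ContinuousLinearMap.adjoint_inner_left]
  have h3 := h1.unique (h2.congr_of_eventuallyEq (Eventually.of_forall fun s => by
    simp only []
    rw [hT, hA2]))
  rw [hT, ← neg_inj, h3]

/-- On an eigenspace of `J J†` the generator is skew-symmetric. -/
theorem generator_skew {μ : ℂ} (hμ : μ ≠ 0) (hμ' : conj μ = μ) {x y : 𝓗}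
    (hx : J (J.adjoint x) = μ • x) (hy : J (J.adjoint y) = μ • y) :
    inner ℂ (P (J.adjoint x)) y = - inner ℂ x (P (J.adjoint y)) := by
  have h1 := h.skew (J.adjoint y) (J.adjoint x)
  rw [hx, hy, inner_smul_left, inner_smul_right, hμ', eq_neg_iff_add_eq_zero, ← mul_add,
    mul_eq_zero] at h1
  rw [eq_neg_iff_add_eq_zero, add_comm]
  exact h1.resolve_left hμ

/-- An eigenvector of the generator has an eigenvalue in `2πiℤ`, by periodicity. -/
theorem exists_int_of_eigenvector {w : W} (hw : J w ≠ 0) {c : ℂ} (hc : P w = c • J w) :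
    ∃ n : ℤ, c = 2 * Real.pi * Complex.I * n := by
  obtain ⟨u, hu⟩ : ∃ u, inner ℂ (J w) (J (κ u)) ≠ 0 := by
    by_contra! h0
    refine hw (h.dense_embed.eq_of_inner_left ℂ fun u => ?_)
    rw [h0, inner_zero_left]
  -- `⟪J w, U s u⟫ exp (c̄ s)` does not depend on `s`; compare `s = 1` with `s = 0`
  have h1 : ∀ s : ℝ, HasDerivAt (fun s : ℝ => inner ℂ (J w) (J (κ (U s u))) *
      Complex.exp (conj c * s)) 0 s := by
    intro s
    have h2 := h.hasDerivAt_inner w u s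
    have h3 : HasDerivAt (fun s : ℝ => Complex.exp (conj c * s))
        (Complex.exp (conj c * s) * (conj c * 1)) s :=
      ((Complex.ofRealCLM.hasDerivAt (x := s)).const_mul (conj c)).cexp
    have h4 := h2.mul h3
    rw [hc, inner_smul_left] at h4
    exact h4.congr_deriv (by ring)
  have h2 := is_const_of_deriv_eq_zero (fun s => (h1 s).differentiableAt)
    (fun s => (h1 s).deriv) 1 0
  simp only [h.one, h.zero, Complex.ofReal_one, mul_one, Complex.ofReal_zero, mul_zero,
    Complex.exp_zero] at h2
  have h3 : Complex.exp (conj c) = 1 := mul_left_cancel₀ hu (by rw [h2, mul_one])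
  obtain ⟨n, hn⟩ := Complex.exp_eq_one_iff.1 h3
  refine ⟨-n, ?_⟩
  have h2 : conj (2 : ℂ) = 2 := Complex.conj_ofReal 2
  rw [← Complex.conj_conj c, hn]
  simp only [map_mul, Complex.conj_ofReal, Complex.conj_I, h2, map_intCast, Int.cast_neg]
  ring

/-- There is an orthonormal basis of common eigenvectors of the form and of the generator, if
`J` is compact. It consists of eigenvectors of the compact operator `J J†`; an eigenvalue `μ` of
`J J†` gives the eigenvalue `a = μ⁻¹ - 1` of the form, because the norm of `W` includes that
of `𝓗`. -/
theorem exists_hilbertBasis (hJ : IsCompactOperator J) (hJ1 : ∀ w, ‖J w‖ ≤ ‖w‖) :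
    ∃ (ι : Type) (e : HilbertBasis ι ℂ 𝓗) (w : ι → W) (a : ι → ℝ) (n : ι → ℤ),
      (∀ i, 0 ≤ a i) ∧ (∀ i, J (w i) = e i) ∧
      (∀ i z, inner ℂ (w i) z = (1 + a i) * inner ℂ (e i) (J z)) ∧
      ∀ i, P (w i) = (2 * Real.pi * Complex.I * n i) • e i := by
  let T : 𝓗 →L[ℂ] 𝓗 := J ∘L J.adjoint
  have hTa : ∀ x, T x = J (J.adjoint x) := fun x => rfl
  have hTc : IsCompactOperator T := hJ.comp_clm J.adjoint
  have hTs : T.IsSymmetric := fun x y => by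
    change inner ℂ (T x) y = inner ℂ x (T y)
    rw [hTa, hTa, ← ContinuousLinearMap.adjoint_inner_right, ContinuousLinearMap.adjoint_inner_left]
  have hinj : ∀ x, T x = 0 → x = 0 := by
    intro x hx
    have h1 : J.adjoint x = 0 := by
      have : inner ℂ (J.adjoint x) (J.adjoint x) = 0 := by
        rw [ContinuousLinearMap.adjoint_inner_left, ← hTa, hx, inner_zero_right]
      exact inner_self_eq_zero.1 this
    refine h.dense_embed.eq_of_inner_left ℂ fun u => ?_
    rw [← ContinuousLinearMap.adjoint_inner_left, h1, inner_zero_left, inner_zero_left]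
  let E : ℂ → Submodule ℂ 𝓗 := fun μ => Module.End.eigenspace (T : Module.End ℂ 𝓗) μ
  have hE : ∀ μ x, x ∈ E μ ↔ T x = μ • x := fun μ x => Module.End.mem_eigenspace_iff
  have hfd : ∀ μ : {μ : ℂ // μ ≠ 0}, FiniteDimensional ℂ (E μ) := fun μ =>
    ContinuousLinearMap.finite_dimensional_eigenspace hTc μ.1 μ.2
  have hreal : ∀ (μ : ℂ) (x : 𝓗), x ∈ E μ → x ≠ 0 → conj μ = μ := fun μ x hx hx0 =>
    hTs.conj_eigenvalue_eq_self (Module.End.hasEigenvalue_of_hasEigenvector ⟨hx, hx0⟩)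
  -- `i P J†` is a symmetric operator on each of the finite-dimensional eigenspaces, so that there
  -- is an orthonormal basis of the eigenspace which diagonalizes it
  have hloc : ∀ μ : {μ : ℂ // μ ≠ 0},
      ∃ v : OrthonormalBasis (Fin (Module.finrank ℂ (E μ))) ℂ (E μ),
      ∀ i, ∃ c : ℂ, P (J.adjoint (v i : 𝓗)) = c • (v i : 𝓗) := by
    intro μ
    let B : 𝓗 →ₗ[ℂ] 𝓗 := Complex.I • (P ∘L J.adjoint).toLinearMap
    have hBa : ∀ x, B x = Complex.I • P (J.adjoint x) := fun x => rfl
    have hBE : ∀ x ∈ E μ, B x ∈ E μ := by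
      intro x hx
      rw [hE] at hx ⊢
      rw [hBa, map_smul, hTa, ← h.generator_comm, ← hTa, hx, map_smul, map_smul, smul_comm]
    have hBs : (B.restrict hBE).IsSymmetric := by
      rintro ⟨x, hx⟩ ⟨y, hy⟩
      by_cases hx0 : x = 0
      · subst hx0
        have h0 : (⟨0, hx⟩ : E μ) = 0 := rfl
        rw [h0, map_zero, inner_zero_left, inner_zero_left]
      · have hμ := hreal μ x hx hx0
        change inner ℂ (B x) y = inner ℂ x (B y)
        rw [hBa, hBa, inner_smul_left, inner_smul_right,
          h.generator_skew μ.2 hμ ((hE _ _).1 hx) ((hE _ _).1 hy)]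
        simp
    refine ⟨hBs.eigenvectorBasis rfl, fun i => ?_⟩
    have h1 := hBs.apply_eigenvectorBasis rfl i
    have h2 : B (hBs.eigenvectorBasis rfl i : 𝓗) =
        ((hBs.eigenvalues rfl i : ℝ) : ℂ) • (hBs.eigenvectorBasis rfl i : 𝓗) :=
      congrArg Subtype.val h1
    refine ⟨-Complex.I * (hBs.eigenvalues rfl i : ℝ), ?_⟩
    rw [mul_smul, ← h2, hBa, smul_smul]
    simp
  choose v c hc using hloc
  have hfam : OrthogonalFamily ℂ (fun μ : {μ : ℂ // μ ≠ 0} => E μ) fun μ => (E μ).subtypeₗᵢ :=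
    hTs.orthogonalFamily_eigenspaces.comp Subtype.coe_injective
  have hon := hfam.orthonormal_sigma_orthonormal fun μ => (v μ).orthonormal
  let ι : Type := Σ μ : {μ : ℂ // μ ≠ 0}, Fin (Module.finrank ℂ (E μ))
  let e₀ : ι → 𝓗 := fun i => (v i.1 i.2 : 𝓗)
  have hon' : Orthonormal ℂ e₀ := hon
  have hsp : (Submodule.span ℂ (range e₀))ᗮ = ⊥ := by
    rw [eq_bot_iff, ← ContinuousLinearMap.orthogonalComplement_iSup_eigenspaces_eq_bot hTc hTs]
    refine Submodule.orthogonal_le (iSup_le fun μ => ?_)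
    by_cases hμ : μ = 0
    · subst hμ
      intro x hx
      have : x = 0 := hinj x (by simpa using (hE 0 x).1 hx)
      rw [this]
      exact zero_mem _
    · intro x hx
      have h1 := (v ⟨μ, hμ⟩).sum_repr ⟨x, hx⟩
      have h2 := congrArg Subtype.val h1
      rw [Submodule.coe_sum] at h2
      change _ = x at h2
      rw [← h2]
      exact Submodule.sum_mem _ fun i _ => Submodule.smul_mem _ _
        (Submodule.subset_span ⟨⟨⟨μ, hμ⟩, i⟩, rfl⟩)
  let e := HilbertBasis.mkOfOrthogonalEqBot hon' hsp
  have he : ∀ i, e i = e₀ i := fun i => by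
    simp only [e, HilbertBasis.coe_mkOfOrthogonalEqBot]
  have hTe : ∀ i : ι, T (e i) = (i.1 : ℂ) • e i := fun i => by
    rw [he]
    exact (hE _ _).1 (v i.1 i.2).2
  have hne : ∀ i, e i ≠ 0 := fun i => e.orthonormal.ne_zero i
  have hre : ∀ i : ι, conj (i.1 : ℂ) = (i.1 : ℂ) := fun i =>
    hreal _ _ ((hE _ _).2 (hTe i)) (hne i)
  -- the eigenvalues of `J J†` are `‖J† eᵢ‖²`
  have hval : ∀ i : ι, (i.1 : ℂ) = ((‖J.adjoint (e i)‖ ^ 2 : ℝ) : ℂ) := fun i => by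
    have h1 : inner ℂ (e i) (T (e i)) = (i.1 : ℂ) := by
      rw [hTe, inner_smul_right, inner_self_eq_norm_sq_to_K, e.orthonormal.1 i]
      simp
    rw [← h1, hTa, ← ContinuousLinearMap.adjoint_inner_left, inner_self_eq_norm_sq_to_K]
    simp
  have hpos : ∀ i : ι, 0 < ‖J.adjoint (e i)‖ ^ 2 := fun i => by
    refine lt_of_le_of_ne (sq_nonneg _) fun h0 => i.1.2 ?_
    rw [hval i, ← h0, Complex.ofReal_zero]
  have hle : ∀ i : ι, ‖J.adjoint (e i)‖ ^ 2 ≤ 1 := fun i => by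
    have h1 : ‖J.adjoint‖ ≤ 1 := by
      rw [LinearIsometryEquiv.norm_map]
      exact J.opNorm_le_bound zero_le_one fun w => by rw [one_mul]; exact hJ1 w
    have h2 := J.adjoint.le_of_opNorm_le h1 (e i)
    rw [e.orthonormal.1 i, mul_one] at h2
    exact pow_le_one₀ (norm_nonneg _) h2
  refine ⟨ι, e, fun i => (i.1 : ℂ)⁻¹ • J.adjoint (e i), fun i => (‖J.adjoint (e i)‖ ^ 2)⁻¹ - 1, ?_⟩
  have hJw : ∀ i : ι, J ((i.1 : ℂ)⁻¹ • J.adjoint (e i)) = e i := fun i => by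
    rw [map_smul, ← hTa, hTe, smul_smul, inv_mul_cancel₀ i.1.2, one_smul]
  have hP : ∀ i : ι, ∃ n : ℤ, P ((i.1 : ℂ)⁻¹ • J.adjoint (e i)) =
      (2 * Real.pi * Complex.I * n) • e i := fun i => by
    have h1 : P ((i.1 : ℂ)⁻¹ • J.adjoint (e i)) =
        ((i.1 : ℂ)⁻¹ * c i.1 i.2) • J ((i.1 : ℂ)⁻¹ • J.adjoint (e i)) := by
      rw [hJw, map_smul, he, hc, smul_smul]
    obtain ⟨n, hn⟩ := h.exists_int_of_eigenvector (by rw [hJw]; exact hne i) h1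
    exact ⟨n, by rw [h1, hn, hJw]⟩
  choose n hn using hP
  refine ⟨n, fun i => ?_, hJw, fun i z => ?_, hn⟩
  · rw [sub_nonneg]
    exact (one_le_inv₀ (hpos i)).2 (hle i)
  · rw [inner_smul_left, map_inv₀, hre, ContinuousLinearMap.adjoint_inner_left]
    congr 1
    rw [hval i]
    push_cast
    ring

end IsTranslationFamily

end JointDiagonalization

/-! ### The eigenfunctions of the free operator -/

/-- An operator is compact if it is small on subspaces of finite codimension. -/
theorem isCompactOperator_of_forall_le {W 𝓗 : Type*} [NormedAddCommGroup W]
    [InnerProductSpace ℂ W] [CompleteSpace W] [NormedAddCommGroup 𝓗] [InnerProductSpace ℂ 𝓗]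
    [CompleteSpace 𝓗] {J : W →L[ℂ] 𝓗}
    (h : ∀ ε : ℝ, 0 < ε → ∃ (n : ℕ) (L : W →L[ℂ] (Fin n → ℂ)), ∀ w, L w = 0 → ‖J w‖ ≤ ε * ‖w‖) :
    IsCompactOperator J := by
  have hcl := isClosed_setOfPred_isCompactOperator (𝕜₁ := ℂ) (𝕜₂ := ℂ) (σ₁₂ := RingHom.id ℂ)
    (M₁ := W) (M₂ := 𝓗)
  have hmem : J ∈ closure {f : W →L[ℂ] 𝓗 | IsCompactOperator f} := by
    refine Metric.mem_closure_iff.2 fun ε hε => ?_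
    obtain ⟨n, L, hL⟩ := h (ε / 2) (half_pos hε)
    set N : Submodule ℂ W := LinearMap.ker L.toLinearMap
    have hNc : IsClosed (N : Set W) := L.isClosed_ker
    have : CompleteSpace N := hNc.completeSpace_coe
    have : FiniteDimensional ℂ Nᗮ := by
      refine Module.Finite.of_injective (L.toLinearMap ∘ₗ Nᗮ.subtype) ?_
      rw [← LinearMap.ker_eq_bot, LinearMap.ker_eq_bot']
      rintro ⟨x, hx⟩ hx0
      have h1 : x ∈ N := hx0
      have h2 := Submodule.inner_right_of_mem_orthogonal h1 hx
      exact Subtype.ext (inner_self_eq_zero.1 h2)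
    -- off the finite-dimensional space `Nᗮ` the operator `J` is small
    let K : W →L[ℂ] 𝓗 := J ∘L Nᗮ.subtypeL ∘L Nᗮ.orthogonalProjectionOnto
    have hK : IsCompactOperator K := by
      have : ProperSpace Nᗮ := FiniteDimensional.proper ℂ Nᗮ
      have h1 : IsCompactOperator (Nᗮ.orthogonalProjectionOnto : W → Nᗮ) :=
        isCompactOperator_of_locallyCompactSpace_dom _
      exact h1.clm_comp (J ∘L Nᗮ.subtypeL)
    refine ⟨K, hK, ?_⟩
    rw [dist_eq_norm]
    refine (ContinuousLinearMap.opNorm_le_bound _ (half_pos hε).le fun w => ?_).trans_lt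
      (half_lt_self hε)
    have e1 : (J - K) w = J (w - Nᗮ.starProjection w) := by
      rw [map_sub]; rfl
    have e2 : w - Nᗮ.starProjection w = N.starProjection w := by
      rw [Submodule.starProjection_orthogonal]; simp
    rw [e1, e2]
    exact (hL _ (N.starProjection_apply_mem w)).trans (mul_le_mul_of_nonneg_left
      (Submodule.norm_starProjection_apply_le _ w) (half_pos hε).le)
  rw [hcl.closure_eq] at hmem
  exact hmem

section Eigenfunctions

variable {k m : ℕ} {H : Type*} [TopologicalSpace H]
  {I : ModelWithCorners ℝ (EuclideanSpace ℝ (Fin k)) H}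
  {M : Type*} [TopologicalSpace M] [ChartedSpace H M] [IsManifold I ∞ M]
  {g : Metric I M} {b : Module.Basis (Fin m) ℝ (EuclideanSpace ℝ (Fin m))}
  [MeasurableSpace M] [BorelSpace M] [CompactSpace M] {hI : IsBoundaryModel I}
  {bc : BoundaryCondition}

theorem norm_sq_coreToL2 (u : coreSpace b I M bc) :
    ENNReal.ofReal (‖coreToL2 g b hI bc u‖ ^ 2) = ∫⁻ p, ‖u.1 p‖ₑ ^ 2 ∂(cellMeasure g b) := by
  have h1 : ENNReal.ofReal ‖coreToL2 g b hI bc u‖ = eLpNorm u.1 2 (cellMeasure g b) := by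
    rw [ofReal_norm]
    exact Lp.enorm_toLp (memLp_of_continuous g b hI u.2.1.continuous 2)
  rw [ENNReal.ofReal_pow (norm_nonneg _), h1,
    eLpNorm_eq_lintegral_rpow_enorm_toReal two_ne_zero ENNReal.ofNat_ne_top,
    ← ENNReal.rpow_natCast, ← ENNReal.rpow_mul]
  simp

/-- Rellich's inequality for core functions, in terms of the form with quasimomentum zero. -/
theorem norm_sq_coreToL2_le (g : Metric I M)
    (b : Module.Basis (Fin m) ℝ (EuclideanSpace ℝ (Fin m))) (hI : IsBoundaryModel I)
    (bc : BoundaryCondition) {ε : ℝ} (hε : 0 < ε) :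
    ∃ (s : Finset (Set (M × EuclideanSpace ℝ (Fin m)))) (C : ℝ),
      (∀ A ∈ s, MeasurableSet A) ∧ ∀ u : coreSpace b I M bc,
        ‖coreToL2 g b hI bc u‖ ^ 2 ≤ ε * (freeForm g b 0 u.1 u.1).re +
          C * ∑ A ∈ s, ‖∫ p in A, u.1 p ∂(cellMeasure g b)‖ ^ 2 := by
  obtain ⟨s, C, hC, hs, h⟩ := rellich g b hI hε
  refine ⟨s, C, hs, fun u => ?_⟩
  have h1 := h u.1 u.2.1
  have h2 : ∫⁻ p, ENNReal.ofReal (gradSq g u.1 p) ∂(cellMeasure g b) =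
      ENNReal.ofReal (freeForm g b 0 u.1 u.1).re := by
    rw [freeForm_self_re g b hI 0 u.2.1]
    simp only [formDensity_zero_re]
    refine (ofReal_integral_eq_lintegral_ofReal ?_ (ae_of_all _ fun p => gradSq_nonneg g _ p)).symm
    have := (integrable_formDensity g b hI 0 u.2.1 u.2.1).re
    exact this.congr (ae_of_all _ fun p => formDensity_zero_re g p)
  have h3 : ∑ A ∈ s, ‖∫ p in A, u.1 p ∂(cellMeasure g b)‖ₑ ^ 2 =
      ENNReal.ofReal (∑ A ∈ s, ‖∫ p in A, u.1 p ∂(cellMeasure g b)‖ ^ 2) := by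
    rw [ENNReal.ofReal_sum_of_nonneg fun _ _ => sq_nonneg _]
    exact Finset.sum_congr rfl fun A _ => by
      rw [ENNReal.ofReal_pow (norm_nonneg _), ofReal_norm]
  have h4 : 0 ≤ (freeForm g b 0 u.1 u.1).re := freeForm_self_nonneg g b hI (by simp) u.2.1
  have h5 : 0 ≤ ∑ A ∈ s, ‖∫ p in A, u.1 p ∂(cellMeasure g b)‖ ^ 2 :=
    Finset.sum_nonneg fun _ _ => sq_nonneg _
  rw [← norm_sq_coreToL2 (g := g) (hI := hI), h2, h3, ← ENNReal.ofReal_mul hε.le,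
    ← ENNReal.ofReal_mul hC, ← ENNReal.ofReal_add (by positivity) (by positivity)] at h1
  exact (ENNReal.ofReal_le_ofReal_iff (by positivity)).1 h1

variable [NeZero m] {ξ : EuclideanSpace ℝ (Fin m)} {W : Type*} [NormedAddCommGroup W]
  [InnerProductSpace ℂ W] [CompleteSpace W] {κ : coreSpace b I M bc →ₗ[ℂ] W} {J δ : W →L[ℂ] L2 g b}

/-- The embedding of the form space in `L₂` is compact: by Rellich's inequality it is small where
finitely many mean values vanish. -/
theorem IsFormSpace.isCompactOperator (h : IsFormSpace g b hI bc ξ κ J δ) :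
    IsCompactOperator J := by
  have hμ := isFiniteMeasure_cellMeasure g b hI
  refine isCompactOperator_of_forall_le fun ε hε => ?_
  set S : ℝ := ∑ j, ‖(0 : EuclideanSpace ℂ (Fin m)) j - quasimomentum b ξ 0 j‖ ^ 2
  have hS : 0 ≤ S := Finset.sum_nonneg fun _ _ => sq_nonneg _
  obtain ⟨s, C, hs, hle⟩ := norm_sq_coreToL2_le g b hI bc
    (show 0 < ε ^ 2 / (2 + 2 * S) by positivity)
  -- the functionals `w ↦ ∫_A J w`
  let ℓ : s → W →L[ℂ] ℂ := fun A =>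
    (innerSL ℂ (indicatorConstLp 2 (hs A.1 A.2) (measure_ne_top _ _) (1 : ℂ))) ∘L J
  have hℓ : ∀ (A : s) w, ℓ A w = ∫ p in A.1, J w p ∂(cellMeasure g b) := fun A w =>
    L2.inner_indicatorConstLp_one (hs A.1 A.2) (measure_ne_top _ _) (J w)
  have key : ∀ w, ‖J w‖ ^ 2 ≤ ε ^ 2 * ‖w‖ ^ 2 + C * ∑ A, ‖ℓ A w‖ ^ 2 := fun w => by
    refine h.dense.induction_on w (isClosed_le (by fun_prop) (by fun_prop)) fun u => ?_
    have h1 := hle u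
    have h2 := freeForm_self_le g b hI (ζ := 0) (by simp) (conj_quasimomentum_zero b ξ) u
    have h3 := h.norm_sq u
    have h5 := freeForm_self_nonneg g b hI (conj_quasimomentum_zero b ξ) u.2.1
    have h4 : (freeForm g b 0 u.1 u.1).re ≤ (2 + 2 * S) * ‖κ u‖ ^ 2 := by
      rw [h3]
      nlinarith [sq_nonneg ‖coreToL2 g b hI bc u‖]
    have h6 : ∑ A, ‖ℓ A (κ u)‖ ^ 2 = ∑ A ∈ s, ‖∫ p in A, u.1 p ∂(cellMeasure g b)‖ ^ 2 := by
      rw [← Finset.sum_coe_sort s fun A => ‖∫ p in A, u.1 p ∂(cellMeasure g b)‖ ^ 2]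
      refine Finset.sum_congr rfl fun A _ => ?_
      rw [hℓ, h.embed]
      congr 2
      exact integral_congr_ae (ae_restrict_of_ae (coeFn_coreToL2 g b hI u))
    rw [h.embed, h6]
    refine h1.trans (add_le_add ?_ le_rfl)
    calc ε ^ 2 / (2 + 2 * S) * (freeForm g b 0 u.1 u.1).re
        ≤ ε ^ 2 / (2 + 2 * S) * ((2 + 2 * S) * ‖κ u‖ ^ 2) :=
          mul_le_mul_of_nonneg_left h4 (by positivity)
      _ = ε ^ 2 * ‖κ u‖ ^ 2 := by field_simp
  refine ⟨Fintype.card s, ContinuousLinearMap.pi fun i => ℓ ((Fintype.equivFin s).symm i),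
    fun w hw => ?_⟩
  have h0 : ∀ A, ℓ A w = 0 := fun A => by
    have := congrFun hw (Fintype.equivFin s A)
    simpa using this
  have h1 := key w
  simp only [h0, norm_zero] at h1
  refine le_of_sq_le_sq ?_ (by positivity)
  rw [mul_pow]
  simpa using h1

/-- The translations along `b₁` satisfy the assumptions of the joint diagonalization. -/
theorem IsFormSpace.isTranslationFamily [T2Space M] (h : IsFormSpace g b hI bc ξ κ J δ) :
    IsTranslationFamily κ J (δ - (Complex.I * Real.pi) • J) (coreTranslate b bc) where
  dense := h.dense
  dense_embed := by
    simp only [h.embed]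
    exact denseRange_coreToL2 g b hI bc
  add s t u := coreTranslate_add b bc s t u
  zero u := coreTranslate_zero b bc u
  one u := coreTranslate_one b bc u
  inner_form s u v := h.inner_translate s u v
  inner_embed s u v := by
    simp only [h.embed]
    exact inner_coreToL2_translate g b hI s u v
  hasDerivAt f u := by
    simp only [h.embed]
    have := h.hasDerivAt_translate f u
    rw [h.embed] at this
    simpa only [_root_.sub_apply, _root_.smul_apply, h.embed] using this
  skew w z := by
    have := h.inner_deriv w z
    simp only [_root_.sub_apply, _root_.smul_apply, inner_sub_right,
      inner_sub_left, inner_smul_left, inner_smul_right, this, map_mul, Complex.conj_I,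
      Complex.conj_ofReal]
    ring

/-- There is an orthonormal basis of eigenfunctions of `H₀` which are also eigenfunctions of the
derivative along `b₁`; by periodicity, `∂ + iπ` has eigenvalues `iπ(2n + 1)`, which are bounded
away from zero. -/
theorem IsFormSpace.exists_eigenbasis [T2Space M] (h : IsFormSpace g b hI bc ξ κ J δ)
    (hb : ‖b 0‖ = 1) (hξ : inner ℝ ξ (b 0) = 0) :
    ∃ (ι : Type) (e : HilbertBasis ι ℂ (L2 g b)) (w : ι → W) (a d : ι → ℝ),
      (∀ i, 0 ≤ a i) ∧ (∀ i, J (w i) = e i) ∧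
      (∀ i z, inner ℂ (w i) z = (1 + a i) * inner ℂ (e i) (J z)) ∧
      (∀ i, δ (w i) = (Complex.I * d i) • e i) ∧ (∀ i, Real.pi ≤ |d i|) ∧
      (∀ i, d i ^ 2 ≤ 1 + a i) ∧
      ∀ i (l : ℕ), ((l : ℝ) - 1) ^ 2 ≤ a i → a i < (l : ℝ) ^ 2 →
        e i ∈ spectralCluster g b bc ξ l := by
  obtain ⟨ι, e, w, a, n, ha, hJ, hin, hP⟩ :=
    h.isTranslationFamily.exists_hilbertBasis h.isCompactOperator h.norm_embed_le
  have hδ : ∀ i, δ (w i) = (Complex.I * ((Real.pi * (2 * n i + 1) : ℝ) : ℂ)) • e i := fun i => by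
    have := hP i
    rw [_root_.sub_apply, _root_.smul_apply, hJ, sub_eq_iff_eq_add,
      ← add_smul] at this
    rw [this]
    congr 1
    push_cast
    ring
  refine ⟨ι, e, w, a, fun i => Real.pi * (2 * n i + 1), ha, hJ, hin, hδ, fun i => ?_, fun i => ?_,
    fun i l h1 h2 => ?_⟩
  · rw [abs_mul, abs_of_pos Real.pi_pos]
    refine le_mul_of_one_le_right Real.pi_pos.le ?_
    have : (1 : ℤ) ≤ |2 * n i + 1| := Int.one_le_abs (by omega)
    exact_mod_cast this
  · have h1 := h.norm_deriv_le hb hξ (w i)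
    have h2 : ‖w i‖ ^ 2 = 1 + a i := by
      rw [← inner_self_eq_norm_sq (𝕜 := ℂ), hin, hJ, inner_self_eq_norm_sq_to_K,
        e.orthonormal.1 i]
      simp
    have h3 := pow_le_pow_left₀ (norm_nonneg _) h1 2
    rw [h2, hδ, norm_smul, e.orthonormal.1 i, mul_one, norm_mul, Complex.norm_I, one_mul,
      Complex.norm_real, Real.norm_eq_abs, sq_abs] at h3
    exact h3
  · refine Submodule.le_topologicalClosure _ (Submodule.subset_span ⟨a i, h1, h2, ?_⟩)
    rw [h.isSchrodinger_iff hb hξ]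
    refine ⟨w i, hJ i, fun z => ?_⟩
    have h3 : inner ℂ z (w i) = (1 + a i) * inner ℂ (J z) (e i) := by
      rw [← inner_conj_symm, hin, map_mul, inner_conj_symm]
      simp
    refine ⟨by simp, ?_⟩
    rw [twistedForm, h3, hJ, inner_smul_right]
    simp
    ring

end Eigenfunctions

/-! ### Operators defined by their values on an orthonormal basis -/

section Synthesis

variable {ι 𝓗 F : Type*} [NormedAddCommGroup 𝓗] [InnerProductSpace ℂ 𝓗]
  [NormedAddCommGroup F]

theorem denseRange_linearCombination (e : HilbertBasis ι ℂ 𝓗) :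
    DenseRange (Finsupp.linearCombination ℂ e) := by
  intro x
  have h : x ∈ (Submodule.span ℂ (range e)).topologicalClosure := by
    rw [e.dense_span]; trivial
  rw [← Finsupp.range_linearCombination] at h
  exact h

theorem clm_ext_basis [NormedSpace ℂ F] (e : HilbertBasis ι ℂ 𝓗) {A B : 𝓗 →L[ℂ] F}
    (h : ∀ i, A (e i) = B (e i)) : A = B := by
  ext x
  refine (denseRange_linearCombination e).induction_on x (isClosed_eq A.continuous B.continuous)
    fun c => ?_
  simp only [Finsupp.linearCombination_apply, Finsupp.sum, map_sum, map_smul, h]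

theorem norm_sq_sum_smul (e : HilbertBasis ι ℂ 𝓗) (s : Finset ι) (c : ι → ℂ) :
    ‖∑ i ∈ s, c i • e i‖ ^ 2 = ∑ i ∈ s, ‖c i‖ ^ 2 := by
  rw [← inner_self_eq_norm_sq (𝕜 := ℂ), e.orthonormal.inner_sum, map_sum]
  refine Finset.sum_congr rfl fun i _ => ?_
  rw [← Complex.normSq_eq_norm_sq, mul_comm, Complex.mul_conj]
  exact Complex.ofReal_re _

/-- A bounded operator with prescribed values on an orthonormal basis. -/
theorem exists_clm_of_bound [NormedSpace ℂ F] [CompleteSpace F] (e : HilbertBasis ι ℂ 𝓗)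
    (v : ι → F) {C : ℝ} (hC : 0 ≤ C)
    (h : ∀ (s : Finset ι) (c : ι → ℂ), ‖∑ i ∈ s, c i • v i‖ ^ 2 ≤ C ^ 2 * ∑ i ∈ s, ‖c i‖ ^ 2) :
    ∃ A : 𝓗 →L[ℂ] F, (∀ i, A (e i) = v i) ∧ ‖A‖ ≤ C := by
  have hd := denseRange_linearCombination e
  have hb : ∀ c, ‖Finsupp.linearCombination ℂ v c‖ ≤ C * ‖Finsupp.linearCombination ℂ e c‖ := by
    intro c
    refine le_of_sq_le_sq ?_ (by positivity)
    rw [mul_pow]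
    simp only [Finsupp.linearCombination_apply, Finsupp.sum]
    rw [norm_sq_sum_smul]
    exact h _ _
  refine ⟨(Finsupp.linearCombination ℂ v).extendOfNorm (Finsupp.linearCombination ℂ e),
    fun i => ?_, LinearMap.opNorm_extendOfNorm_le hd hC hb⟩
  have := LinearMap.extendOfNorm_eq hd ⟨C, hb⟩ (Finsupp.single i 1)
  simpa using this

/-- The case of orthogonal values. -/
theorem exists_clm_of_orthogonal [InnerProductSpace ℂ F] [CompleteSpace F]
    (e : HilbertBasis ι ℂ 𝓗) (v : ι → F) {C : ℝ} (hC : 0 ≤ C)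
    (ho : ∀ i j, i ≠ j → inner ℂ (v i) (v j) = 0) (hv : ∀ i, ‖v i‖ ^ 2 ≤ C ^ 2) :
    ∃ A : 𝓗 →L[ℂ] F, (∀ i, A (e i) = v i) ∧ ‖A‖ ≤ C := by
  refine exists_clm_of_bound e v hC fun s c => ?_
  have h1 : ‖∑ i ∈ s, c i • v i‖ ^ 2 = ∑ i ∈ s, ‖c i • v i‖ ^ 2 := by
    rw [← inner_self_eq_norm_sq (𝕜 := ℂ), sum_inner, map_sum]
    refine Finset.sum_congr rfl fun i hi => ?_
    rw [inner_sum, Finset.sum_eq_single i, inner_self_eq_norm_sq]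
    · intro j _ hj
      rw [inner_smul_left, inner_smul_right, ho i j hj.symm, mul_zero, mul_zero]
    · exact fun h => absurd hi h
  rw [h1, Finset.mul_sum]
  refine Finset.sum_le_sum fun i _ => ?_
  rw [norm_smul, mul_pow, mul_comm]
  exact mul_le_mul_of_nonneg_right (hv i) (sq_nonneg _)

/-- Diagonal operators. -/
theorem exists_diagonal [CompleteSpace 𝓗] (e : HilbertBasis ι ℂ 𝓗) (c : ι → ℂ) {C : ℝ} (hC : 0 ≤ C)
    (hc : ∀ i, ‖c i‖ ≤ C) : ∃ A : 𝓗 →L[ℂ] 𝓗, (∀ i, A (e i) = c i • e i) ∧ ‖A‖ ≤ C := by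
  refine exists_clm_of_orthogonal e _ hC (fun i j hij => ?_) fun i => ?_
  · rw [inner_smul_left, inner_smul_right, e.orthonormal.2 hij, mul_zero, mul_zero]
  · rw [norm_smul, e.orthonormal.1 i, mul_one]
    exact pow_le_pow_left₀ (norm_nonneg _) (hc i) 2

theorem inner_diagonal [CompleteSpace 𝓗] (e : HilbertBasis ι ℂ 𝓗) {c : ι → ℂ} {A : 𝓗 →L[ℂ] 𝓗}
    (hA : ∀ i, A (e i) = c i • e i) (i : ι) (x : 𝓗) :
    inner ℂ (e i) (A x) = c i * inner ℂ (e i) x := by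
  have h : (innerSL ℂ (e i)) ∘L A = c i • innerSL ℂ (e i) := by
    refine clm_ext_basis e fun j => ?_
    change inner ℂ (e i) (A (e j)) = c i * inner ℂ (e i) (e j)
    rw [hA, inner_smul_right]
    by_cases hij : i = j
    · rw [hij]
    · rw [e.orthonormal.2 hij, mul_zero, mul_zero]
  exact congrArg (fun L => L x) h

end Synthesis

/-! ### Multiplication operators in weighted spectral spaces -/

section Multiplier

variable {X : Type*} [MeasurableSpace X] {μ : Measure X}

/-- Multiplication by a measurable function is a closed operator in `L₂`. -/
theorem isClosed_setOf_mul_ae_eq {p : X → ℂ} : IsClosed {q : Lp ℂ 2 μ × Lp ℂ 2 μ |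
    ⇑q.2 =ᵐ[μ] fun x => p x * q.1 x} := by
  refine IsSeqClosed.isClosed fun q q₀ hq hlim => ?_
  have h1 : Tendsto (fun n => (q n).1) atTop (𝓝 q₀.1) := (continuous_fst.tendsto _).comp hlim
  have h2 : Tendsto (fun n => (q n).2) atTop (𝓝 q₀.2) := (continuous_snd.tendsto _).comp hlim
  obtain ⟨φ, hφ, hae⟩ := (tendstoInMeasure_of_tendsto_Lp h1).exists_seq_tendsto_ae
  obtain ⟨ψ, hψ, hae'⟩ := (tendstoInMeasure_of_tendsto_Lp
    (h2.comp hφ.tendsto_atTop)).exists_seq_tendsto_ae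
  have hall : ∀ᵐ x ∂μ, ∀ n, (q n).2 x = p x * (q n).1 x := ae_all_iff.2 hq
  filter_upwards [hae, hae', hall] with x hx hx' hx''
  refine tendsto_nhds_unique hx' ?_
  have := (hx.comp hψ.tendsto_atTop).const_mul (p x)
  refine this.congr fun n => ?_
  simp only [Function.comp, hx'']

variable {ι : Type*}

/-- Let `p` be a function which multiplies the span of the basis functions with index `l` into `L₂`
with norm at most `β l`. If the sum of `β l ^ 2 * t l` is at most `η` and `ρ i ^ 2 ≤ t (l i)`, then
the product of `p` with the diagonal operator `diag(ρ)` is bounded by `√η`. -/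
theorem exists_multiplier (e : HilbertBasis ι ℂ (Lp ℂ 2 μ)) (l : ι → ℕ) {p : X → ℂ} {β t : ℕ → ℝ}
    (hβ : ∀ n, 0 ≤ β n) (ht : ∀ n, 0 ≤ t n)
    (hp : ∀ n, ∀ f ∈ Submodule.span ℂ (e '' {i | l i = n}),
      MemLp (fun x => p x * f x) 2 μ ∧
        eLpNorm (fun x => p x * f x) 2 μ ≤ ENNReal.ofReal (β n) * eLpNorm f 2 μ)
    {ρ : ι → ℝ} (hρ : ∀ i, ρ i ^ 2 ≤ t (l i)) {η : ℝ}
    (hη : ∀ s : Finset ℕ, ∑ n ∈ s, β n ^ 2 * t n ≤ η) {G : Lp ℂ 2 μ →L[ℂ] Lp ℂ 2 μ}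
    (hG : ∀ i, G (e i) = (ρ i : ℂ) • e i) :
    ∃ Y : Lp ℂ 2 μ →L[ℂ] Lp ℂ 2 μ, ‖Y‖ ≤ Real.sqrt η ∧
      ∀ c, ⇑(Y c) =ᵐ[μ] fun x => p x * G c x := by
  classical
  have hη0 : 0 ≤ η := (hη ∅).trans' (by simp)
  -- multiplication by `p` on the span of one cluster
  have hmem : ∀ i, e i ∈ Submodule.span ℂ (e '' {j | l j = l i}) := fun i =>
    Submodule.subset_span ⟨i, rfl, rfl⟩
  let v : ι → Lp ℂ 2 μ := fun i => (hp _ _ (hmem i)).1.toLp _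
  have hv : ∀ i, ⇑(v i) =ᵐ[μ] fun x => p x * e i x := fun i => MemLp.coeFn_toLp _
  have hsum : ∀ (s : Finset ι) (c : ι → ℂ),
      ⇑(∑ i ∈ s, c i • v i) =ᵐ[μ] fun x => p x * (∑ i ∈ s, c i • e i : Lp ℂ 2 μ) x := by
    intro s c
    induction s using Finset.induction_on with
    | empty =>
      simp only [Finset.sum_empty]
      filter_upwards [Lp.coeFn_zero ℂ 2 μ] with x hx
      rw [hx]; simp
    | insert i s hi ih =>
      rw [Finset.sum_insert hi, Finset.sum_insert hi]
      filter_upwards [ih, hv i, Lp.coeFn_add (c i • v i) (∑ i ∈ s, c i • v i),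
        Lp.coeFn_add (c i • e i) (∑ i ∈ s, c i • e i), Lp.coeFn_smul (c i) (v i),
        Lp.coeFn_smul (c i) (e i)] with x h1 h2 h3 h4 h5 h6
      rw [h3, h4, Pi.add_apply, Pi.add_apply, h5, h6, Pi.smul_apply, Pi.smul_apply, h1, h2,
        smul_eq_mul, smul_eq_mul]
      ring
  have hcl : ∀ (n : ℕ) (s : Finset ι) (c : ι → ℂ), (∀ i ∈ s, l i = n) →
      ‖∑ i ∈ s, c i • v i‖ ≤ β n * ‖∑ i ∈ s, c i • e i‖ := by
    intro n s c hs
    have hf : ∑ i ∈ s, c i • e i ∈ Submodule.span ℂ (e '' {i | l i = n}) :=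
      Submodule.sum_mem _ fun i hi =>
        Submodule.smul_mem _ _ (Submodule.subset_span ⟨i, hs i hi, rfl⟩)
    have h1 := (hp n _ hf).2
    rw [← eLpNorm_congr_ae (hsum s c), ← Lp.enorm_def, ← Lp.enorm_def, ← ofReal_norm, ← ofReal_norm,
      ← ENNReal.ofReal_mul (hβ n)] at h1
    exact (ENNReal.ofReal_le_ofReal_iff (mul_nonneg (hβ n) (norm_nonneg _))).1 h1
  have hbound : ∀ (s : Finset ι) (c : ι → ℂ), ‖∑ i ∈ s, c i • ((ρ i : ℂ) • v i)‖ ^ 2 ≤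
      Real.sqrt η ^ 2 * ∑ i ∈ s, ‖c i‖ ^ 2 := by
    intro s c
    rw [Real.sq_sqrt hη0]
    set T := s.image l
    have hmap : ∀ i ∈ s, l i ∈ T := fun i hi => Finset.mem_image_of_mem _ hi
    have h1 : ∑ i ∈ s, c i • ((ρ i : ℂ) • v i) =
        ∑ n ∈ T, ∑ i ∈ s with l i = n, (c i * ρ i) • v i := by
      rw [Finset.sum_fiberwise_of_maps_to hmap]
      exact Finset.sum_congr rfl fun i _ => smul_smul _ _ _
    have h2 : ∀ n ∈ T, ‖∑ i ∈ s with l i = n, (c i * ρ i) • v i‖ ≤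
        (β n * Real.sqrt (t n)) * Real.sqrt (∑ i ∈ s with l i = n, ‖c i‖ ^ 2) := by
      intro n _
      refine (hcl n _ _ fun i hi => (Finset.mem_filter.1 hi).2).trans ?_
      rw [mul_assoc]
      refine mul_le_mul_of_nonneg_left ?_ (hβ n)
      rw [← Real.sqrt_mul (ht n)]
      refine Real.le_sqrt_of_sq_le ?_
      rw [norm_sq_sum_smul, Finset.mul_sum]
      refine Finset.sum_le_sum fun i hi => ?_
      rw [norm_mul, mul_pow, mul_comm, Complex.norm_real, Real.norm_eq_abs, sq_abs,
        ← (Finset.mem_filter.1 hi).2]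
      exact mul_le_mul_of_nonneg_right (hρ i) (sq_nonneg _)
    have h3 : ‖∑ i ∈ s, c i • ((ρ i : ℂ) • v i)‖ ≤
        ∑ n ∈ T, (β n * Real.sqrt (t n)) * Real.sqrt (∑ i ∈ s with l i = n, ‖c i‖ ^ 2) := by
      rw [h1]
      exact (norm_sum_le _ _).trans (Finset.sum_le_sum h2)
    -- Cauchy–Schwarz over the clusters
    refine (pow_le_pow_left₀ (norm_nonneg _) h3 2).trans
      ((Finset.sum_mul_sq_le_sq_mul_sq _ _ _).trans ?_)
    refine mul_le_mul ?_ (le_of_eq ?_) (Finset.sum_nonneg fun _ _ => sq_nonneg _) hη0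
    · refine (le_of_eq (Finset.sum_congr rfl fun n _ => ?_)).trans (hη T)
      rw [mul_pow, Real.sq_sqrt (ht n)]
    · rw [← Finset.sum_fiberwise_of_maps_to hmap]
      exact Finset.sum_congr rfl fun n _ =>
        Real.sq_sqrt (Finset.sum_nonneg fun _ _ => sq_nonneg _)
  obtain ⟨Y, hY, hYn⟩ := exists_clm_of_bound e _ (Real.sqrt_nonneg η) hbound
  refine ⟨Y, hYn, fun c => ?_⟩
  have hclosed : IsClosed {c | ⇑(Y c) =ᵐ[μ] fun x => p x * G c x} :=
    isClosed_setOf_mul_ae_eq.preimage (G.continuous.prodMk Y.continuous)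
  refine (denseRange_linearCombination e).induction_on c hclosed fun c => ?_
  have e1 : Y (Finsupp.linearCombination ℂ e c) = ∑ i ∈ c.support, (c i * ρ i) • v i := by
    simp only [Finsupp.linearCombination_apply, Finsupp.sum, map_sum, map_smul, hY, smul_smul]
  have e2 : G (Finsupp.linearCombination ℂ e c) = ∑ i ∈ c.support, (c i * ρ i) • e i := by
    simp only [Finsupp.linearCombination_apply, Finsupp.sum, map_sum, map_smul, hG, smul_smul]
  rw [e1, e2]
  exact hsum _ _

end Multiplier

/-! ### The resolvent -/

section Resolvent

theorem ext_inner_basis {ι 𝓗 : Type*} [NormedAddCommGroup 𝓗] [InnerProductSpace ℂ 𝓗]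
    (e : HilbertBasis ι ℂ 𝓗) {x y : 𝓗} (h : ∀ i, inner ℂ (e i) x = inner ℂ (e i) y) : x = y := by
  refine (denseRange_linearCombination e).eq_of_inner_right ℂ fun c => ?_
  simp only [Finsupp.linearCombination_apply, Finsupp.sum, sum_inner, inner_smul_left, h]

/-- A small perturbation of a unitary diagonal operator is invertible. -/
theorem exists_inverse_diagonal_add {ι 𝓗 : Type*} [NormedAddCommGroup 𝓗] [InnerProductSpace ℂ 𝓗]
    [CompleteSpace 𝓗] (e : HilbertBasis ι ℂ 𝓗) {c : ι → ℂ} (hc : ∀ i, ‖c i‖ = 1)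
    {U B : 𝓗 →L[ℂ] 𝓗} (hU : ∀ i, U (e i) = c i • e i) (hB : ‖B‖ ≤ 1 / 2) :
    ∃ A : 𝓗 →L[ℂ] 𝓗, (∀ x, A (U x + B x) = x) ∧ (∀ x, U (A x) + B (A x) = x) ∧ ‖A‖ ≤ 2 := by
  obtain ⟨U', hU', hn⟩ := exists_diagonal e (fun i => (c i)⁻¹) zero_le_one
    (fun i => by rw [norm_inv, hc, inv_one])
  have hc0 : ∀ i, c i ≠ 0 := fun i h0 => by
    have := hc i
    rw [h0, norm_zero] at this
    norm_num at this
  have h1 : U' * U = 1 := clm_ext_basis e fun i => by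
    change U' (U (e i)) = e i
    rw [hU, map_smul, hU', smul_smul, mul_inv_cancel₀ (hc0 i), one_smul]
  have h2 : U * U' = 1 := clm_ext_basis e fun i => by
    change U (U' (e i)) = e i
    rw [hU', map_smul, hU, smul_smul, inv_mul_cancel₀ (hc0 i), one_smul]
  have hX : ‖-(U' * B)‖ ≤ 1 / 2 := by
    rw [norm_neg]
    exact (norm_mul_le _ _).trans (by nlinarith [norm_nonneg B])
  set Q := Units.oneSub (-(U' * B)) (hX.trans_lt (by norm_num))
  have hQ : (Q : 𝓗 →L[ℂ] 𝓗) = 1 + U' * B := by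
    rw [Units.val_oneSub, sub_neg_eq_add]
  have hZ : U + B = U * Q := by
    rw [hQ, mul_add, mul_one, ← mul_assoc, h2, one_mul]
  have hl : ((Q⁻¹ : (𝓗 →L[ℂ] 𝓗)ˣ) : 𝓗 →L[ℂ] 𝓗) * U' * (U + B) = 1 := by
    rw [hZ, mul_assoc, ← mul_assoc U', h1, one_mul, Units.inv_mul]
  have hr : (U + B) * (((Q⁻¹ : (𝓗 →L[ℂ] 𝓗)ˣ) : 𝓗 →L[ℂ] 𝓗) * U') = 1 := by
    rw [hZ, mul_assoc, ← mul_assoc (Q : 𝓗 →L[ℂ] 𝓗), Units.mul_inv, one_mul, h2]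
  refine ⟨((Q⁻¹ : (𝓗 →L[ℂ] 𝓗)ˣ) : 𝓗 →L[ℂ] 𝓗) * U', fun x => congrArg (fun L => L x) hl,
    fun x => congrArg (fun L => L x) hr,
    ContinuousLinearMap.opNorm_le_bound _ zero_le_two fun y => ?_⟩
  set x := (((Q⁻¹ : (𝓗 →L[ℂ] 𝓗)ˣ) : 𝓗 →L[ℂ] 𝓗) * U') y
  have h3 : U' y = x + (U' * B) x := by
    have h4 : (Q : 𝓗 →L[ℂ] 𝓗) * (((Q⁻¹ : (𝓗 →L[ℂ] 𝓗)ˣ) : 𝓗 →L[ℂ] 𝓗) * U') = U' := by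
      rw [← mul_assoc, Units.mul_inv, one_mul]
    have h5 : (Q : 𝓗 →L[ℂ] 𝓗) x = U' y := congrArg (fun L => L y) h4
    rw [← h5, hQ]
    rfl
  have h6 : ‖(U' * B) x‖ ≤ 1 / 2 * ‖x‖ := by
    rw [norm_neg] at hX
    exact (U' * B).le_of_opNorm_le hX x
  have h7 : ‖U' y‖ ≤ ‖y‖ := by simpa using U'.le_of_opNorm_le hn y
  have h8 : ‖x‖ ≤ ‖U' y‖ + ‖(U' * B) x‖ := by
    have : x = U' y - (U' * B) x := by rw [h3, add_sub_cancel_right]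
    conv_lhs => rw [this]
    exact norm_sub_le _ _
  linarith

variable {X ι W : Type*} [MeasurableSpace X] {μ : Measure X} [NormedAddCommGroup W]
  [InnerProductSpace ℂ W] [CompleteSpace W] {J δ : W →L[ℂ] Lp ℂ 2 μ}
  {e : HilbertBasis ι ℂ (Lp ℂ 2 μ)} {w : ι → W} {a d : ι → ℝ}

/-- The eigenvalues of the free operator with quasimomentum `(π + iτ) b₁ + ξ`. -/
noncomputable def twistedEigenvalue (a d : ι → ℝ) (τ : ℝ) (i : ι) : ℂ :=
  a i - (τ : ℂ) ^ 2 + 2 * Complex.I * τ * d i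

theorem twistedForm_left (hJ : ∀ i, J (w i) = e i)
    (hw : ∀ i z, inner ℂ (w i) z = (1 + a i) * inner ℂ (e i) (J z))
    (hδ : ∀ i, δ (w i) = (Complex.I * d i) • e i)
    (hs : ∀ w z, inner ℂ (J z) (δ w) = - inner ℂ (δ z) (J w)) (τ : ℝ) (i : ι) (z : W) :
    twistedForm J δ τ (w i) z = twistedEigenvalue a d τ i * inner ℂ (J z) (e i) := by
  have h1 : inner ℂ z (w i) = (1 + a i) * inner ℂ (J z) (e i) := by
    rw [← inner_conj_symm, hw, map_mul, inner_conj_symm]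
    simp
  have h2 := hs (w i) z
  rw [hδ, inner_smul_right, hJ] at h2
  rw [twistedForm, h1, hJ, hδ, inner_smul_right, ← neg_eq_iff_eq_neg.2 h2, twistedEigenvalue]
  ring

theorem twistedForm_right (hJ : ∀ i, J (w i) = e i)
    (hw : ∀ i z, inner ℂ (w i) z = (1 + a i) * inner ℂ (e i) (J z))
    (hδ : ∀ i, δ (w i) = (Complex.I * d i) • e i)
    (hs : ∀ w z, inner ℂ (J z) (δ w) = - inner ℂ (δ z) (J w)) (τ : ℝ) (i : ι) (z : W) :
    twistedForm J δ τ z (w i) = twistedEigenvalue a d τ i * inner ℂ (e i) (J z) := by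
  have h2 := hs z (w i)
  rw [hJ] at h2
  rw [twistedForm, hw, hJ, h2, hδ, inner_smul_left, twistedEigenvalue]
  simp
  ring

/-- `H u = f` for the operator of the form `twistedForm + V`. -/
def SolvesWeakly (J δ : W →L[ℂ] Lp ℂ 2 μ) (τ : ℝ) (V : X → ℝ) (u f : Lp ℂ 2 μ) : Prop :=
  ∃ w : W, J w = u ∧ ∀ z : W, Integrable (fun x => (V x : ℂ) * u x * conj (J z x)) μ ∧
    twistedForm J δ τ w z + ∫ x, (V x : ℂ) * u x * conj (J z x) ∂μ = inner ℂ (J z) f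

/-- The resolvent, for a potential `V = lam + p₂ p̄₁` such that the products of `p₁` and `p₂` with
the square root `G` of the modulus of the free resolvent are small. With the unitary part `U` of the
free operator, `H - lam = G⁻¹ (U + Y₁† Y₂) G⁻¹` in the sense of forms, so that the resolvent is
`R = G (U + Y₁† Y₂)⁻¹ G`. -/
theorem exists_resolvent (hJ : ∀ i, J (w i) = e i)
    (hw : ∀ i z, inner ℂ (w i) z = (1 + a i) * inner ℂ (e i) (J z))
    (hδ : ∀ i, δ (w i) = (Complex.I * d i) • e i)
    (hs : ∀ w z, inner ℂ (J z) (δ w) = - inner ℂ (δ z) (J w)) (ha : ∀ i, 0 ≤ a i) (τ : ℝ)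
    (hl : ∀ i, twistedEigenvalue a d τ i ≠ 0) {K : ℝ} (hK : 0 ≤ K)
    (hK1 : ∀ i, 1 + a i ≤ K * ‖twistedEigenvalue a d τ i‖)
    (hK2 : ∀ i, ‖twistedEigenvalue a d τ i‖ ≤ K * (1 + a i))
    {V : X → ℝ} {lam : ℂ} {p₁ p₂ : X → ℂ} (hV : ∀ x, (V x : ℂ) = lam + p₂ x * conj (p₁ x))
    {G Y₁ Y₂ : Lp ℂ 2 μ →L[ℂ] Lp ℂ 2 μ}
    (hG : ∀ i, G (e i) = (((Real.sqrt ‖twistedEigenvalue a d τ i‖)⁻¹ : ℝ) : ℂ) • e i)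
    (hY₁ : ∀ c, ⇑(Y₁ c) =ᵐ[μ] fun x => p₁ x * G c x)
    (hY₂ : ∀ c, ⇑(Y₂ c) =ᵐ[μ] fun x => p₂ x * G c x) (hY : ‖Y₁‖ * ‖Y₂‖ ≤ 1 / 2) :
    ∃ R : Lp ℂ 2 μ →L[ℂ] Lp ℂ 2 μ, ‖R‖ ≤ 2 * ‖G‖ ^ 2 ∧
      (∀ u f₁ f₂, SolvesWeakly J δ τ V u f₁ → SolvesWeakly J δ τ V u f₂ → f₁ = f₂) ∧
      (∀ f, SolvesWeakly J δ τ V (R f) (f + lam • R f)) ∧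
      ∀ u f, SolvesWeakly J δ τ V u f → R (f - lam • u) = u := by
  set ev := twistedEigenvalue a d τ
  have hr : ∀ i, 0 < ‖ev i‖ := fun i => norm_pos_iff.2 (hl i)
  set ρ : ι → ℝ := fun i => (Real.sqrt ‖ev i‖)⁻¹
  have hρ : ∀ i, ρ i ^ 2 * ‖ev i‖ = 1 := fun i => by
    simp only [ρ, inv_pow, Real.sq_sqrt (norm_nonneg _)]
    exact inv_mul_cancel₀ (hr i).ne'
  have hρ0 : ∀ i, (ρ i : ℂ) ≠ 0 := fun i =>
    Complex.ofReal_ne_zero.2 (inv_ne_zero (Real.sqrt_ne_zero'.2 (hr i)))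
  have hρc : ∀ i, (ρ i : ℂ) ^ 2 * (‖ev i‖ : ℂ) = 1 := fun i => by exact_mod_cast hρ i
  have hwn : ∀ i, ‖w i‖ ^ 2 = 1 + a i := fun i => by
    rw [← inner_self_eq_norm_sq (𝕜 := ℂ), hw, hJ, inner_self_eq_norm_sq_to_K, e.orthonormal.1 i]
    simp
  have ha0 : ∀ i, (1 + a i : ℂ) ≠ 0 := fun i => by
    have : (0 : ℝ) < 1 + a i := by linarith [ha i]
    exact_mod_cast this.ne'
  -- the diagonal operator with values in the form space
  obtain ⟨S, hS, -⟩ := exists_clm_of_orthogonal e (fun i => (ρ i : ℂ) • w i) (Real.sqrt_nonneg K)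
    (fun i j hij => by
      rw [inner_smul_left, inner_smul_right, hw, hJ, e.orthonormal.2 hij]; simp)
    (fun i => by
      rw [Real.sq_sqrt hK, norm_smul, mul_pow, hwn, Complex.norm_real, Real.norm_eq_abs, sq_abs]
      calc ρ i ^ 2 * (1 + a i) ≤ ρ i ^ 2 * (K * ‖ev i‖) :=
            mul_le_mul_of_nonneg_left (hK1 i) (sq_nonneg _)
        _ = K * (ρ i ^ 2 * ‖ev i‖) := by ring
        _ = K := by rw [hρ, mul_one])
  -- `N` is chosen such that `G N S† = J`
  obtain ⟨N, hN, -⟩ := exists_diagonal e (fun i => (‖ev i‖ : ℂ) / (1 + a i)) hK fun i => by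
    have h1 : (0 : ℝ) < 1 + a i := by linarith [ha i]
    have h2 : ((‖ev i‖ : ℂ) / (1 + a i)) = ((‖ev i‖ / (1 + a i) : ℝ) : ℂ) := by push_cast; rfl
    rw [h2, Complex.norm_real, Real.norm_eq_abs, abs_of_nonneg (div_nonneg (norm_nonneg _) h1.le),
      div_le_iff₀ h1]
    exact hK2 i
  obtain ⟨U, hU, -⟩ := exists_diagonal e (fun i => ev i / ‖ev i‖) zero_le_one fun i => by
    rw [norm_div, Complex.norm_real, norm_norm, div_self (hr i).ne']
  have hJS : J ∘L S = G := clm_ext_basis e fun i => by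
    change J (S (e i)) = G (e i)
    rw [hS, map_smul, hJ, hG]
  have hJS' : ∀ c, J (S c) = G c := fun c => congrArg (fun L => L c) hJS
  -- every element of the form domain is in the range of `G`, with an explicit preimage
  have hGc : ∀ z, G (N (S.adjoint z)) = J z := fun z => by
    refine ext_inner_basis e fun i => ?_
    rw [inner_diagonal e hG, inner_diagonal e hN, ContinuousLinearMap.adjoint_inner_right, hS,
      inner_smul_left, hw, Complex.conj_ofReal]
    calc _ = ((ρ i : ℂ) ^ 2 * (‖ev i‖ : ℂ)) * ((1 + a i) / (1 + a i)) * inner ℂ (e i) (J z) := by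
          simp only [ρ, ev]; ring
      _ = _ := by rw [hρc, div_self (ha0 i), one_mul, one_mul]
  -- the form of the potential on the range of `G`
  have hpair : ∀ c c' u v, G c = u → G c' = v →
      Integrable (fun x => (V x : ℂ) * u x * conj (v x)) μ ∧
      ∫ x, (V x : ℂ) * u x * conj (v x) ∂μ = inner ℂ (Y₁ c') (Y₂ c) + lam * inner ℂ v u := by
    rintro c c' u v rfl rfl
    have h1 : Integrable (fun x => inner ℂ (Y₁ c' x) (Y₂ c x)) μ := L2.integrable_inner _ _
    have h2 : Integrable (fun x => inner ℂ (G c' x) (G c x)) μ := L2.integrable_inner _ _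
    have h3 : (fun x => inner ℂ (Y₁ c' x) (Y₂ c x) + lam * inner ℂ (G c' x) (G c x)) =ᵐ[μ]
        fun x => (V x : ℂ) * G c x * conj (G c' x) := by
      filter_upwards [hY₁ c', hY₂ c] with x hx hx'
      rw [hx, hx', hV, RCLike.inner_apply, RCLike.inner_apply, map_mul]
      ring
    refine ⟨(h1.add (h2.const_mul lam)).congr h3, ?_⟩
    rw [← integral_congr_ae h3, integral_add h1 (h2.const_mul lam), integral_const_mul,
      L2.inner_def, L2.inner_def]
  have hB : ‖Y₁.adjoint ∘L Y₂‖ ≤ 1 / 2 := by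
    refine (ContinuousLinearMap.opNorm_comp_le _ _).trans ?_
    rwa [LinearIsometryEquiv.norm_map]
  obtain ⟨A, hA1, hA2, hAn⟩ := exists_inverse_diagonal_add e
    (fun i => by rw [norm_div, Complex.norm_real, norm_norm, div_self (hr i).ne']) hU hB
  -- a solution is `u = G c`, where `c` satisfies an equation with a bounded invertible operator
  have key : ∀ u f, SolvesWeakly J δ τ V u f →
      ∃ c, G c = u ∧ U c + (Y₁.adjoint ∘L Y₂) c = G (f - lam • u) := by
    rintro u f ⟨z, rfl, hz⟩
    refine ⟨_, hGc z, ext_inner_basis e fun i => ?_⟩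
    set c := N (S.adjoint z)
    have h1 : G ((ρ i : ℂ)⁻¹ • e i) = J (w i) := by
      rw [map_smul, hG, smul_smul, hJ, inv_mul_cancel₀ (hρ0 i), one_smul]
    have h2 := (hz (w i)).2
    rw [twistedForm_right hJ hw hδ hs, (hpair _ _ _ _ (hGc z) h1).2, hJ, map_smul,
      inner_smul_left, ← hGc z, inner_diagonal e hG, map_inv₀, Complex.conj_ofReal] at h2
    rw [inner_add_right, inner_diagonal e hU, inner_diagonal e hG, inner_sub_right,
      inner_smul_right, ← hGc z, inner_diagonal e hG, ← h2, ContinuousLinearMap.comp_apply,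
      ContinuousLinearMap.adjoint_inner_right]
    change _ = (ρ i : ℂ) * (ev i * ((ρ i : ℂ) * inner ℂ (e i) c) +
      ((ρ i : ℂ)⁻¹ * inner ℂ (Y₁ (e i)) (Y₂ c) + lam * ((ρ i : ℂ) * inner ℂ (e i) c)) -
        lam * ((ρ i : ℂ) * inner ℂ (e i) c))
    have h3 : ev i / ‖ev i‖ = ρ i ^ 2 * ev i := by
      rw [div_eq_iff (by exact_mod_cast (hr i).ne'), mul_right_comm, hρc, one_mul]
    rw [h3]
    have h4 := mul_inv_cancel₀ (hρ0 i)
    linear_combination (-inner ℂ (Y₁ (e i)) (Y₂ c)) * h4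
  refine ⟨G ∘L A ∘L G, ?_, ?_, ?_, ?_⟩
  · refine (ContinuousLinearMap.opNorm_comp_le _ _).trans ?_
    refine (mul_le_mul_of_nonneg_left ((ContinuousLinearMap.opNorm_comp_le _ _).trans
      (mul_le_mul_of_nonneg_right hAn (norm_nonneg _))) (norm_nonneg _)).trans (le_of_eq ?_)
    ring
  · intro u f₁ f₂ h₁ h₂
    obtain ⟨c₁, hc₁, e₁⟩ := key u f₁ h₁
    obtain ⟨c₂, hc₂, e₂⟩ := key u f₂ h₂
    have hinj : ∀ x y, G x = G y → x = y := fun x y hxy => by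
      refine ext_inner_basis e fun i => mul_left_cancel₀ (hρ0 i) ?_
      rw [← inner_diagonal e hG, ← inner_diagonal e hG, hxy]
    have h3 := hinj _ _ (hc₁.trans hc₂.symm)
    rw [h3, e₂] at e₁
    exact (sub_left_injective (hinj _ _ e₁)).symm
  · intro f
    set c := A (G f)
    have hc : U c + (Y₁.adjoint ∘L Y₂) c = G f := hA2 (G f)
    change SolvesWeakly J δ τ V (G c) (f + lam • G c)
    refine ⟨S c, hJS' c, fun z => ?_⟩
    obtain ⟨h1, h2⟩ := hpair _ _ _ _ (rfl : G c = G c) (hGc z)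
    refine ⟨h1, ?_⟩
    set c' := N (S.adjoint z)
    have h3 : twistedForm J δ τ (S c) z = inner ℂ c' (U c) := by
      -- both sides are continuous and linear in `c`
      let L : W →L[ℂ] ℂ := innerSL ℂ z - (1 + (τ : ℂ) ^ 2) • (innerSL ℂ (J z) ∘L J) +
        (τ : ℂ) • (innerSL ℂ (J z) ∘L δ - innerSL ℂ (δ z) ∘L J)
      have hL : ∀ x, L x = twistedForm J δ τ x z := fun x => rfl
      have h4 : L ∘L S = innerSL ℂ c' ∘L U := clm_ext_basis e fun i => by
        change L (S (e i)) = inner ℂ c' (U (e i))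
        rw [hS, map_smul, hL, twistedForm_left hJ hw hδ hs, hU, inner_smul_right, ← hGc z]
        have h5 : inner ℂ (G c') (e i) = ρ i * inner ℂ c' (e i) := by
          rw [← inner_conj_symm, inner_diagonal e hG, map_mul, inner_conj_symm,
            Complex.conj_ofReal]
        have h3 : ev i / ‖ev i‖ = ρ i ^ 2 * ev i := by
          rw [div_eq_iff (by exact_mod_cast (hr i).ne'), mul_right_comm, hρc, one_mul]
        rw [h5, h3, smul_eq_mul]
        ring
      rw [← hL]
      exact congrArg (fun L => L c) h4
    rw [h2, h3, inner_add_right, inner_smul_right, ← add_assoc]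
    congr 1
    have h6 : inner ℂ (J z) f = inner ℂ c' (G f) := by
      have h7 : inner ℂ (G c') f = inner ℂ c' (G f) := by
        have : ∀ x y, inner ℂ (G x) y = inner ℂ x (G y) := by
          intro x y
          have h8 : G.adjoint = G := clm_ext_basis e fun i => by
            refine ext_inner_basis e fun j => ?_
            rw [ContinuousLinearMap.adjoint_inner_right, inner_diagonal e hG, hG, inner_smul_left,
              Complex.conj_ofReal]
          conv_lhs => rw [← h8]
          rw [ContinuousLinearMap.adjoint_inner_left]
        exact this _ _
      rw [← hGc z, h7]
    rw [h6, ← hc, inner_add_right, ContinuousLinearMap.comp_apply,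
      ContinuousLinearMap.adjoint_inner_right]
  · intro u f h
    obtain ⟨c, hc, h1⟩ := key u f h
    change G (A (G (f - lam • u))) = u
    rw [← h1, hA1, hc]

end Resolvent

/-! ### Lower bounds for the twisted eigenvalues -/

section Scalar

variable {ι : Type*} {a d : ι → ℝ} {τ : ℝ} {i : ι}

theorem abs_sub_sq_le_norm_twistedEigenvalue :
    |a i - |τ| ^ 2| ≤ ‖twistedEigenvalue a d τ i‖ := by
  refine le_trans (le_of_eq ?_) (Complex.abs_re_le_norm _)
  simp [twistedEigenvalue, pow_two]

/-- The imaginary part of the quasimomentum keeps the eigenvalues away from zero, since the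
momentum along `b₁` is at least `π` in modulus. -/
theorem six_mul_le_norm_twistedEigenvalue (hd : Real.pi ≤ |d i|) :
    6 * |τ| ≤ ‖twistedEigenvalue a d τ i‖ := by
  have h1 : |2 * τ * d i| ≤ ‖twistedEigenvalue a d τ i‖ := by
    refine le_trans (le_of_eq ?_) (Complex.abs_im_le_norm _)
    simp [twistedEigenvalue, pow_two]
  rw [abs_mul, abs_mul, abs_two] at h1
  nlinarith [Real.pi_gt_three, abs_nonneg τ]

theorem one_add_le_mul_norm_twistedEigenvalue (hτ : 1 ≤ |τ|) (hd : Real.pi ≤ |d i|) :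
    1 + a i ≤ (1 + |τ|) ^ 2 * ‖twistedEigenvalue a d τ i‖ := by
  have h1 := abs_sub_sq_le_norm_twistedEigenvalue (a := a) (d := d) (τ := τ) (i := i)
  have h2 := six_mul_le_norm_twistedEigenvalue (a := a) (τ := τ) hd
  have h3 := le_abs_self (a i - |τ| ^ 2)
  nlinarith [mul_le_mul_of_nonneg_left h2 (abs_nonneg τ), norm_nonneg (twistedEigenvalue a d τ i),
    mul_nonneg (sq_nonneg |τ|) (norm_nonneg (twistedEigenvalue a d τ i))]

theorem norm_twistedEigenvalue_le (ha : 0 ≤ a i) (hd : d i ^ 2 ≤ 1 + a i) :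
    ‖twistedEigenvalue a d τ i‖ ≤ (1 + |τ|) ^ 2 * (1 + a i) := by
  have h1 : |d i| ≤ 1 + a i := abs_le_of_sq_le_sq (by nlinarith) (by linarith)
  have h2 : ‖twistedEigenvalue a d τ i‖ ≤ a i + |τ| ^ 2 + 2 * |τ| * |d i| := by
    refine (norm_add_le _ _).trans (add_le_add ((norm_sub_le _ _).trans (le_of_eq ?_))
      (le_of_eq ?_))
    · simp [abs_of_nonneg ha]
    · simp
  nlinarith [mul_le_mul_of_nonneg_left h1 (abs_nonneg τ), mul_nonneg (sq_nonneg |τ|) ha]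

/-- On the `l`-th spectral cluster the real part of the twisted eigenvalue is comparable with
`(l - |τ|) (l + |τ|)` unless `l` is close to `|τ|`; there the imaginary part takes over. -/
theorem cluster_le_norm_twistedEigenvalue (hτ : 1 ≤ |τ|) (hd : Real.pi ≤ |d i|) {l : ℝ}
    (h1 : (l - 1) ^ 2 ≤ a i) (h2 : a i ≤ l ^ 2) (hl : 1 ≤ l) :
    (1 + |l - (|τ|)|) * (l + |τ|) ≤ 6 * ‖twistedEigenvalue a d τ i‖ := by
  have ha : 0 ≤ a i := (sq_nonneg _).trans h1
  have h3 := abs_sub_sq_le_norm_twistedEigenvalue (a := a) (d := d) (τ := τ) (i := i)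
  have h4 := six_mul_le_norm_twistedEigenvalue (a := a) (τ := τ) hd
  set n := ‖twistedEigenvalue a d τ i‖
  set t := |τ|
  obtain ⟨s, hs, has⟩ : ∃ s, 0 ≤ s ∧ a i = s ^ 2 :=
    ⟨√(a i), Real.sqrt_nonneg _, (Real.sq_sqrt ha).symm⟩
  rw [has] at h1 h2 h3
  have h5 : l - 1 ≤ s := le_of_sq_le_sq h1 hs
  have h6 : s ≤ l := le_of_sq_le_sq h2 (by linarith)
  have h7 : |s ^ 2 - t ^ 2| = |s - t| * (s + t) := by
    rw [← abs_of_nonneg (add_nonneg hs (abs_nonneg τ)), ← abs_mul]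
    congr 1
    ring
  rw [h7] at h3
  have h8 : |l - t| ≤ 1 + |s - t| := by
    rw [abs_le]
    have := neg_abs_le (s - t)
    have := le_abs_self (s - t)
    constructor <;> linarith
  have h9 : (1 + |l - t|) * (l + t) ≤ (2 + |s - t|) * (2 * (s + t)) :=
    mul_le_mul (by linarith) (by linarith) (by linarith) (by positivity)
  have h10 : 4 * (s + t) ≤ 4 * n := by
    rcases le_total s (2 * t) with h | h
    · linarith
    · have : 1 ≤ |s - t| := le_trans (by linarith) (le_abs_self _)
      nlinarith
  linarith

/-- The summation over the clusters which uses the gain `ε` of condition `A(q)`. With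
`x = 1 + |l - t|` one has `l ≤ l + t`, `x ≤ l + t` and `t ≤ l + t`, hence
`l ^ (1 - 2ε) / (x (l + t)) ≤ x ^ (-1 - ε) t ^ (-ε)`, and the sum of `x ^ (-1 - ε)` over `l` is
bounded uniformly in `t`. -/
theorem exists_sum_cluster_le {ε : ℝ} (hε : 0 < ε) (hε' : ε ≤ 1 / 4) :
    ∃ C : ℝ, 0 ≤ C ∧ ∀ t : ℝ, 1 ≤ t → ∀ s : Finset ℕ,
      ∑ l ∈ s, ((l : ℝ) ^ (1 / 2 - ε)) ^ 2 * (6 / ((1 + |(l : ℝ) - t|) * (l + t))) ≤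
        C * t ^ (-ε) := by
  -- a summable majorant of `x ^ (-1 - ε)`, in terms of `j = l - ⌊t⌋`
  let f : ℤ → ℝ := fun j => |(j : ℝ)| ^ (-(1 + ε)) + if j = 0 then 1 else 0
  have hf0 : ∀ j, 0 ≤ f j := fun j => add_nonneg (by positivity) (by split_ifs <;> norm_num)
  have hf : Summable f := (Real.summable_abs_int_rpow (by linarith)).add
    (summable_of_hasFiniteSupport ((Set.finite_singleton (0 : ℤ)).subset fun j hj => by
      by_contra h
      exact hj (if_neg h)))
  refine ⟨6 * ∑' j, f j, by positivity, fun t ht s => ?_⟩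
  have hterm : ∀ l : ℕ, ((l : ℝ) ^ (1 / 2 - ε)) ^ 2 * (6 / ((1 + |(l : ℝ) - t|) * (l + t))) ≤
      6 * f ((l : ℤ) - ⌊t⌋) * t ^ (-ε) := by
    intro l
    have ht0 : 0 < t := by linarith
    -- the term with `l = 0` vanishes, because `1 / 2 - ε > 0`
    rcases Nat.eq_zero_or_pos l with rfl | hl
    · rw [Nat.cast_zero, Real.zero_rpow (by linarith)]
      have := hf0 (((0 : ℕ) : ℤ) - ⌊t⌋)
      simp only [ne_eq, OfNat.ofNat_ne_zero, not_false_eq_true, zero_pow, zero_mul]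
      positivity
    have hl1 : (1 : ℝ) ≤ l := by exact_mod_cast hl
    set x : ℝ := 1 + |(l : ℝ) - t|
    have hx : 1 ≤ x := le_add_of_nonneg_right (abs_nonneg _)
    have hxl : x ≤ l + t := by
      have : |(l : ℝ) - t| ≤ l + t - 1 := abs_le.2 ⟨by linarith, by linarith⟩
      simp only [x]; linarith
    have hlt : 0 < (l : ℝ) + t := by linarith
    have e1 : ((l : ℝ) ^ (1 / 2 - ε)) ^ 2 ≤ ((l : ℝ) + t) * (x ^ (-ε) * t ^ (-ε)) := by
      have e2 : ((l : ℝ) ^ (1 / 2 - ε)) ^ 2 ≤ (((l : ℝ) + t) ^ (1 / 2 - ε)) ^ 2 :=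
        pow_le_pow_left₀ (by positivity)
          (Real.rpow_le_rpow (by positivity) (by linarith) (by linarith)) 2
      have e3 : (((l : ℝ) + t) ^ (1 / 2 - ε)) ^ 2 =
          ((l : ℝ) + t) * (((l : ℝ) + t) ^ (-ε) * ((l : ℝ) + t) ^ (-ε)) := by
        rw [← Real.rpow_natCast, ← Real.rpow_mul hlt.le, ← Real.rpow_add hlt]
        nth_rewrite 2 [← Real.rpow_one ((l : ℝ) + t)]
        rw [← Real.rpow_add hlt]
        congr 1
        push_cast
        ring
      rw [e3] at e2
      refine e2.trans (mul_le_mul_of_nonneg_left ?_ hlt.le)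
      exact mul_le_mul (Real.rpow_le_rpow_of_nonpos (by linarith) hxl (by linarith))
        (Real.rpow_le_rpow_of_nonpos ht0 (by linarith) (by linarith)) (by positivity)
        (by positivity)
    have e4 : x ^ (-(1 + ε)) ≤ f ((l : ℤ) - ⌊t⌋) := by
      simp only [f]
      by_cases hj : (l : ℤ) - ⌊t⌋ = 0
      · rw [if_pos hj]
        exact (Real.rpow_le_one_of_one_le_of_nonpos hx (by linarith)).trans
          (le_add_of_nonneg_left (by positivity))
      · rw [if_neg hj, add_zero]
        refine Real.rpow_le_rpow_of_nonpos (abs_pos.2 (Int.cast_ne_zero.2 hj)) ?_ (by linarith)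
        push_cast
        have h1 := Int.floor_le t
        have h2 := Int.lt_floor_add_one t
        have h3 := le_abs_self ((l : ℝ) - t)
        have h4 := neg_abs_le ((l : ℝ) - t)
        rw [abs_le]
        simp only [x]
        constructor <;> linarith
    calc ((l : ℝ) ^ (1 / 2 - ε)) ^ 2 * (6 / (x * (l + t)))
        ≤ (((l : ℝ) + t) * (x ^ (-ε) * t ^ (-ε))) * (6 / (x * (l + t))) :=
          mul_le_mul_of_nonneg_right e1 (by positivity)
      _ = 6 * x ^ (-(1 + ε)) * t ^ (-ε) := by
          rw [neg_add, Real.rpow_add (by linarith), Real.rpow_neg_one]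
          field_simp
      _ ≤ _ := by gcongr
  have hinj : Function.Injective fun l : ℕ => (l : ℤ) - ⌊t⌋ := fun x y h => by
    simpa using h
  calc _ ≤ ∑ l ∈ s, 6 * f ((l : ℤ) - ⌊t⌋) * t ^ (-ε) := Finset.sum_le_sum fun l _ => hterm l
    _ = 6 * (∑ j ∈ s.map ⟨_, hinj⟩, f j) * t ^ (-ε) := by
        rw [Finset.sum_map, Finset.mul_sum, Finset.sum_mul]; rfl
    _ ≤ _ := by
        have := hf.sum_le_tsum (s.map ⟨_, hinj⟩) fun j _ => hf0 j
        gcongr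

end Scalar

/-! ### The potential as a product of two multipliers -/

/-- A function in `L_p`, `p = q / (q - 2)`, is the product of two functions in `L_{2p}`; by
Hölder's inequality these multiply `L_q` into `L₂`. -/
theorem exists_factorization {X : Type*} [MeasurableSpace X] {μ : Measure X} {q : ℝ} (hq : 2 < q)
    {Q : X → ℂ} (hQ : MemLp Q (ENNReal.ofReal (q / (q - 2))) μ) :
    ∃ (p₁ p₂ : X → ℂ) (D : ℝ), 0 ≤ D ∧ (∀ x, Q x = p₂ x * conj (p₁ x)) ∧
      ∀ p, p = p₁ ∨ p = p₂ → ∀ f : X → ℂ, MemLp f (ENNReal.ofReal q) μ →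
        MemLp (fun x => p x * f x) 2 μ ∧
          eLpNorm (fun x => p x * f x) 2 μ ≤
            ENNReal.ofReal D * eLpNorm f (ENNReal.ofReal q) μ := by
  set r : ℝ≥0∞ := ENNReal.ofReal (2 * q / (q - 2))
  have hq2 : 0 < q - 2 := by linarith
  have hq0 : 0 < q := by linarith
  have hholder : ENNReal.HolderTriple r (ENNReal.ofReal q) 2 := ⟨by
    rw [← ENNReal.ofReal_inv_of_pos (by positivity), ← ENNReal.ofReal_inv_of_pos hq0,
      ← ENNReal.ofReal_add (by positivity) (by positivity),
      ← ENNReal.ofReal_ofNat 2, ← ENNReal.ofReal_inv_of_pos two_pos]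
    congr 1
    field_simp
    ring⟩
  have hr : ENNReal.ofReal (q / (q - 2)) / ENNReal.ofReal (1 / 2) = r := by
    rw [← ENNReal.ofReal_div_of_pos (by norm_num)]
    congr 1
    field_simp
  have hsqrt : MemLp (fun x => ‖Q x‖ ^ (1 / 2 : ℝ)) r μ := by
    have := hQ.norm_rpow_div (ENNReal.ofReal (1 / 2))
    rwa [hr, ENNReal.toReal_ofReal (by norm_num)] at this
  -- where `Q = 0`, both factors vanish, as `0 / 0 = 0`
  let p₁ : X → ℂ := fun x => ((‖Q x‖ ^ (1 / 2 : ℝ) : ℝ) : ℂ)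
  let p₂ : X → ℂ := fun x => Q x / p₁ x
  have h₁ : MemLp p₁ r μ := hsqrt.ofReal
  have hsq : ∀ x, ‖Q x‖ ^ (1 / 2 : ℝ) * ‖Q x‖ ^ (1 / 2 : ℝ) = ‖Q x‖ := fun x => by
    rw [← Real.sqrt_eq_rpow, Real.mul_self_sqrt (norm_nonneg _)]
  have hn : ∀ x, ‖p₂ x‖ = ‖p₁ x‖ := fun x => by
    have h1 : ‖p₁ x‖ = ‖Q x‖ ^ (1 / 2 : ℝ) := by
      rw [Complex.norm_real, Real.norm_of_nonneg (by positivity)]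
    simp only [p₂]
    rw [norm_div, h1]
    nth_rewrite 1 [← hsq x]
    exact mul_self_div_self _
  have h₂ : MemLp p₂ r μ := h₁.congr_norm (hQ.1.aemeasurable.div h₁.1.aemeasurable
    |>.aestronglyMeasurable) (Eventually.of_forall fun x => (hn x).symm)
  have he : eLpNorm p₂ r μ = eLpNorm p₁ r μ :=
    eLpNorm_congr_norm_ae (Eventually.of_forall hn)
  refine ⟨p₁, p₂, (eLpNorm p₁ r μ).toReal, ENNReal.toReal_nonneg, fun x => ?_, fun p hp f hf => ?_⟩
  · simp only [p₂, p₁, Complex.conj_ofReal]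
    by_cases h : Q x = 0
    · rw [h]; simp
    · rw [div_mul_cancel₀]
      exact Complex.ofReal_ne_zero.2 (Real.rpow_pos_of_pos (norm_pos_iff.2 h) _).ne'
  · obtain ⟨h, he'⟩ : MemLp p r μ ∧ eLpNorm p r μ = eLpNorm p₁ r μ := by
      rcases hp with rfl | rfl
      exacts [⟨h₁, rfl⟩, ⟨h₂, he⟩]
    refine ⟨hf.mul' h, ?_⟩
    rw [ENNReal.ofReal_toReal h₁.eLpNorm_ne_top, ← he']
    have h3 := eLpNorm_smul_le_mul_eLpNorm (p := r) (q := ENNReal.ofReal q) (r := 2) hf.1 h.1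
    exact h3

section Cluster

variable {k m : ℕ} [NeZero m] {H : Type*} [TopologicalSpace H]
  {I : ModelWithCorners ℝ (EuclideanSpace ℝ (Fin k)) H}
  {M : Type*} [TopologicalSpace M] [MeasurableSpace M] [ChartedSpace H M] [IsManifold I ∞ M]
  {g : Metric I M} {b : Module.Basis (Fin m) ℝ (EuclideanSpace ℝ (Fin m))}
  {bc : BoundaryCondition} {ξ : EuclideanSpace ℝ (Fin m)}

theorem clusterProjector_eq_self {l : ℕ} {f : L2 g b} (hf : f ∈ spectralCluster g b bc ξ l) :
    clusterProjector g b bc ξ l f = f := by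
  have : CompleteSpace (spectralCluster g b bc ξ l) :=
    (Submodule.isClosed_topologicalClosure _).completeSpace_coe
  exact Submodule.starProjection_eq_self_iff.2 hf

/-- Condition `A(q)` for functions in the spectral cluster, with an exponent gain `ε` which is not
too large. -/
theorem ConditionA.exists_eLpNorm_le {q : ℝ} (hA : ConditionA g b bc q)
    (hξ : inner ℝ ξ (b 0) = 0) :
    ∃ ε : ℝ, 0 < ε ∧ ε ≤ 1 / 4 ∧ ∃ C : ℝ, 0 ≤ C ∧ ∀ l : ℕ, 1 ≤ l →
      ∀ f ∈ spectralCluster g b bc ξ l, MemLp f (ENNReal.ofReal q) (cellMeasure g b) ∧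
        eLpNorm f (ENNReal.ofReal q) (cellMeasure g b) ≤
          ENNReal.ofReal (C * (l : ℝ) ^ (1 / 2 - ε)) * eLpNorm f 2 (cellMeasure g b) := by
  obtain ⟨ε, hε, C, hC, h⟩ := hA ξ hξ
  refine ⟨min ε (1 / 4), lt_min hε (by norm_num), min_le_right _ _, C, hC.le, fun l hl f hf => ?_⟩
  have h1 := h l hl f
  rw [clusterProjector_eq_self hf] at h1
  have h2 : eLpNorm f (ENNReal.ofReal q) (cellMeasure g b) ≤
      ENNReal.ofReal (C * (l : ℝ) ^ (1 / 2 - min ε (1 / 4))) *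
        eLpNorm f 2 (cellMeasure g b) := by
    refine h1.trans ?_
    gcongr
    · exact_mod_cast hl
    · exact min_le_left _ _
  exact ⟨⟨(Lp.aestronglyMeasurable f), h2.trans_lt
    (ENNReal.mul_lt_top ENNReal.ofReal_lt_top (Lp.eLpNorm_lt_top f))⟩, h2⟩

end Cluster

end Cylinder
theorem mainTheorem4 {k m : ℕ} [NeZero m] (hd : 3 ≤ k + m)
    {H : Type*} [TopologicalSpace H]
    (I : ModelWithCorners ℝ (EuclideanSpace ℝ (Fin k)) H) (hI : Cylinder.IsBoundaryModel I)
    {M : Type*} [TopologicalSpace M] [T2Space M] [CompactSpace M]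
    [MeasurableSpace M] [BorelSpace M] [ChartedSpace H M] [IsManifold I ∞ M]
    (g : Cylinder.Metric I M)
    (b : Module.Basis (Fin m) ℝ (EuclideanSpace ℝ (Fin m))) (hb : ‖b 0‖ = 1)
    (bc : Cylinder.BoundaryCondition)
    (q : ℝ) (hq : 2 < q) (hqd : q < 2 * ((k + m : ℕ) : ℝ) / (((k + m : ℕ) : ℝ) - 2))
    (hA : Cylinder.ConditionA g b bc q)
    (V : M × EuclideanSpace ℝ (Fin m) → ℝ) (hVper : Cylinder.IsPeriodic b V)
    (hV : MemLp V (ENNReal.ofReal (q / (q - 2))) (Cylinder.cellMeasure g b))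
    (lam : ℂ) (ξ : EuclideanSpace ℝ (Fin m)) (hξ : inner ℝ ξ (b 0) = 0) :
    ∃ τ₀ : ℝ, 0 < τ₀ ∧ ∃ C : ℝ, ∀ τ : ℝ, τ₀ < |τ| →
      ∃ R : Cylinder.L2 g b →L[ℂ] Cylinder.L2 g b,
        Cylinder.IsResolvent g b bc V (Cylinder.quasimomentum b ξ τ) lam R ∧
        ‖R‖ ≤ C * |τ|⁻¹ := by
  have hμ := Cylinder.isFiniteMeasure_cellMeasure g b hI
  obtain ⟨W, _, _, _, κ, J, δ, hW⟩ := Cylinder.exists_isFormSpace b g hI hb hξ bc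
  obtain ⟨ι, e, w, a, d, ha, hJ, hw, hδ, hπ, hda, hcl⟩ := hW.exists_eigenbasis hb hξ
  obtain ⟨ε, hε, hε', A, hA0, hAl⟩ := hA.exists_eLpNorm_le hξ
  obtain ⟨S, hS0, hS⟩ := Cylinder.exists_sum_cluster_le hε hε'
  have hQ : MemLp (fun p => (V p : ℂ) - lam) (ENNReal.ofReal (q / (q - 2)))
      (Cylinder.cellMeasure g b) := hV.ofReal.sub (memLp_const lam)
  obtain ⟨p₁, p₂, D, hD, hfac, hp⟩ := Cylinder.exists_factorization hq hQ
  -- the index of the cluster which contains the eigenvalue `a i`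
  let l : ι → ℕ := fun i => ⌊Real.sqrt (a i)⌋₊ + 1
  have hl1 : ∀ i, ((l i : ℝ) - 1) ^ 2 ≤ a i := fun i => by
    have := pow_le_pow_left₀ (Nat.cast_nonneg _) (Nat.floor_le (Real.sqrt_nonneg (a i))) 2
    rw [Real.sq_sqrt (ha i)] at this
    simpa [l] using this
  have hl2 : ∀ i, a i < (l i : ℝ) ^ 2 := fun i => by
    have := pow_lt_pow_left₀ (Nat.lt_floor_add_one (Real.sqrt (a i))) (Real.sqrt_nonneg _)
      two_ne_zero
    rw [Real.sq_sqrt (ha i)] at this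
    simpa [l] using this
  have hl0 : ∀ i, (1 : ℝ) ≤ l i := fun i => by simp [l]
  let β : ℕ → ℝ := fun n => D * A * (n : ℝ) ^ (1 / 2 - ε)
  have hβ : ∀ n, 0 ≤ β n := fun n => by positivity
  -- both factors of the potential are controlled on each cluster, by Hölder and condition `A(q)`
  have hmul : ∀ p, p = p₁ ∨ p = p₂ → ∀ n, ∀ f ∈ Submodule.span ℂ (e '' {i | l i = n}),
      MemLp (fun x => p x * f x) 2 (Cylinder.cellMeasure g b) ∧
        eLpNorm (fun x => p x * f x) 2 (Cylinder.cellMeasure g b) ≤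
          ENNReal.ofReal (β n) * eLpNorm f 2 (Cylinder.cellMeasure g b) := by
    intro p hp' n f hf
    have hmem : MemLp f (ENNReal.ofReal q) (Cylinder.cellMeasure g b) ∧
        eLpNorm f (ENNReal.ofReal q) (Cylinder.cellMeasure g b) ≤
          ENNReal.ofReal (A * (n : ℝ) ^ (1 / 2 - ε)) *
            eLpNorm f 2 (Cylinder.cellMeasure g b) := by
      rcases Nat.eq_zero_or_pos n with rfl | hn
      · -- the cluster with index `0` is empty
        have h0 : {i | l i = 0} = ∅ := Set.eq_empty_of_forall_notMem fun i => Nat.succ_ne_zero _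
        rw [h0, Set.image_empty, Submodule.span_empty, Submodule.mem_bot] at hf
        have h0' : f =ᵐ[Cylinder.cellMeasure g b] 0 := by
          rw [hf]
          exact Lp.coeFn_zero ℂ 2 _
        rw [memLp_congr_ae h0', eLpNorm_congr_ae h0', eLpNorm_zero]
        exact ⟨MemLp.zero, zero_le⟩
      · refine hAl n hn f (Submodule.span_le.2 ?_ hf)
        rintro _ ⟨i, rfl, rfl⟩
        exact hcl i _ (hl1 i) (hl2 i)
    obtain ⟨h1, h2⟩ := hp p hp' f hmem.1
    refine ⟨h1, h2.trans ?_⟩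
    simp only [β]
    rw [mul_assoc D, ENNReal.ofReal_mul hD, mul_assoc]
    gcongr
    exact hmem.2
  have hlim : Tendsto (fun t : ℝ => (D * A) ^ 2 * (S * t ^ (-ε))) atTop (𝓝 0) := by
    simpa using ((tendsto_rpow_neg_atTop hε).const_mul S).const_mul ((D * A) ^ 2)
  -- beyond `t₀` the operators `p₁ G` and `p₂ G` have squared norm at most `1 / 2`
  obtain ⟨t₀, ht₀⟩ := Filter.eventually_atTop.1
    (hlim.eventually (Iic_mem_nhds (show (0 : ℝ) < 1 / 2 by norm_num)))
  refine ⟨max 1 t₀, lt_max_of_lt_left one_pos, 1, fun τ hτ => ?_⟩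
  have hτ1 : 1 ≤ |τ| := (le_max_left _ _).trans hτ.le
  have hη : (D * A) ^ 2 * (S * |τ| ^ (-ε)) ≤ 1 / 2 := ht₀ _ ((le_max_right _ _).trans hτ.le)
  set ev := Cylinder.twistedEigenvalue a d τ
  have h6 : ∀ i, 6 * |τ| ≤ ‖ev i‖ := fun i => Cylinder.six_mul_le_norm_twistedEigenvalue (hπ i)
  have hev : ∀ i, 0 < ‖ev i‖ := fun i => by linarith [h6 i]
  have hρ : ∀ i, (Real.sqrt ‖ev i‖)⁻¹ ≤ (Real.sqrt (6 * |τ|))⁻¹ := fun i =>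
    inv_anti₀ (Real.sqrt_pos.2 (by linarith)) (Real.sqrt_le_sqrt (h6 i))
  obtain ⟨G, hG, hGn⟩ := Cylinder.exists_diagonal e
    (fun i => (((Real.sqrt ‖ev i‖)⁻¹ : ℝ) : ℂ)) (C := (Real.sqrt (6 * |τ|))⁻¹) (by positivity)
    fun i => by
      rw [Complex.norm_real, Real.norm_of_nonneg (by positivity)]
      exact hρ i
  have hmulG : ∀ p, p = p₁ ∨ p = p₂ → ∃ Y : Cylinder.L2 g b →L[ℂ] Cylinder.L2 g b,
      ‖Y‖ ≤ Real.sqrt (1 / 2) ∧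
        ∀ c, ⇑(Y c) =ᵐ[Cylinder.cellMeasure g b] fun x => p x * G c x := fun p hp' =>
    Cylinder.exists_multiplier e l (t := fun n => 6 / ((1 + |(n : ℝ) - (|τ|)|) * (n + |τ|))) hβ
      (fun n => by positivity) (hmul p hp')
      (fun i => by
        have h := Cylinder.cluster_le_norm_twistedEigenvalue (a := a) (d := d) hτ1 (hπ i) (hl1 i)
          (hl2 i).le (hl0 i)
        have h0 : 0 < (1 + |(l i : ℝ) - (|τ|)|) * (l i + |τ|) := by
          have := hl0 i
          positivity
        rw [inv_pow, Real.sq_sqrt (norm_nonneg _), le_div_iff₀ h0, inv_mul_le_iff₀ (hev i)]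
        linarith)
      (fun s => by
        refine le_trans (le_of_eq ?_) ((mul_le_mul_of_nonneg_left (hS |τ| hτ1 s)
          (sq_nonneg (D * A))).trans hη)
        rw [Finset.mul_sum]
        refine Finset.sum_congr rfl fun n _ => ?_
        simp only [β]
        ring)
      hG
  obtain ⟨Y₁, hY₁n, hY₁⟩ := hmulG p₁ (Or.inl rfl)
  obtain ⟨Y₂, hY₂n, hY₂⟩ := hmulG p₂ (Or.inr rfl)
  obtain ⟨R, hRn, hR1, hR2, hR3⟩ := Cylinder.exists_resolvent hJ hw hδ hW.inner_deriv ha τ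
    (fun i => norm_pos_iff.1 (hev i)) (K := (1 + |τ|) ^ 2) (by positivity)
    (fun i => Cylinder.one_add_le_mul_norm_twistedEigenvalue hτ1 (hπ i))
    (fun i => Cylinder.norm_twistedEigenvalue_le (ha i) (hda i))
    (fun x => (add_sub_cancel _ _).symm.trans (congrArg (lam + ·) (hfac x))) hG hY₁ hY₂
    ((mul_le_mul hY₁n hY₂n (norm_nonneg _) (Real.sqrt_nonneg _)).trans
      (Real.mul_self_sqrt (by norm_num)).le)
  have hiff := hW.isSchrodinger_iff hb hξ τ V
  refine ⟨R, ⟨fun u f₁ f₂ h₁ h₂ => hR1 u f₁ f₂ ((hiff _ _).1 h₁) ((hiff _ _).1 h₂),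
    fun f => (hiff _ _).2 (hR2 f), fun u f h => hR3 u f ((hiff _ _).1 h)⟩, hRn.trans ?_⟩
  have h7 : ‖G‖ ^ 2 ≤ (6 * |τ|)⁻¹ := by
    refine (pow_le_pow_left₀ (norm_nonneg _) hGn 2).trans (le_of_eq ?_)
    rw [inv_pow, Real.sq_sqrt (by positivity)]
  rw [mul_inv] at h7
  have : 0 ≤ |τ|⁻¹ := by positivity
  linarith
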